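/- Let $\mathbb{F}_q$ be a finite field, $\mathrm{GL}_n=\mathrm{GL}_n(\mathbb{F}_q)$, and $\mathrm{UT}_n\le \mathrm{GL}_n$ the subgroup of unipotent upper triangular matrices, $n\ge 0$. *Superclass functions.* An indifference graph on $[n]=\{1,\dots,n\}$ is a simple graph such that for every edge $\{i,l\}$ with $i<l$, all $\{j,k\}$ with $i\le j<k\le l$ are edges. For such $\gamma$ let $\mathrm{UT}_\gamma=\{g\in\mathrm{UT}_n : g_{ij}=0 \text{ whenever } i<j \text{ and } \{i,j\}\in E(\gamma)\}$, and let $\mathrm{UT}_\gamma^\circ$ be the set of $g\in \mathrm{UT}_\gamma$ that lie in no $\mathrm{UT}_\sigma$ with $\sigma\supsetneq\gamma$ an indifference graph on $[n]$. These sets partition $\mathrm{UT}_n$; let $\mathsf{scf}(\mathrm{UT}_n)$ be the space of functions $\mathrm{UT}_n\to\mathbb{C}$ constant on each $\mathrm{UT}^\circ_\gamma$. Let $\mathsf{cf}(\mathrm{GL}_n)$ be the space of complex class functions on $\mathrm{GL}_n$. Put $\mathsf{scf}(\mathrm{UT}_\bullet)=\bigoplus_{n\ge0}\mathsf{scf}(\mathrm{UT}_n)$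 and $\mathsf{cf}(\mathrm{GL}_\bullet)=\bigoplus_{n\ge0}\mathsf{cf}(\mathrm{GL}_n)$. *Structure maps.* On $\mathsf{cf}(\mathrm{GL}_\bullet)$ the product and coproduct are parabolic induction and parabolic restriction: for the block upper triangular subgroup $P_{k,l}\le\mathrm{GL}_{k+l}$ with projection $P_{k,l}\to\mathrm{GL}_k\times\mathrm{GL}_l$, $\varphi\cdot\psi=\operatorname{Ind}_{P_{k,l}}^{\mathrm{GL}_{k+l}}\operatorname{Inf}(\varphi\times\psi)$, and the $(k,l)$ component of the coproduct is restriction to $P_{k,l}$ followed by deflation (averaging over the fibres of the projection). On $\mathsf{scf}(\mathrm{UT}_\bullet)$ the product of $\varphi\in\mathsf{scf}(\mathrm{UT}_m)$ and $\psi\in\mathsf{scf}(\mathrm{UT}_n)$ is the inflation of $\varphi\times\psi$ along the projection $\mathrm{UT}_{m+n}\to\mathrm{UT}_m\times\mathrm{UT}_n$ onto diagonal blocks, and the coproduct of $\varphi\in\mathsf{scf}(\mathrm{UT}_n)$ is the sum over $I\subseteq[n]$, with complement $J$, of the element of $\mathsf{scf}(\mathrm{UT}_{|I|})\otimes\mathsf{scf}(\mathrm{UT}_{|J|})$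 obtained by restricting $\varphi$ to $\{g\in\mathrm{UT}_n : g_{ji}=0 \text{ for } j\in J,\ i\in I\}$ and averaging over the fibres of $g\mapsto (g|_{I\times I},g|_{J\times J})$, the blocks being identified with elements of $\mathrm{UT}_{|I|}$ and $\mathrm{UT}_{|J|}$ by the order preserving numberings of $I$ and $J$. In both cases the unit is the constant function $1$ in degree $0$, and the counit is evaluation at the identity in degree $0$ and zero in positive degrees. *Functionals and induction.* With $\langle\psi,\chi\rangle=|G|^{-1}\sum_{g\in G}\psi(g)\overline{\chi(g)}$, let $|\mathrm{reg}_\bullet\rangle$ be the functional on $\mathsf{scf}(\mathrm{UT}_\bullet)$ given by $\psi\mapsto\langle\psi,\mathrm{reg}_{\mathrm{UT}_n}\rangle$ in degree $n$, where $\mathrm{reg}_{\mathrm{UT}_n}$ is the regular character, and $|\mathrm{St}_\bullet\rangle$ the functional on $\mathsf{cf}(\mathrm{GL}_\bullet)$ given by $\psi\mapsto\langle\psi,\mathrm{St}_n\rangle$ in degree $n$, where $\mathrm{St}_n=\sum_{\alpha\vDash n}(-1)^{n-\ell(\alpha)}\operatorname{Ind}_{P_\alpha}^{\mathrm{GL}_n}(\mathbb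 1)$ is the Steinberg character ($\alpha$ runs over the compositions of $n$ and $P_\alpha$ is the standard block upper triangular parabolic subgroup). Let $\operatorname{Ind}_{\mathrm{UT}}^{\mathrm{GL}}:\mathsf{scf}(\mathrm{UT}_\bullet)\to\mathsf{cf}(\mathrm{GL}_\bullet)$ be induction from $\mathrm{UT}_n$ to $\mathrm{GL}_n$ in each degree. A linear character of a Hopf algebra over $\mathbb{C}$ is an algebra homomorphism to $\mathbb{C}$; a combinatorial Hopf algebra (CHA) is a graded connected Hopf algebra over $\mathbb{C}$ with a linear character; a CHA morphism $(H,\zeta)\to(H',\zeta')$ between CHAs is a graded Hopf algebra homomorphism $\Psi$ with $\zeta=\zeta'\circ\Psi$. **Theorem.** The functional $|\mathrm{reg}_\bullet\rangle$ is a linear character of $\mathsf{scf}(\mathrm{UT}_\bullet)$; moreover $$|\mathrm{reg}_\bullet\rangle=|\mathrm{St}_\bullet\rangle\circ\operatorname{Ind}_{\mathrm{UT}}^{\mathrm{GL}},$$ and $\operatorname{Ind}_{\mathrm{UT}}^{\mathrm{GL}}$ is a CHA morphism $\big(\mathsf{scf}(\mathrm{UT}_\bullet),|\mathrm{reg}_\bullet\rangle\big)\to\big(\mathsf{cf}(\mathrm{GL}_\bullet),|\mathrm{St}_\bullet\rangle\big)$.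 In particular both of these pairs are CHAs. -/

import Mathlib

open scoped TensorProduct DirectSum
open scoped Classical

noncomputable section

set_option linter.unusedSectionVars false

/-! ### Class functions -/

/-- The complex functions on `G` that are constant on the classes of `r`. -/
def classSpace {G : Type*} (r : Setoid G) : Submodule ℂ (G → ℂ) where
  carrier := {φ | ∀ g h, r g h → φ g = φ h}
  zero_mem' := fun _ _ _ => rfl
  add_mem' := fun {φ ψ} hφ hψ g h e => by simp only [Pi.add_apply, hφ g h e, hψ g h e]
  smul_mem' := fun c φ hφ g h e => by simp only [Pi.smul_apply, hφ g h e]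

/-- The class functions on a group `G`. -/
abbrev classFun (G : Type*) [Group G] : Submodule ℂ (G → ℂ) :=
  classSpace (IsConj.setoid G)

/-- The inner product `⟨ψ, χ⟩ = |G|⁻¹ ∑_g ψ(g) conj (χ(g))`, as a linear functional of `ψ`. -/
def ket {G : Type*} [Fintype G] (χ : G → ℂ) : (G → ℂ) →ₗ[ℂ] ℂ where
  toFun ψ := (Fintype.card G : ℂ)⁻¹ * ∑ g, ψ g * (starRingEnd ℂ) (χ g)
  map_add' ψ ψ' := by simp only [Pi.add_apply, add_mul, Finset.sum_add_distrib, mul_add]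
  map_smul' c ψ := by
    simp only [Pi.smul_apply, smul_eq_mul, RingHom.id_apply, mul_assoc]
    rw [← Finset.mul_sum, mul_left_comm]

/-- The character of the regular representation of `G`. -/
def regChar (G : Type*) [Group G] : G → ℂ :=
  (Representation.leftRegular ℂ G).character

/-- The class function on `G` induced from a function `φ` on a subgroup `H`:
`g ↦ |H|⁻¹ ∑_x φ(x⁻¹ g x)`, the sum over all `x ∈ G` with `x⁻¹ g x ∈ H`. -/
def induce {G : Type*} [Group G] [Fintype G] (H : Subgroup G) :
    (H → ℂ) →ₗ[ℂ] classFun G where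
  toFun φ := ⟨fun g => (Fintype.card H : ℂ)⁻¹ *
      ∑ x : G, if h : x⁻¹ * g * x ∈ H then φ ⟨x⁻¹ * g * x, h⟩ else 0, by
    intro g g' hg
    obtain ⟨c, rfl⟩ := isConj_iff.1 (show IsConj g g' from hg)
    refine congrArg _ (Fintype.sum_equiv (Equiv.mulLeft c) _ _ fun x => ?_)
    have e : (c * x)⁻¹ * (c * g * c⁻¹) * (c * x) = x⁻¹ * g * x := by group
    simp only [Equiv.coe_mulLeft, e]⟩
  map_add' φ ψ := by
    ext g
    simp only [Submodule.coe_add, Pi.add_apply, ← mul_add, ← Finset.sum_add_distrib]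
    congr 1
    refine Finset.sum_congr rfl fun x _ => ?_
    split_ifs <;> simp
  map_smul' c φ := by
    ext g
    simp only [Submodule.coe_smul, Pi.smul_apply, smul_eq_mul, RingHom.id_apply,
      Finset.mul_sum]
    refine Finset.sum_congr rfl fun x _ => ?_
    split_ifs
    · ring
    · simp

/-- Averaging along the fibres of a map `π`.  When `π` is a surjective group homomorphism this is
the deflation (the character of the coinvariants under `ker π`). -/
def deflate {X Y : Type*} [Fintype X] (π : X → Y) : (X → ℂ) →ₗ[ℂ] (Y → ℂ) where
  toFun φ y := (∑ x with π x = y, φ x) / (Finset.card {x | π x = y} : ℂ)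
  map_add' φ ψ := by
    ext y
    simp only [Pi.add_apply, Finset.sum_add_distrib, add_div]
  map_smul' c φ := by
    ext y
    simp only [Pi.smul_apply, smul_eq_mul, RingHom.id_apply, ← Finset.mul_sum, mul_div_assoc]

theorem deflate_congr {X Y : Type*} [Fintype X] {π : X → Y} {φ : X → ℂ} {y y' : Y}
    (T T' : X → X) (h₁ : ∀ x, π x = y → π (T x) = y') (h₂ : ∀ x, π x = y' → π (T' x) = y)
    (h₃ : ∀ x, π x = y → T' (T x) = x) (h₄ : ∀ x, π x = y' → T (T' x) = x)
    (h₅ : ∀ x, π x = y → φ x = φ (T x)) : deflate π φ y = deflate π φ y' := by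
  have hs : (∑ x with π x = y, φ x) = ∑ x with π x = y', φ x :=
    Finset.sum_nbij' T T' (by simpa using h₁) (by simpa using h₂) (by simpa using h₃)
      (by simpa using h₄) (by simpa using h₅)
  have hc : Finset.card {x | π x = y} = Finset.card {x | π x = y'} :=
    Finset.card_nbij' T T' (by simpa [Set.MapsTo] using h₁) (by simpa [Set.MapsTo] using h₂)
      (by simpa [Set.LeftInvOn] using h₃) (by simpa [Set.RightInvOn, Set.LeftInvOn] using h₄)
  simp only [deflate, LinearMap.coe_mk, AddHom.coe_mk, hs, hc]

/-- The external product of functions. -/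
def extProd {G H : Type*} (r : Setoid G) (s : Setoid H) :
    classSpace r ⊗[ℂ] classSpace s →ₗ[ℂ] classSpace (r.prod s) :=
  TensorProduct.lift <| LinearMap.mk₂ ℂ
    (fun φ ψ => ⟨fun p => φ.1 p.1 * ψ.1 p.2, fun p p' h => by
      simp only [φ.2 _ _ h.1, ψ.2 _ _ h.2]⟩)
    (fun φ φ' ψ => by ext p; simp [add_mul])
    (fun c φ ψ => by ext p; simp [mul_assoc])
    (fun φ ψ ψ' => by ext p; simp [mul_add])
    (fun c φ ψ => by ext p; simp [mul_left_comm])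

theorem extProd_tmul {G H : Type*} (r : Setoid G) (s : Setoid H) (φ : classSpace r)
    (ψ : classSpace s) (p : G × H) : (extProd r s (φ ⊗ₜ ψ)).1 p = φ.1 p.1 * ψ.1 p.2 := rfl

/-- The normalized indicator function of the class of `a`. -/
def normInd {G : Type*} [Fintype G] (r : Setoid G) (a : G) : classSpace r :=
  ⟨fun x => if r a x then (Finset.card {b | r a b} : ℂ)⁻¹ else 0, fun g h e => by
    have : r a g ↔ r a h := ⟨fun k => r.trans' k e, fun k => r.trans' k (r.symm' e)⟩
    simp only [this]⟩

theorem sum_normInd {G : Type*} [Fintype G] (r : Setoid G) (φ : G → ℂ)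
    (hφ : ∀ g h, r g h → φ g = φ h) (x : G) :
    ∑ a, φ a * (normInd r a).1 x = φ x := by
  have h1 : ∀ a, φ a * (normInd r a).1 x =
      if r x a then φ x * (Finset.card {b | r x b} : ℂ)⁻¹ else 0 := by
    intro a
    by_cases h : r a x
    · have e : ∀ b, r a b ↔ r x b := fun b =>
        ⟨fun k => r.trans' (r.symm' h) k, fun k => r.trans' h k⟩
      simp only [normInd, e, hφ a x h, r.symm' h, r.refl' x, if_true]
    · have h' : ¬ r x a := fun k => h (r.symm' k)
      simp [normInd, h, h']
  rw [Finset.sum_congr rfl fun a _ => h1 a, ← Finset.sum_filter, Finset.sum_const, nsmul_eq_mul]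
  have hne : (Finset.card {b | r x b} : ℂ) ≠ 0 := by
    rw [Nat.cast_ne_zero, ← Nat.pos_iff_ne_zero, Finset.card_pos]
    exact ⟨x, by simp⟩
  field_simp

theorem sum_smul_normInd {G : Type*} [Fintype G] (r : Setoid G) (φ : classSpace r) :
    ∑ a, φ.1 a • normInd r a = φ := by
  ext x
  simpa using sum_normInd r φ.1 φ.2 x

/-- The identification `classSpace r ⊗ classSpace s = classSpace (r × s)` given by the external
product. -/
def extEquiv {G H : Type*} [Fintype G] [Fintype H] (r : Setoid G) (s : Setoid H) :
    classSpace r ⊗[ℂ] classSpace s ≃ₗ[ℂ] classSpace (r.prod s) :=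
  LinearEquiv.ofLinearMap (extProd r s)
    { toFun := fun f => ∑ a, ∑ b, f.1 (a, b) • (normInd r a ⊗ₜ[ℂ] normInd s b)
      map_add' := fun f f' => by simp [add_smul, Finset.sum_add_distrib]
      map_smul' := fun c f => by simp [mul_smul, Finset.smul_sum] }
    (by
      ext f p
      obtain ⟨x, y⟩ := p
      simp only [LinearMap.comp_apply, LinearMap.coe_mk, AddHom.coe_mk, map_sum, map_smul,
        Submodule.coe_sum, Submodule.coe_smul, Finset.sum_apply, Pi.smul_apply, extProd_tmul,
        smul_eq_mul, LinearMap.id_apply]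
      have : ∀ a, ∑ b, f.1 (a, b) * ((normInd r a).1 x * (normInd s b).1 y) =
          f.1 (a, y) * (normInd r a).1 x := by
        intro a
        rw [← sum_normInd s (fun b => f.1 (a, b))
          (fun g h e => f.2 _ _ ⟨r.refl' a, e⟩) y, Finset.sum_mul]
        exact Finset.sum_congr rfl fun b _ => by ring
      rw [Finset.sum_congr rfl fun a _ => this a]
      exact sum_normInd r (fun a => f.1 (a, y)) (fun g h e => f.2 _ _ ⟨e, s.refl' y⟩) x)
    (by
      refine TensorProduct.ext' fun φ ψ => ?_
      simp only [LinearMap.comp_apply, LinearMap.coe_mk, AddHom.coe_mk, extProd_tmul,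
        LinearMap.id_apply]
      refine Eq.trans ?_ (congrArg₂ (fun a b => a ⊗ₜ[ℂ] b) (sum_smul_normInd r φ)
        (sum_smul_normInd s ψ))
      simp only [TensorProduct.sum_tmul, TensorProduct.tmul_sum]
      rw [Finset.sum_comm]
      refine Finset.sum_congr rfl fun b _ => Finset.sum_congr rfl fun a _ => ?_
      rw [TensorProduct.smul_tmul_smul])

/-! ### Graded Hopf algebras and combinatorial Hopf algebras -/

/-- The structure maps of a Hopf algebra on a complex vector space; the axioms are `IsHopf`. -/
structure HopfMaps (A : Type*) [AddCommGroup A] [Module ℂ A] where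
  mul : A ⊗[ℂ] A →ₗ[ℂ] A
  unit : ℂ →ₗ[ℂ] A
  comul : A →ₗ[ℂ] A ⊗[ℂ] A
  counit : A →ₗ[ℂ] ℂ

/-- The Hopf algebra axioms: an associative unital algebra, a coassociative counital coalgebra,
the two being compatible, with an antipode. -/
structure IsHopf {A : Type*} [AddCommGroup A] [Module ℂ A] (S : HopfMaps A) : Prop where
  mul_assoc : ∀ x y z, S.mul (S.mul (x ⊗ₜ y) ⊗ₜ z) = S.mul (x ⊗ₜ S.mul (y ⊗ₜ z))
  unit_mul : ∀ x, S.mul (S.unit 1 ⊗ₜ x) = x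
  mul_unit : ∀ x, S.mul (x ⊗ₜ S.unit 1) = x
  coassoc : TensorProduct.assoc ℂ A A A ∘ₗ S.comul.rTensor A ∘ₗ S.comul =
    S.comul.lTensor A ∘ₗ S.comul
  counit_comul : ∀ x, TensorProduct.lid ℂ A (S.counit.rTensor A (S.comul x)) = x
  comul_counit : ∀ x, TensorProduct.rid ℂ A (S.counit.lTensor A (S.comul x)) = x
  comul_mul : S.comul ∘ₗ S.mul = TensorProduct.map S.mul S.mul ∘ₗ
    (TensorProduct.tensorTensorTensorComm ℂ A A A A).toLinearMap ∘ₗ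
      TensorProduct.map S.comul S.comul
  comul_unit : S.comul (S.unit 1) = S.unit 1 ⊗ₜ S.unit 1
  counit_mul : ∀ x y, S.counit (S.mul (x ⊗ₜ y)) = S.counit x * S.counit y
  counit_unit : S.counit (S.unit 1) = 1
  exists_antipode : ∃ T : A →ₗ[ℂ] A,
    S.mul ∘ₗ T.rTensor A ∘ₗ S.comul = S.unit ∘ₗ S.counit ∧
    S.mul ∘ₗ T.lTensor A ∘ₗ S.comul = S.unit ∘ₗ S.counit

/-- Graded connected Hopf algebras, with homogeneous components `A n`. -/
structure IsGradedConnectedHopf {A : ℕ → Type*} [∀ n, AddCommGroup (A n)] [∀ n, Module ℂ (A n)]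
    (S : HopfMaps (⨁ n, A n)) : Prop extends IsHopf S where
  mul_mem : ∀ m n (x : A m) (y : A n),
    S.mul (DirectSum.lof ℂ ℕ A m x ⊗ₜ DirectSum.lof ℂ ℕ A n y) ∈
      LinearMap.range (DirectSum.lof ℂ ℕ A (m + n))
  unit_mem : S.unit 1 ∈ LinearMap.range (DirectSum.lof ℂ ℕ A 0)
  comul_mem : ∀ n (x : A n), S.comul (DirectSum.lof ℂ ℕ A n x) ∈
    ⨆ p ∈ Finset.HasAntidiagonal.antidiagonal n,
      LinearMap.range (TensorProduct.map (DirectSum.lof ℂ ℕ A p.1) (DirectSum.lof ℂ ℕ A p.2))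
  counit_eq_zero : ∀ n, n ≠ 0 → ∀ x : A n, S.counit (DirectSum.lof ℂ ℕ A n x) = 0
  connected : Module.finrank ℂ (A 0) = 1

/-- A linear character: an algebra homomorphism to `ℂ`. -/
structure IsLinearCharacter {A : Type*} [AddCommGroup A] [Module ℂ A] (S : HopfMaps A)
    (ζ : A →ₗ[ℂ] ℂ) : Prop where
  map_mul : ∀ x y, ζ (S.mul (x ⊗ₜ y)) = ζ x * ζ y
  map_unit : ζ (S.unit 1) = 1

/-- A combinatorial Hopf algebra: a graded connected Hopf algebra with a linear character. -/
structure IsCHA {A : ℕ → Type*} [∀ n, AddCommGroup (A n)] [∀ n, Module ℂ (A n)]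
    (S : HopfMaps (⨁ n, A n)) (ζ : (⨁ n, A n) →ₗ[ℂ] ℂ) : Prop where
  hopf : IsGradedConnectedHopf S
  character : IsLinearCharacter S ζ

/-- Homomorphisms of graded Hopf algebras. -/
structure IsGradedHopfHom {A B : ℕ → Type*} [∀ n, AddCommGroup (A n)] [∀ n, Module ℂ (A n)]
    [∀ n, AddCommGroup (B n)] [∀ n, Module ℂ (B n)]
    (S : HopfMaps (⨁ n, A n)) (T : HopfMaps (⨁ n, B n))
    (Ψ : (⨁ n, A n) →ₗ[ℂ] ⨁ n, B n) : Prop where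
  map_mul : ∀ x y, Ψ (S.mul (x ⊗ₜ y)) = T.mul (Ψ x ⊗ₜ Ψ y)
  map_unit : Ψ (S.unit 1) = T.unit 1
  map_comul : ∀ x, T.comul (Ψ x) = TensorProduct.map Ψ Ψ (S.comul x)
  map_counit : ∀ x, T.counit (Ψ x) = S.counit x
  map_mem : ∀ n (x : A n), Ψ (DirectSum.lof ℂ ℕ A n x) ∈ LinearMap.range (DirectSum.lof ℂ ℕ B n)

/-- Morphisms `(S, ζ) → (T, ξ)` of combinatorial Hopf algebras. -/
structure IsCHAMorphism {A B : ℕ → Type*} [∀ n, AddCommGroup (A n)] [∀ n, Module ℂ (A n)]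
    [∀ n, AddCommGroup (B n)] [∀ n, Module ℂ (B n)]
    (S : HopfMaps (⨁ n, A n)) (ζ : (⨁ n, A n) →ₗ[ℂ] ℂ)
    (T : HopfMaps (⨁ n, B n)) (ξ : (⨁ n, B n) →ₗ[ℂ] ℂ)
    (Ψ : (⨁ n, A n) →ₗ[ℂ] ⨁ n, B n) : Prop where
  source : IsCHA S ζ
  target : IsCHA T ξ
  hom : IsGradedHopfHom S T Ψ
  character_comp : ζ = ξ ∘ₗ Ψ

/-- The multiplication on `⨁ n, A n` with components `μ m n : A m → A n → A (m + n)`. -/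
def gradedMul {A : ℕ → Type*} [∀ n, AddCommGroup (A n)] [∀ n, Module ℂ (A n)]
    (μ : ∀ m n, A m →ₗ[ℂ] A n →ₗ[ℂ] A (m + n)) :
    (⨁ n, A n) ⊗[ℂ] (⨁ n, A n) →ₗ[ℂ] ⨁ n, A n :=
  TensorProduct.lift <| DirectSum.toModule ℂ ℕ _ fun m => LinearMap.flip <|
    DirectSum.toModule ℂ ℕ _ fun n => LinearMap.flip <|
      (μ m n).compr₂ (DirectSum.lof ℂ ℕ A (m + n))

/-! ### The groups `GL_n(F)` and `UT_n(F)` -/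

section groups

variable (F : Type*) [Field F] [Fintype F]

/-- The unipotent upper triangular group, as a subgroup of `GL_n(F)`. -/
def UT (n : ℕ) : Subgroup (GL (Fin n) F) where
  carrier := {g | ∀ i j, ((g : Matrix (Fin n) (Fin n) F) - 1) i j ≠ 0 → i < j}
  one_mem' := by simp
  mul_mem' := by
    intro a b ha hb i j
    have e : ((a * b : GL (Fin n) F) : Matrix (Fin n) (Fin n) F) - 1 =
        (a.1 - 1) * (b.1 - 1) + (a.1 - 1) + (b.1 - 1) := by
      rw [Units.val_mul]; noncomm_ring
    contrapose!
    intro hij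
    have ha' : (a.1 - 1) i j = 0 := by_contra fun h => hij.not_gt (ha i j h)
    have hb' : (b.1 - 1) i j = 0 := by_contra fun h => hij.not_gt (hb i j h)
    rw [e, Matrix.add_apply, Matrix.add_apply, ha', hb', Matrix.mul_apply, add_zero, add_zero]
    refine Finset.sum_eq_zero fun k _ => ?_
    by_contra h
    exact hij.not_gt ((ha i k (left_ne_zero_of_mul h)).trans (hb k j (right_ne_zero_of_mul h)))
  inv_mem' := by
    intro a ha i j
    contrapose!
    intro hij
    have ht : a.1.BlockTriangular (id : Fin n → Fin n) := by
      intro i j hji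
      have hji : j < i := hji
      have : (a.1 - 1) i j = 0 := by_contra fun h => hji.not_gt (ha i j h)
      simpa [Matrix.one_apply, hji.ne'] using this
    have := Matrix.invertibleOfIsUnitDet a.1 ((Matrix.isUnit_iff_isUnit_det _).1 a.isUnit)
    have hi := Matrix.blockTriangular_inv_of_blockTriangular ht
    rw [← Matrix.coe_units_inv] at hi
    have e : ((a⁻¹ : GL (Fin n) F) : Matrix (Fin n) (Fin n) F) - 1 =
        - ((a.1 - 1) * (a⁻¹ : GL (Fin n) F).1) := by
      rw [sub_mul, ← Units.val_mul, mul_inv_cancel, Units.val_one, one_mul, neg_sub]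
    rw [e, Matrix.neg_apply, Matrix.mul_apply, neg_eq_zero]
    refine Finset.sum_eq_zero fun k _ => ?_
    by_contra h
    have h1 := ha i k (left_ne_zero_of_mul h)
    exact right_ne_zero_of_mul h (hi (show j < k from hij.trans_lt h1))

variable {F}

/-- The entries of an element of `UT_n(F)`. -/
abbrev utMat {n : ℕ} (g : UT F n) : Matrix (Fin n) (Fin n) F := g.1.1

/-- A unipotent upper triangular matrix as an element of `UT_n(F)`. -/
def utMk {n : ℕ} (M : Matrix (Fin n) (Fin n) F) (h : ∀ i j, (M - 1) i j ≠ 0 → i < j) : UT F n :=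
  ⟨Matrix.GeneralLinearGroup.mkOfDetNeZero M (by
    have h0 : ∀ i j, ¬ i < j → M i j = (1 : Matrix (Fin n) (Fin n) F) i j := fun i j hij =>
      sub_eq_zero.1 (by_contra fun k => hij (h i j k))
    rw [Matrix.det_of_isUpperTriangular]
    · rw [Finset.prod_eq_one]
      · exact one_ne_zero
      · intro i _
        rw [h0 i i (lt_irrefl i), Matrix.one_apply_eq]
    · intro i j hij
      have hij : j < i := hij
      rw [h0 i j hij.not_gt, Matrix.one_apply_ne hij.ne']), h⟩

theorem utMat_mk {n : ℕ} (M : Matrix (Fin n) (Fin n) F) (h) : utMat (utMk M h) = M := rfl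

theorem ut_ext {n : ℕ} {g h : UT F n} (e : (utMat g) = (utMat h)) : g = h :=
  Subtype.ext (Units.ext e)

theorem utMat_of_not_lt {n : ℕ} (g : UT F n) {i j : Fin n} (h : ¬ i < j) :
    (utMat g) i j = (1 : Matrix (Fin n) (Fin n) F) i j :=
  sub_eq_zero.1 (by_contra fun k => h (g.2 i j k))

/-- The submatrix of `g ∈ UT_n(F)` on the rows and columns in the image of `e`. -/
def utSub {k n : ℕ} (e : Fin k ↪o Fin n) (g : UT F n) : UT F k :=
  utMk ((utMat g).submatrix e e) (by
    intro i j
    contrapose!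
    intro hij
    have : ¬ e i < e j := by simpa using hij
    rw [Matrix.sub_apply, Matrix.submatrix_apply, utMat_of_not_lt g this]
    simp [Matrix.one_apply])

theorem utMat_sub {k n : ℕ} (e : Fin k ↪o Fin n) (g : UT F n) (i j : Fin k) :
    utMat (utSub e g) i j = (utMat g) (e i) (e j) := rfl

/-! ### Superclass functions on `UT_n(F)` -/

/-- Indifference graphs on an ordered vertex set. -/
def IsIndifference {n : ℕ} (γ : SimpleGraph (Fin n)) : Prop :=
  ∀ i l, i < l → γ.Adj i l → ∀ j k, i ≤ j → j < k → k ≤ l → γ.Adj j k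

/-- The normal pattern subgroup `UT_γ` (its underlying set). -/
def UTpat {n : ℕ} (γ : SimpleGraph (Fin n)) : Set (UT F n) :=
  {g | ∀ i j, i < j → γ.Adj i j → (utMat g) i j = 0}

/-- The superclass `UT_γ°`. -/
def superclass {n : ℕ} (γ : SimpleGraph (Fin n)) : Set (UT F n) :=
  {g | g ∈ UTpat γ ∧ ∀ σ, IsIndifference σ → γ < σ → g ∉ UTpat σ}

variable (F) in
/-- The equivalence relation on `UT_n(F)` of lying in the same superclasses `UT_γ°`,
for `γ` an indifference graph. -/
def superSetoid (n : ℕ) : Setoid (UT F n) where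
  r g h := ∀ γ, IsIndifference γ → (g ∈ superclass γ ↔ h ∈ superclass γ)
  iseqv := ⟨fun _ _ _ => Iff.rfl, fun h γ hγ => (h γ hγ).symm,
    fun h h' γ hγ => (h γ hγ).trans (h' γ hγ)⟩

variable (F) in
/-- The superclass functions on `UT_n(F)`. -/
abbrev scf (n : ℕ) : Submodule ℂ (UT F n → ℂ) := classSpace (superSetoid F n)

variable (F) in
/-- The class functions on `GL_n(F)`. -/
abbrev cfGL (n : ℕ) : Submodule ℂ (GL (Fin n) F → ℂ) := classFun (GL (Fin n) F)

/-- All entries of `g` strictly above the diagonal and inside the interval `[i, l]` vanish. -/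
def VanishOn {n : ℕ} (g : UT F n) (i l : Fin n) : Prop :=
  ∀ j k, i ≤ j → j < k → k ≤ l → (utMat g) j k = 0

theorem exists_superclass {n : ℕ} (g : UT F n) (γ : SimpleGraph (Fin n)) (hγ : IsIndifference γ)
    (hg : g ∈ UTpat γ) : ∃ σ, IsIndifference σ ∧ γ ≤ σ ∧ g ∈ superclass σ := by
  obtain ⟨σ, hσ, hmax⟩ := (Set.toFinite {σ | IsIndifference σ ∧ γ ≤ σ ∧ g ∈ UTpat σ}).exists_le_maximal
    (show γ ∈ _ from ⟨hγ, le_rfl, hg⟩)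
  obtain ⟨⟨h1, h2, h3⟩, h4⟩ := hmax
  exact ⟨σ, h1, h2, h3, fun τ hτ hlt hgτ => hlt.not_ge (h4 ⟨hτ, h2.trans hlt.le, hgτ⟩ hlt.le)⟩

theorem superSetoid_iff {n : ℕ} (g h : UT F n) :
    superSetoid F n g h ↔ ∀ i l, VanishOn g i l ↔ VanishOn h i l := by
  have hpat : ∀ (g : UT F n) (γ : SimpleGraph (Fin n)), IsIndifference γ →
      (g ∈ UTpat γ ↔ ∀ i l, i < l → γ.Adj i l → VanishOn g i l) := by
    intro g γ hγ
    refine ⟨fun hg i l hil ha j k h1 h2 h3 => hg j k h2 (hγ i l hil ha j k h1 h2 h3), ?_⟩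
    exact fun hg i l hil ha => hg i l hil ha i l le_rfl hil le_rfl
  constructor
  · intro hgh
    have key : ∀ g h : UT F n, superSetoid F n g h → ∀ i l, VanishOn g i l → VanishOn h i l := by
      intro g h hgh i l hg
      let γ : SimpleGraph (Fin n) :=
        { Adj := fun j k => j ≠ k ∧ i ≤ j ∧ j ≤ l ∧ i ≤ k ∧ k ≤ l
          symm := ⟨fun j k ⟨a, b, c, d, e⟩ => ⟨a.symm, d, e, b, c⟩⟩
          loopless := ⟨fun j hj => hj.1 rfl⟩ }
      have hγ : IsIndifference γ := by
        intro a b hab ⟨_, h1, h2, h3, h4⟩ c d hc hcd hd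
        exact ⟨hcd.ne, h1.trans hc, (hcd.le.trans hd).trans h4, (h1.trans hc).trans hcd.le,
          hd.trans h4⟩
      have hgγ : g ∈ UTpat γ := fun j k hjk ⟨_, h1, _, _, h4⟩ => hg j k h1 hjk h4
      obtain ⟨σ, hσ, hle, hgσ⟩ := exists_superclass g γ hγ hgγ
      have hhσ := ((hgh σ hσ).1 hgσ).1
      intro j k h1 h2 h3
      exact hhσ j k h2 (hle ⟨h2.ne, h1, h2.le.trans h3, h1.trans h2.le, h3⟩)
    exact fun i l => ⟨key g h hgh i l, key h g ((superSetoid F n).symm' hgh) i l⟩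
  · intro hV
    have hp : ∀ γ, IsIndifference γ → (g ∈ UTpat γ ↔ h ∈ UTpat γ) := by
      intro γ hγ
      simp only [hpat _ γ hγ, hV]
    intro γ hγ
    refine and_congr (hp γ hγ) (forall_congr' fun σ => forall_congr' fun hσ =>
      imp_congr_right fun _ => not_congr (hp σ hσ))

/-! ### The Hopf algebra of superclass functions -/

theorem sub_castAdd_rel {m n : ℕ} {g h : UT F (m + n)} (e : superSetoid F (m + n) g h) :
    superSetoid F m (utSub (Fin.castAddOrderEmb n) g) (utSub (Fin.castAddOrderEmb n) h) := by
  rw [superSetoid_iff] at e ⊢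
  have key : ∀ (g : UT F (m + n)) i l, VanishOn (utSub (Fin.castAddOrderEmb n) g) i l ↔
      VanishOn g (Fin.castAdd n i) (Fin.castAdd n l) := by
    intro g i l
    constructor
    · intro hv j k h1 h2 h3
      have hj : (j : ℕ) < m := by
        have := l.2; simp only [Fin.le_def, Fin.lt_def, Fin.val_castAdd] at *; omega
      have hk : (k : ℕ) < m := by
        have := l.2; simp only [Fin.le_def, Fin.lt_def, Fin.val_castAdd] at *; omega
      exact hv ⟨j, hj⟩ ⟨k, hk⟩ h1 h2 h3
    · intro hv j k h1 h2 h3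
      exact hv (Fin.castAdd n j) (Fin.castAdd n k) h1 h2 h3
  intro i l
  rw [key, key, e]

theorem sub_natAdd_rel {m n : ℕ} {g h : UT F (m + n)} (e : superSetoid F (m + n) g h) :
    superSetoid F n (utSub (Fin.natAddOrderEmb m) g) (utSub (Fin.natAddOrderEmb m) h) := by
  rw [superSetoid_iff] at e ⊢
  have key : ∀ (g : UT F (m + n)) i l, VanishOn (utSub (Fin.natAddOrderEmb m) g) i l ↔
      VanishOn g (Fin.natAdd m i) (Fin.natAdd m l) := by
    intro g i l
    constructor
    · intro hv j k h1 h2 h3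
      have hj : m ≤ (j : ℕ) := (Nat.le_add_right m i).trans (Fin.le_def.1 h1)
      have hk : m ≤ (k : ℕ) := hj.trans (Fin.lt_def.1 h2).le
      obtain ⟨j', rfl⟩ : ∃ j', Fin.natAdd m j' = j :=
        ⟨⟨j - m, by omega⟩, Fin.ext (Nat.add_sub_cancel' hj)⟩
      obtain ⟨k', rfl⟩ : ∃ k', Fin.natAdd m k' = k :=
        ⟨⟨k - m, by omega⟩, Fin.ext (Nat.add_sub_cancel' hk)⟩
      exact hv j' k' ((Fin.natAddOrderEmb m).le_iff_le.1 h1) ((Fin.natAddOrderEmb m).lt_iff_lt.1 h2)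
        ((Fin.natAddOrderEmb m).le_iff_le.1 h3)
    · intro hv j k h1 h2 h3
      exact hv (Fin.natAdd m j) (Fin.natAdd m k) ((Fin.natAddOrderEmb m).le_iff_le.2 h1)
        ((Fin.natAddOrderEmb m).lt_iff_lt.2 h2) ((Fin.natAddOrderEmb m).le_iff_le.2 h3)
  intro i l
  rw [key, key, e]

variable (F) in
/-- The product of `φ ∈ scf(UT_m)` and `ψ ∈ scf(UT_n)`: the inflation of `φ × ψ` along the
projection `UT_{m+n} → UT_m × UT_n` onto the diagonal blocks. -/
def scfMul (m n : ℕ) : scf F m →ₗ[ℂ] scf F n →ₗ[ℂ] scf F (m + n) :=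
  LinearMap.mk₂ ℂ
    (fun φ ψ => ⟨fun g => φ.1 (utSub (Fin.castAddOrderEmb n) g) * ψ.1 (utSub (Fin.natAddOrderEmb m) g),
      fun g h e => by simp only [φ.2 _ _ (sub_castAdd_rel e), ψ.2 _ _ (sub_natAdd_rel e)]⟩)
    (fun φ φ' ψ => by ext p; simp [add_mul])
    (fun c φ ψ => by ext p; simp [mul_assoc])
    (fun φ ψ ψ' => by ext p; simp [mul_add])
    (fun c φ ψ => by ext p; simp [mul_left_comm])

variable (F) in
/-- For `I ⊆ [n]`, the subgroup of `UT_n` of those `g` that preserve the span of the coordinate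
vectors indexed by `I`. -/
abbrev UTstab {n : ℕ} (I : Finset (Fin n)) : Type _ :=
  {g : UT F n // ∀ i ∉ I, ∀ j ∈ I, (utMat g) i j = 0}

/-- The projection of this subgroup onto the blocks indexed by `I` and by its complement, which are
identified with `UT_{|I|}` and `UT_{n-|I|}` through the order preserving numberings. -/
def UTstabProj {n : ℕ} (I : Finset (Fin n)) (g : UTstab F I) : UT F I.card × UT F Iᶜ.card :=
  (utSub (I.orderEmbOfFin rfl) g.1, utSub (Iᶜ.orderEmbOfFin rfl) g.1)

/-- Replace the diagonal blocks of `g` by `a` and `b`. -/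
def replaceMat {n : ℕ} (I : Finset (Fin n)) (a : UT F I.card) (b : UT F Iᶜ.card)
    (g : UTstab F I) : Matrix (Fin n) (Fin n) F := Matrix.of fun i j =>
  if hi : i ∈ I then
    if hj : j ∈ I then
      utMat a ((I.orderIsoOfFin rfl).symm ⟨i, hi⟩) ((I.orderIsoOfFin rfl).symm ⟨j, hj⟩)
    else utMat g.1 i j
  else
    if hj : j ∈ I then utMat g.1 i j
    else utMat b ((Iᶜ.orderIsoOfFin rfl).symm ⟨i, Finset.mem_compl.2 hi⟩)
      ((Iᶜ.orderIsoOfFin rfl).symm ⟨j, Finset.mem_compl.2 hj⟩)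

/-- Replace the diagonal blocks of `g` by `a` and `b`. -/
def replaceBlocks {n : ℕ} (I : Finset (Fin n)) (a : UT F I.card) (b : UT F Iᶜ.card)
    (g : UTstab F I) : UTstab F I :=
  ⟨utMk (replaceMat I a b g) (by
    intro i j
    contrapose!
    intro hij
    rw [Matrix.sub_apply, sub_eq_zero, replaceMat, Matrix.of_apply]
    split_ifs with hi hj hj
    · rw [utMat_of_not_lt a (by simpa using hij)]
      simp [Matrix.one_apply]
    · rw [utMat_of_not_lt g.1 hij.not_gt]
    · rw [utMat_of_not_lt g.1 hij.not_gt]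
    · rw [utMat_of_not_lt b (by simpa using hij)]
      simp [Matrix.one_apply]), by
    intro i hi j hj
    simp only [utMat_mk, replaceMat, Matrix.of_apply, hi, hj, dif_pos, dif_neg, not_false_eq_true]
    exact g.2 i hi j hj⟩

theorem mat_replaceBlocks {n : ℕ} (I : Finset (Fin n)) (a : UT F I.card) (b : UT F Iᶜ.card)
    (g : UTstab F I) : utMat (replaceBlocks I a b g).1 = replaceMat I a b g := rfl

theorem orderIso_symm_emb {n k : ℕ} (I : Finset (Fin n)) (hk : I.card = k) (x : Fin k)
    (h : I.orderEmbOfFin hk x ∈ I) : (I.orderIsoOfFin hk).symm ⟨I.orderEmbOfFin hk x, h⟩ = x := by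
  rw [OrderIso.symm_apply_eq]; rfl

theorem emb_orderIso_symm {n k : ℕ} (I : Finset (Fin n)) (hk : I.card = k) (i : Fin n)
    (h : i ∈ I) : I.orderEmbOfFin hk ((I.orderIsoOfFin hk).symm ⟨i, h⟩) = i := by
  rw [← Finset.coe_orderIsoOfFin_apply, OrderIso.apply_symm_apply]

theorem proj_replaceBlocks {n : ℕ} (I : Finset (Fin n)) (a : UT F I.card) (b : UT F Iᶜ.card)
    (g : UTstab F I) : UTstabProj I (replaceBlocks I a b g) = (a, b) := by
  refine Prod.ext (ut_ext ?_) (ut_ext ?_)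
  · ext x y
    have hx := I.orderEmbOfFin_mem rfl x
    have hy := I.orderEmbOfFin_mem rfl y
    change utMat (replaceBlocks I a b g).1 _ _ = _
    simp only [mat_replaceBlocks, replaceMat, Matrix.of_apply, hx, hy, dif_pos, orderIso_symm_emb]
  · ext x y
    have hx := Finset.mem_compl.1 (Iᶜ.orderEmbOfFin_mem rfl x)
    have hy := Finset.mem_compl.1 (Iᶜ.orderEmbOfFin_mem rfl y)
    change utMat (replaceBlocks I a b g).1 _ _ = _
    simp only [mat_replaceBlocks, replaceMat, Matrix.of_apply, hx, hy, dif_neg, not_false_eq_true, orderIso_symm_emb]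

theorem replaceBlocks_replaceBlocks {n : ℕ} (I : Finset (Fin n)) (a a' : UT F I.card)
    (b b' : UT F Iᶜ.card) (g : UTstab F I) (hg : UTstabProj I g = (a, b)) :
    replaceBlocks I a b (replaceBlocks I a' b' g) = g := by
  obtain ⟨rfl, rfl⟩ := Prod.ext_iff.1 hg
  refine Subtype.ext (ut_ext ?_)
  ext i j
  by_cases hi : i ∈ I <;> by_cases hj : j ∈ I <;>
    simp [mat_replaceBlocks, replaceMat, hi, hj, UTstabProj, utMat_sub, emb_orderIso_symm]

theorem replaceBlocks_rel {n : ℕ} (I : Finset (Fin n)) {a a' : UT F I.card}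
    {b b' : UT F Iᶜ.card} (ha : superSetoid F _ a a') (hb : superSetoid F _ b b')
    (g : UTstab F I) (hg : UTstabProj I g = (a, b)) :
    superSetoid F n g.1 (replaceBlocks I a' b' g).1 := by
  have key : ∀ {a a' : UT F I.card} {b b' : UT F Iᶜ.card}, superSetoid F _ a a' →
      superSetoid F _ b b' → ∀ g : UTstab F I, UTstabProj I g = (a, b) → ∀ i l,
      VanishOn g.1 i l → VanishOn (replaceBlocks I a' b' g).1 i l := by
    intro a a' b b' ha hb g hg i l hv j k h1 h2 h3
    obtain ⟨rfl, rfl⟩ := Prod.ext_iff.1 hg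
    rw [superSetoid_iff] at ha hb
    have aux : ∀ (J : Finset (Fin n)) (c : UT F J.card),
        (∀ i l, VanishOn (utSub (J.orderEmbOfFin rfl) g.1) i l ↔ VanishOn c i l) →
        ∀ (hj : j ∈ J) (hk : k ∈ J), (utMat c) ((J.orderIsoOfFin rfl).symm ⟨j, hj⟩)
          ((J.orderIsoOfFin rfl).symm ⟨k, hk⟩) = 0 := by
      intro J c hc hj hk
      refine (hc _ _).1 (fun x y hx hxy hy => ?_) _ _ le_rfl (by simpa using h2) le_rfl
      rw [utMat_sub]
      refine hv _ _ (h1.trans ?_) (by simpa using hxy) (le_trans ?_ h3)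
      · rw [← emb_orderIso_symm J rfl j hj]
        exact (J.orderEmbOfFin rfl).monotone hx
      · rw [← emb_orderIso_symm J rfl k hk]
        exact (J.orderEmbOfFin rfl).monotone hy
    simp only [mat_replaceBlocks, replaceMat, Matrix.of_apply]
    split_ifs with hj hk hk
    · exact aux I a' ha hj hk
    · exact hv j k h1 h2 h3
    · exact hv j k h1 h2 h3
    · exact aux Iᶜ b' hb (Finset.mem_compl.2 hj) (Finset.mem_compl.2 hk)
  rw [superSetoid_iff]
  refine fun i l => ⟨key ha hb g hg i l, fun h => ?_⟩
  have := key ((superSetoid F _).symm' ha) ((superSetoid F _).symm' hb) _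
    (proj_replaceBlocks I a' b' g) i l h
  rwa [replaceBlocks_replaceBlocks I a a' b b' g hg] at this

variable (F) in
/-- The component of the coproduct of `φ ∈ scf(UT_n)` indexed by `I ⊆ [n]`, as a function on
`UT_{|I|} × UT_{n-|I|}`: restrict to the stabilizer of `I`, then deflate to the diagonal blocks. -/
def scfDeflate {n : ℕ} (I : Finset (Fin n)) :
    scf F n →ₗ[ℂ] classSpace ((superSetoid F I.card).prod (superSetoid F Iᶜ.card)) :=
  ((deflate (UTstabProj I)).comp
    ((LinearMap.funLeft ℂ ℂ (Subtype.val : UTstab F I → UT F n)).comp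
      (scf F n).subtype)).codRestrict _ (by
    rintro φ ⟨a, b⟩ ⟨a', b'⟩ ⟨ha, hb⟩
    exact deflate_congr (replaceBlocks I a' b') (replaceBlocks I a b)
      (fun x _ => proj_replaceBlocks I a' b' x) (fun x _ => proj_replaceBlocks I a b x)
      (fun x hx => replaceBlocks_replaceBlocks I a a' b b' x hx)
      (fun x hx => replaceBlocks_replaceBlocks I a' a b' b x hx)
      (fun x hx => φ.2 _ _ (replaceBlocks_rel I ha hb x hx)))

variable (F) in
/-- The unit and counit use the identification of the degree zero component with `ℂ`. -/
def scfHopf : HopfMaps (⨁ n, scf F n) where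
  mul := gradedMul (scfMul F)
  unit := LinearMap.toSpanSingleton ℂ _
    (DirectSum.lof ℂ ℕ (fun n => scf F n) 0 ⟨fun _ => 1, fun _ _ _ => rfl⟩)
  comul := DirectSum.toModule ℂ ℕ _ fun n => ∑ I : Finset (Fin n),
    TensorProduct.map (DirectSum.lof ℂ ℕ (fun n => scf F n) I.card)
        (DirectSum.lof ℂ ℕ (fun n => scf F n) Iᶜ.card) ∘ₗ
      (extEquiv (superSetoid F I.card) (superSetoid F Iᶜ.card)).symm.toLinearMap ∘ₗ scfDeflate F I
  counit := LinearMap.proj (1 : UT F 0) ∘ₗ (scf F 0).subtype ∘ₗ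
    DirectSum.component ℂ ℕ (fun n => scf F n) 0

/-! ### Zelevinsky's Hopf algebra of class functions on `GL_n(F)` -/

/-- The block upper triangular matrices in `GL_n(F)` with respect to `b`. -/
def parabolic (F : Type*) [Field F] {n : ℕ} {α : Type*} [LinearOrder α] (b : Fin n → α) :
    Subgroup (GL (Fin n) F) where
  carrier := {g | (g : Matrix (Fin n) (Fin n) F).BlockTriangular b}
  one_mem' := Matrix.blockTriangular_one
  mul_mem' := fun ha hb => by
    simpa only [Set.mem_ofPred_eq, Units.val_mul] using Matrix.BlockTriangular.mul ha hb
  inv_mem' := by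
    intro a ha
    have := Matrix.invertibleOfIsUnitDet a.1 ((Matrix.isUnit_iff_isUnit_det _).1 a.isUnit)
    simpa only [Set.mem_ofPred_eq, Matrix.coe_units_inv] using
      Matrix.blockTriangular_inv_of_blockTriangular ha

variable (F) in
/-- The standard maximal parabolic subgroup `P_{k,l}` of `GL_{k+l}(F)`: the matrices whose lower
left `l × k` block is zero. -/
def maxParabolic (k l : ℕ) : Subgroup (GL (Fin (k + l)) F) :=
  parabolic F (Fin.append (fun _ : Fin k => (0 : ℕ)) (fun _ : Fin l => 1))

theorem maxParabolic_lower {k l : ℕ} (g : maxParabolic F k l) (i : Fin l) (j : Fin k) :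
    g.1.1 (Fin.natAdd k i) (Fin.castAdd l j) = 0 :=
  g.2 (by simp)

/-- The projection of `P_{k,l}` onto the upper left diagonal block. -/
def leviFst (k l : ℕ) : maxParabolic F k l →* GL (Fin k) F :=
  MonoidHom.toHomUnits
    { toFun := fun g => g.1.1.submatrix (Fin.castAdd l) (Fin.castAdd l)
      map_one' := by ext i j; simp [Matrix.one_apply]
      map_mul' := fun g h => by
        ext i j
        simp [Matrix.mul_apply, Fin.sum_univ_add, maxParabolic_lower h] }

/-- The projection of `P_{k,l}` onto the lower right diagonal block. -/
def leviSnd (k l : ℕ) : maxParabolic F k l →* GL (Fin l) F :=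
  MonoidHom.toHomUnits
    { toFun := fun g => g.1.1.submatrix (Fin.natAdd k) (Fin.natAdd k)
      map_one' := by ext i j; simp [Matrix.one_apply]
      map_mul' := fun g h => by
        ext i j
        simp [Matrix.mul_apply, Fin.sum_univ_add, maxParabolic_lower g] }

/-- The projection of `P_{k,l}` onto its Levi factor. -/
def levi (k l : ℕ) : maxParabolic F k l →* GL (Fin k) F × GL (Fin l) F :=
  (leviFst k l).prod (leviSnd k l)

theorem levi_surjective (k l : ℕ) : Function.Surjective (levi (F := F) k l) := by
  rintro ⟨a, b⟩
  let D : Matrix (Fin (k + l)) (Fin (k + l)) F :=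
    Matrix.reindex finSumFinEquiv finSumFinEquiv (Matrix.fromBlocks a.1 0 0 b.1)
  have hD : D.det ≠ 0 := by
    rw [Matrix.det_reindex_self, Matrix.det_fromBlocks_zero₂₁]
    exact mul_ne_zero ((Matrix.isUnit_iff_isUnit_det _).1 a.isUnit).ne_zero
      ((Matrix.isUnit_iff_isUnit_det _).1 b.isUnit).ne_zero
  refine ⟨⟨Matrix.GeneralLinearGroup.mkOfDetNeZero D hD, ?_⟩, ?_⟩
  · intro i j
    induction i using Fin.addCases with
    | left i => induction j using Fin.addCases <;> simp
    | right i =>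
      induction j using Fin.addCases with
      | left j =>
        intro _
        change D _ _ = 0
        simp [D]
      | right j => simp
  · refine Prod.ext (Units.ext ?_) (Units.ext ?_)
    · ext i j
      change D (Fin.castAdd l i) (Fin.castAdd l j) = _
      simp [D]
    · ext i j
      change D (Fin.natAdd k i) (Fin.natAdd k j) = _
      simp [D]

variable (F) in
/-- Parabolic induction: inflate `φ × ψ` from the Levi factor to `P_{k,l}` and induce to
`GL_{k+l}`. -/
def cfGLMul (k l : ℕ) : cfGL F k →ₗ[ℂ] cfGL F l →ₗ[ℂ] cfGL F (k + l) :=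
  LinearMap.mk₂ ℂ
    (fun φ ψ => induce (maxParabolic F k l) fun p => φ.1 (leviFst k l p) * ψ.1 (leviSnd k l p))
    (fun φ φ' ψ => by rw [← map_add]; congr 1; ext p; simp [add_mul])
    (fun c φ ψ => by rw [← map_smul]; congr 1; ext p; simp [mul_assoc])
    (fun φ ψ ψ' => by rw [← map_add]; congr 1; ext p; simp [mul_add])
    (fun c φ ψ => by rw [← map_smul]; congr 1; ext p; simp [mul_left_comm])

variable (F) in
/-- Parabolic restriction: restrict `φ` to `P_{k,l}` and deflate to the Levi factor. -/
def cfGLDeflate (k l : ℕ) : cfGL F (k + l) →ₗ[ℂ]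
    classSpace ((IsConj.setoid (GL (Fin k) F)).prod (IsConj.setoid (GL (Fin l) F))) :=
  ((deflate (levi k l)).comp
    ((LinearMap.funLeft ℂ ℂ (Subtype.val : maxParabolic F k l → GL (Fin (k + l)) F)).comp
      (cfGL F (k + l)).subtype)).codRestrict _ (by
    rintro φ ⟨a, b⟩ ⟨a', b'⟩ ⟨ha, hb⟩
    obtain ⟨c, rfl⟩ := isConj_iff.1 (show IsConj a a' from ha)
    obtain ⟨d, rfl⟩ := isConj_iff.1 (show IsConj b b' from hb)
    obtain ⟨D, hD⟩ := levi_surjective (F := F) k l (c, d)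
    refine deflate_congr (fun x => D * x * D⁻¹) (fun x => D⁻¹ * x * D) ?_ ?_ ?_ ?_ ?_
    · intro x hx
      simp [hx, hD]
    · intro x hx
      simp [hx, hD, mul_assoc]
    · intro x _
      group
    · intro x _
      group
    · intro x _
      exact φ.2 _ _ (isConj_iff.2 ⟨D.1, by simp⟩))

variable (F) in
/-- The structure maps on `⨁ n, cf(GL_n)` by parabolic induction and restriction. -/
def cfGLHopf : HopfMaps (⨁ n, cfGL F n) where
  mul := gradedMul (cfGLMul F)
  unit := LinearMap.toSpanSingleton ℂ _
    (DirectSum.lof ℂ ℕ (fun n => cfGL F n) 0 ⟨fun _ => 1, fun _ _ _ => rfl⟩)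
  comul := DirectSum.toModule ℂ ℕ _ fun n => ∑ p ∈ Finset.HasAntidiagonal.antidiagonal n,
    TensorProduct.map (DirectSum.lof ℂ ℕ (fun n => cfGL F n) p.1)
        (DirectSum.lof ℂ ℕ (fun n => cfGL F n) p.2) ∘ₗ
      (extEquiv (IsConj.setoid (GL (Fin p.1) F)) (IsConj.setoid (GL (Fin p.2) F))).symm.toLinearMap
      ∘ₗ cfGLDeflate F p.1 p.2 ∘ₗ
      -- this composite is the identification of `cf(GL_n)` with `cf(GL_{p.1 + p.2})`
      DirectSum.component ℂ ℕ (fun n => cfGL F n) (p.1 + p.2) ∘ₗ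
      DirectSum.lof ℂ ℕ (fun n => cfGL F n) n
  counit := LinearMap.proj (1 : GL (Fin 0) F) ∘ₗ (cfGL F 0).subtype ∘ₗ
    DirectSum.component ℂ ℕ (fun n => cfGL F n) 0

/-! ### Induction and the two functionals -/

variable (F) in
/-- Induction from `UT_n` to `GL_n` in all degrees, on superclass functions. -/
def indUTGL : (⨁ n, scf F n) →ₗ[ℂ] ⨁ n, cfGL F n :=
  DirectSum.lmap fun n => induce (UT F n) ∘ₗ (scf F n).subtype

variable (F) in
/-- The Steinberg character `∑_α (-1)^(n - ℓ(α)) Ind_{P_α}^{GL_n}(1)`, the sum over the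
compositions `α` of `n`, where `P_α` is the standard parabolic subgroup with blocks of sizes
`α_1, α_2, …`. -/
def steinberg (n : ℕ) : cfGL F n :=
  ∑ α : Composition n, (-1 : ℂ) ^ (n - α.length) • induce (parabolic F α.index) fun _ => 1

variable (F) in
/-- The functional `⟨reg_•|`, given by the regular characters of the groups `UT_n`. -/
def regFunctional : (⨁ n, scf F n) →ₗ[ℂ] ℂ :=
  DirectSum.toModule ℂ ℕ _ fun n => ket (regChar (UT F n)) ∘ₗ (scf F n).subtype

variable (F) in
/-- The functional `⟨St_•|`, given by the Steinberg characters of the groups `GL_n`. -/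
def stFunctional : (⨁ n, cfGL F n) →ₗ[ℂ] ℂ :=
  DirectSum.toModule ℂ ℕ _ fun n => ket (steinberg F n).1 ∘ₗ (cfGL F n).subtype

end groups

end

/-! Both algebras are turned into models in which every axiom becomes an identity between finite
sums.

Superclass functions are spanned by indicators of pattern subgroups (`normInd_mem_span`), each
recorded as a finite set `K` of naturals with a relation closed under passing to subintervals. If
`K` lies before `L` and no relation joins them, the product of their elements is the element of `K ∪
L` (`mul_patElem`). The coproduct of the element of `K` is a sum over splittings `K = I ⊔ J`,
weighted by `q⁻¹` for every related pair `i < j` with `i ∈ I`, `j ∈ J` (`comul_patElem`). The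
bialgebra axioms then reduce to bijections between splittings and multiplicativity of the weights.

A class function on `GL_n`, extended by zero, is a function of endomorphisms of finite vector
spaces, and these evaluations separate points. The product at `f` is the sum, over `f`-stable `W`,
of the value at `f|W` times the value at `f` on `V/W` (`evL_mul`). The coproduct at `(a, b)` is the
average over all block triangular endomorphisms with diagonal `a`, `b` (`evL₂_comul`). Associativity
counts stable flags, coassociativity fills in a 3 × 3 block matrix in two orders, and the bialgebra
axiom sorts the stable subspaces of `A × B` by their intersection with `A` and image in `B`
(`sum_sum_prodTerm`). In both cases the antipode comes from connectedness
(`exists_antipode_of_connected`).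

With the sign `(-1)^n`, the Steinberg characters are a left inverse, under parabolic induction, of
the family of trivial characters (`sum_prodTerm_stFam`). So for invertible `f` on `V ≠ 0` the signed
Steinberg values on the stable subspaces of `V` sum to zero (`sum_stRes`). This recursion shows that
parabolic restriction of the Steinberg character is an external product (`avgEv_stFam`), which by
Frobenius reciprocity makes pairing with it multiplicative, and that it vanishes at nontrivial
unipotents (`ev_stFam_eq_zero`).

Induction from `UT` respects products by induction in stages, since `UT_{m+n}` is the preimage of
`UT_m × UT_n` in `P_{m,n}` (`induce_scfMul`). It respects coproducts by Mackey's formula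
(`deflate_induce`): the double cosets of `P_{k,l}` and `UT_{k+l}` are represented by shuffles,
indexed by the `k`-subsets `I` (`existsUnique_doubleCoset_shuffle`), and the term of `I` is the
induced `I`-component of the coproduct (`shuffle_term`).

Finally, pairing an induced `ψ` with the Steinberg character gives `St(1) ψ(1) / |UT_n|`, while
pairing `ψ` with the regular character gives `ψ(1)`. The degree `St(1) = |UT_n|` follows from
multiplicativity, because the trivial character of `UT_n` is a product of `n` characters of degree
one (`steinberg_apply_one`). -/

noncomputable section

set_option linter.unusedSectionVars false

/-! ### Separating functionals on tensor products -/

section separation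

variable {A B : Type*} [AddCommGroup A] [Module ℂ A] [AddCommGroup B] [Module ℂ B]

/-- The functional `a ⊗ b ↦ f a * g b`. -/
def tmulFun (f : A →ₗ[ℂ] ℂ) (g : B →ₗ[ℂ] ℂ) : A ⊗[ℂ] B →ₗ[ℂ] ℂ :=
  LinearMap.mul' ℂ ℂ ∘ₗ TensorProduct.map f g

@[simp] theorem tmulFun_tmul (f : A →ₗ[ℂ] ℂ) (g : B →ₗ[ℂ] ℂ) (a : A) (b : B) :
    tmulFun f g (a ⊗ₜ b) = f a * g b := rfl

/-- A family of functionals separates points. -/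
def Separating {ι : Type*} (f : ι → A →ₗ[ℂ] ℂ) : Prop := ∀ a, (∀ i, f i a = 0) → a = 0

theorem Separating.eq {ι : Type*} {f : ι → A →ₗ[ℂ] ℂ} (hf : Separating f) {a a' : A}
    (h : ∀ i, f i a = f i a') : a = a' :=
  sub_eq_zero.1 (hf _ fun i => by rw [map_sub, h, sub_self])

/-- Expand `t = ∑ b_k ⊗ c_k` along a basis of `A`. Contracting the second factor with `g j` gives a
vector of `A` killed by every `f i`, hence zero, so its coordinates `g j (c_k)` vanish for all `j`
and every `c_k` is zero. No finiteness of the spaces is needed. -/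
theorem Separating.tmul {ι κ : Type*} {f : ι → A →ₗ[ℂ] ℂ} {g : κ → B →ₗ[ℂ] ℂ}
    (hf : Separating f) (hg : Separating g) :
    Separating fun p : ι × κ => tmulFun (f p.1) (g p.2) := by
  intro t ht
  let b := Module.Basis.ofVectorSpace ℂ A
  let e := TensorProduct.equivFinsuppOfBasisLeft (N := B) b
  obtain ⟨c, rfl⟩ := e.symm.surjective t
  have hc : ∀ i j, f i (c.sum fun k y => g j y • b k) = 0 := by
    intro i j
    have := ht (i, j)
    rw [TensorProduct.equivFinsuppOfBasisLeft_symm_apply] at this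
    simp only [Finsupp.sum, map_sum, tmulFun_tmul, map_smul, smul_eq_mul] at this ⊢
    rw [← this]
    exact Finset.sum_congr rfl fun k _ => mul_comm _ _
  have h0 : ∀ j k, g j (c k) = 0 := by
    intro j k
    have h1 := hf _ fun i => hc i j
    have h2 := congrArg (fun a => b.repr a k) h1
    simp only [Finsupp.sum, map_sum, map_smul, Module.Basis.repr_self, Finsupp.coe_finsetSum,
      Finset.sum_apply, Finsupp.smul_apply, smul_eq_mul, map_zero, Finsupp.zero_apply,
      Finsupp.single_apply, mul_ite, mul_one, mul_zero] at h2
    rw [Finset.sum_ite_eq'] at h2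
    split_ifs at h2 with hk
    · exact h2
    · rw [Finsupp.notMem_support_iff.1 hk, map_zero]
  have : c = 0 := by
    ext k
    exact hg _ fun j => h0 j k
  rw [this, map_zero]

end separation

/-! ### Graded multiplication -/

theorem gradedMul_lof {A : ℕ → Type*} [∀ n, AddCommGroup (A n)] [∀ n, Module ℂ (A n)]
    (μ : ∀ m n, A m →ₗ[ℂ] A n →ₗ[ℂ] A (m + n)) (m n : ℕ) (x : A m) (y : A n) :
    gradedMul μ (DirectSum.lof ℂ ℕ A m x ⊗ₜ DirectSum.lof ℂ ℕ A n y) =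
      DirectSum.lof ℂ ℕ A (m + n) (μ m n x y) := by
  simp [gradedMul]

/-! ### The antipode of a graded connected bialgebra -/

section antipode

variable {V : Type*} [AddCommGroup V] [Module ℂ V] (S : HopfMaps V)

/-- The convolution product. -/
def HopfMaps.conv (f g : V →ₗ[ℂ] V) : V →ₗ[ℂ] V := S.mul ∘ₗ TensorProduct.map f g ∘ₗ S.comul

theorem HopfMaps.conv_apply (f g : V →ₗ[ℂ] V) (x : V) :
    S.conv f g x = S.mul (TensorProduct.map f g (S.comul x)) := rfl

theorem HopfMaps.conv_add_right (f g g' : V →ₗ[ℂ] V) :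
    S.conv f (g + g') = S.conv f g + S.conv f g' := by
  simp [HopfMaps.conv, TensorProduct.map_add_right, LinearMap.add_comp, LinearMap.comp_add]

theorem HopfMaps.conv_add_left (f f' g : V →ₗ[ℂ] V) :
    S.conv (f + f') g = S.conv f g + S.conv f' g := by
  simp [HopfMaps.conv, TensorProduct.map_add_left, LinearMap.add_comp, LinearMap.comp_add]

theorem HopfMaps.conv_smul_left (c : ℂ) (f g : V →ₗ[ℂ] V) :
    S.conv (c • f) g = c • S.conv f g := by
  simp [HopfMaps.conv, TensorProduct.map_smul_left, LinearMap.smul_comp, LinearMap.comp_smul]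

theorem HopfMaps.conv_smul_right (c : ℂ) (f g : V →ₗ[ℂ] V) :
    S.conv f (c • g) = c • S.conv f g := by
  simp [HopfMaps.conv, TensorProduct.map_smul_right, LinearMap.smul_comp, LinearMap.comp_smul]

variable {S}

theorem HopfMaps.conv_assoc
    (hm : ∀ x y z, S.mul (S.mul (x ⊗ₜ y) ⊗ₜ z) = S.mul (x ⊗ₜ S.mul (y ⊗ₜ z)))
    (hc : TensorProduct.assoc ℂ V V V ∘ₗ S.comul.rTensor V ∘ₗ S.comul =
      S.comul.lTensor V ∘ₗ S.comul) (f g h : V →ₗ[ℂ] V) :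
    S.conv (S.conv f g) h = S.conv f (S.conv g h) := by
  have h1 : S.mul ∘ₗ TensorProduct.map (S.conv f g) h =
      (S.mul ∘ₗ TensorProduct.map f (S.mul ∘ₗ TensorProduct.map g h)) ∘ₗ
        TensorProduct.assoc ℂ V V V ∘ₗ S.comul.rTensor V := by
    have h2 : S.mul ∘ₗ TensorProduct.map (S.mul ∘ₗ TensorProduct.map f g) h =
      (S.mul ∘ₗ TensorProduct.map f (S.mul ∘ₗ TensorProduct.map g h)) ∘ₗ
        (TensorProduct.assoc ℂ V V V).toLinearMap := by
      ext x y z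
      simp [hm]
    rw [← LinearMap.comp_assoc _ (TensorProduct.assoc ℂ V V V).toLinearMap, ← h2]
    refine TensorProduct.ext' fun x y => ?_
    simp [HopfMaps.conv]
  have h3 : S.mul ∘ₗ TensorProduct.map f (S.conv g h) =
      (S.mul ∘ₗ TensorProduct.map f (S.mul ∘ₗ TensorProduct.map g h)) ∘ₗ S.comul.lTensor V := by
    refine TensorProduct.ext' fun x y => ?_
    simp [HopfMaps.conv]
  change (S.mul ∘ₗ TensorProduct.map (S.conv f g) h) ∘ₗ S.comul =
    (S.mul ∘ₗ TensorProduct.map f (S.conv g h)) ∘ₗ S.comul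
  rw [h1, h3, LinearMap.comp_assoc, LinearMap.comp_assoc, LinearMap.comp_assoc, hc,
    LinearMap.comp_assoc, LinearMap.comp_assoc]

/-- The unit of the convolution algebra. -/
def HopfMaps.convOne (S : HopfMaps V) : V →ₗ[ℂ] V := S.unit ∘ₗ S.counit

theorem HopfMaps.unit_apply (S : HopfMaps V) (c : ℂ) : S.unit c = c • S.unit 1 := by
  rw [← map_smul, smul_eq_mul, mul_one]

theorem HopfMaps.convOne_conv (h1 : ∀ x, S.mul (S.unit 1 ⊗ₜ x) = x)
    (h2 : ∀ x, TensorProduct.lid ℂ V (S.counit.rTensor V (S.comul x)) = x) (f : V →ₗ[ℂ] V) :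
    S.conv S.convOne f = f := by
  have : S.mul ∘ₗ TensorProduct.map S.convOne f =
      f ∘ₗ (TensorProduct.lid ℂ V).toLinearMap ∘ₗ S.counit.rTensor V := by
    refine TensorProduct.ext' fun x y => ?_
    simp only [convOne, LinearMap.comp_apply, TensorProduct.map_tmul]
    rw [S.unit_apply, ← TensorProduct.smul_tmul', map_smul, h1]
    simp
  rw [conv, ← LinearMap.comp_assoc, this]
  ext x
  simp [h2]

theorem HopfMaps.conv_convOne (h1 : ∀ x, S.mul (x ⊗ₜ S.unit 1) = x)
    (h2 : ∀ x, TensorProduct.rid ℂ V (S.counit.lTensor V (S.comul x)) = x) (f : V →ₗ[ℂ] V) :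
    S.conv f S.convOne = f := by
  have : S.mul ∘ₗ TensorProduct.map f S.convOne =
      f ∘ₗ (TensorProduct.rid ℂ V).toLinearMap ∘ₗ S.counit.lTensor V := by
    refine TensorProduct.ext' fun x y => ?_
    simp only [convOne, LinearMap.comp_apply, TensorProduct.map_tmul]
    rw [S.unit_apply, TensorProduct.tmul_smul, map_smul, h1]
    simp
  rw [conv, ← LinearMap.comp_assoc, this]
  ext x
  simp [h2]

end antipode

section graded_antipode

variable {A : ℕ → Type*} [∀ n, AddCommGroup (A n)] [∀ n, Module ℂ (A n)]
  {S : HopfMaps (⨁ n, A n)}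

/-- The coproduct of an element of degree `n` lives in bidegrees `i + j = n`, so a convolution in
degree `n` may be computed after changing the two maps anywhere else. -/
theorem HopfMaps.conv_congr
    (hS : ∀ n (x : A n), S.comul (DirectSum.lof ℂ ℕ A n x) ∈
      ⨆ p ∈ Finset.HasAntidiagonal.antidiagonal n,
        LinearMap.range (TensorProduct.map (DirectSum.lof ℂ ℕ A p.1) (DirectSum.lof ℂ ℕ A p.2)))
    {f g f' g' : (⨁ n, A n) →ₗ[ℂ] ⨁ n, A n} {n : ℕ}
    (h : ∀ i j (x : A i) (y : A j), i + j = n →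
      f (DirectSum.lof ℂ ℕ A i x) ⊗ₜ[ℂ] g (DirectSum.lof ℂ ℕ A j y) =
        f' (DirectSum.lof ℂ ℕ A i x) ⊗ₜ[ℂ] g' (DirectSum.lof ℂ ℕ A j y)) (x : A n) :
    S.conv f g (DirectSum.lof ℂ ℕ A n x) = S.conv f' g' (DirectSum.lof ℂ ℕ A n x) := by
  have key : (⨆ p ∈ Finset.HasAntidiagonal.antidiagonal n, LinearMap.range
      (TensorProduct.map (DirectSum.lof ℂ ℕ A p.1) (DirectSum.lof ℂ ℕ A p.2))) ≤
      LinearMap.eqLocus (TensorProduct.map f g) (TensorProduct.map f' g') := by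
    refine iSup₂_le fun p hp => ?_
    rintro _ ⟨t, rfl⟩
    rw [LinearMap.mem_eqLocus, ← LinearMap.comp_apply, ← LinearMap.comp_apply]
    refine LinearMap.congr_fun (TensorProduct.ext' fun x y => ?_) t
    simpa using h p.1 p.2 x y (Finset.HasAntidiagonal.mem_antidiagonal.1 hp)
  rw [HopfMaps.conv_apply, HopfMaps.conv_apply, key (hS n x)]

/-- The antipode is the convolution inverse of the identity, as a geometric series: `p = id - unit ∘
counit` kills degree zero, so its `k`-th convolution power kills degrees below `k`, and `∑ (-1)^k
p^k` is a finite sum in each degree. -/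
theorem exists_antipode_of_connected
    (hm : ∀ x y z, S.mul (S.mul (x ⊗ₜ y) ⊗ₜ z) = S.mul (x ⊗ₜ S.mul (y ⊗ₜ z)))
    (hu : ∀ x, S.mul (S.unit 1 ⊗ₜ x) = x) (hu' : ∀ x, S.mul (x ⊗ₜ S.unit 1) = x)
    (hc : (TensorProduct.assoc ℂ (⨁ n, A n) (⨁ n, A n) (⨁ n, A n)).toLinearMap ∘ₗ
      S.comul.rTensor _ ∘ₗ S.comul =
      S.comul.lTensor _ ∘ₗ S.comul)
    (he : ∀ x, TensorProduct.lid ℂ _ (S.counit.rTensor _ (S.comul x)) = x)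
    (he' : ∀ x, TensorProduct.rid ℂ _ (S.counit.lTensor _ (S.comul x)) = x)
    (hS : ∀ n (x : A n), S.comul (DirectSum.lof ℂ ℕ A n x) ∈
      ⨆ p ∈ Finset.HasAntidiagonal.antidiagonal n,
        LinearMap.range (TensorProduct.map (DirectSum.lof ℂ ℕ A p.1) (DirectSum.lof ℂ ℕ A p.2)))
    (h0 : ∀ x : A 0, S.unit (S.counit (DirectSum.lof ℂ ℕ A 0 x)) = DirectSum.lof ℂ ℕ A 0 x) :
    ∃ T : (⨁ n, A n) →ₗ[ℂ] ⨁ n, A n,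
      S.mul ∘ₗ T.rTensor _ ∘ₗ S.comul = S.unit ∘ₗ S.counit ∧
      S.mul ∘ₗ T.lTensor _ ∘ₗ S.comul = S.unit ∘ₗ S.counit := by
  set p : (⨁ n, A n) →ₗ[ℂ] ⨁ n, A n := LinearMap.id - S.convOne with hp
  have hid : LinearMap.id = S.convOne + p := by rw [hp, add_sub_cancel]
  have hp0 : ∀ x : A 0, p (DirectSum.lof ℂ ℕ A 0 x) = 0 := by
    intro x
    rw [hp, LinearMap.sub_apply, LinearMap.id_apply, HopfMaps.convOne, LinearMap.comp_apply, h0,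
      sub_self]
  have h1c := HopfMaps.convOne_conv hu he
  have hc1 := HopfMaps.conv_convOne hu' he'
  obtain ⟨pw, pw0, pws⟩ : ∃ pw : ℕ → ((⨁ n, A n) →ₗ[ℂ] ⨁ n, A n), pw 0 = S.convOne ∧
      ∀ k, pw (k + 1) = S.conv (pw k) p :=
    ⟨fun k => Nat.rec S.convOne (fun _ f => S.conv f p) k, rfl, fun k => rfl⟩
  have pwc : ∀ k, S.conv p (pw k) = pw (k + 1) := by
    intro k
    induction k with
    | zero => rw [pws, pw0, h1c, hc1]
    | succ k ih => rw [pws, ← HopfMaps.conv_assoc hm hc, ih, ← pws]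
  have pwv : ∀ k m, m < k → ∀ x : A m, pw k (DirectSum.lof ℂ ℕ A m x) = 0 := by
    intro k
    induction k with
    | zero => intro m hm; omega
    | succ k ih =>
      intro m hm x
      rw [pws, HopfMaps.conv_congr hS (f' := 0) (g' := 0)]
      · simp [HopfMaps.conv]
      · intro i j x y hij
        -- As `i + j = m ≤ k`, either `i < k` and the `k`-th power vanishes on the left factor, or
        -- `j = 0` and `p` vanishes on the right one.
        by_cases hi : i < k
        · rw [ih i hi]; simp
        · obtain rfl : j = 0 := by omega
          rw [hp0]; simp
  let TN : ℕ → ((⨁ n, A n) →ₗ[ℂ] ⨁ n, A n) := fun N =>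
    ∑ k ∈ Finset.range (N + 1), (-1 : ℂ) ^ k • pw k
  have TNs : ∀ N, TN (N + 1) = TN N + (-1 : ℂ) ^ (N + 1) • pw (N + 1) := fun N =>
    Finset.sum_range_succ _ _
  have TN0 : TN 0 = S.convOne := by simp [TN, pw0]
  -- The truncated series telescopes, with an error term that is zero in degrees at most `N`.
  have TNid : ∀ N, S.conv (TN N) LinearMap.id = S.convOne + (-1 : ℂ) ^ N • pw (N + 1) := by
    intro N
    induction N with
    | zero => rw [TN0, h1c, pws, pw0, h1c, hid]; simp
    | succ N ih =>
      rw [TNs, HopfMaps.conv_add_left, ih, HopfMaps.conv_smul_left, hid, HopfMaps.conv_add_right,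
        hc1, ← pws, pow_succ]
      module
  have idTN : ∀ N, S.conv LinearMap.id (TN N) = S.convOne + (-1 : ℂ) ^ N • pw (N + 1) := by
    intro N
    induction N with
    | zero => rw [TN0, hc1, pws, pw0, h1c, hid]; simp
    | succ N ih =>
      rw [TNs, HopfMaps.conv_add_right, ih, HopfMaps.conv_smul_right, hid, HopfMaps.conv_add_left,
        h1c, pwc, pow_succ]
      module
  -- Truncating at `n` in degree `n` suffices: by `hT` every later truncation agrees there.
  let T : (⨁ n, A n) →ₗ[ℂ] ⨁ n, A n :=
    DirectSum.toModule ℂ ℕ _ fun n => TN n ∘ₗ DirectSum.lof ℂ ℕ A n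
  have hT : ∀ N m, m ≤ N → ∀ x : A m,
      T (DirectSum.lof ℂ ℕ A m x) = TN N (DirectSum.lof ℂ ℕ A m x) := by
    intro N m hmN x
    have e : T (DirectSum.lof ℂ ℕ A m x) = TN m (DirectSum.lof ℂ ℕ A m x) := by
      simp [T, DirectSum.toModule_lof]
    rw [e]
    induction N, hmN using Nat.le_induction with
    | base => rfl
    | succ N hN ih =>
      rw [ih, TNs, LinearMap.add_apply, LinearMap.smul_apply, pwv _ _ (by omega), smul_zero,
        add_zero]
  refine ⟨T, ?_, ?_⟩
  · refine DirectSum.linearMap_ext ℂ fun n => LinearMap.ext fun x => ?_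
    change S.conv T LinearMap.id (DirectSum.lof ℂ ℕ A n x) = S.convOne (DirectSum.lof ℂ ℕ A n x)
    rw [HopfMaps.conv_congr hS (f' := TN n) (g' := LinearMap.id), TNid, LinearMap.add_apply,
      LinearMap.smul_apply, pwv _ _ (by omega), smul_zero, add_zero]
    intro i j x y hij
    rw [hT n i (by omega)]
  · refine DirectSum.linearMap_ext ℂ fun n => LinearMap.ext fun x => ?_
    change S.conv LinearMap.id T (DirectSum.lof ℂ ℕ A n x) = S.convOne (DirectSum.lof ℂ ℕ A n x)
    rw [HopfMaps.conv_congr hS (f' := LinearMap.id) (g' := TN n), idTN, LinearMap.add_apply,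
      LinearMap.smul_apply, pwv _ _ (by omega), smul_zero, add_zero]
    intro i j x y hij
    rw [hT n j (by omega)]

end graded_antipode

/-! ### Pattern indicators and a spanning set of superclass functions -/

/-- Relations on `ℕ` whose restriction to `{(i, j) | i < j}` is closed under passing to
subintervals. -/
structure IndRel where
  rel : ℕ → ℕ → Prop
  closed : ∀ i j k l, i ≤ j → j < k → k ≤ l → rel i l → rel j k

section pattern

variable {F : Type*} [Field F] [Fintype F]

variable (F) in
/-- The indicator function of the pattern subgroup of `UT_n` attached to the pull-back of `t`
along `e`. -/
def pat (t : IndRel) {n : ℕ} (e : Fin n ↪o ℕ) : scf F n :=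
  ⟨fun g => if ∀ a b, a < b → t.rel (e a) (e b) → utMat g a b = 0 then 1 else 0, fun g h hgh => by
    have key : ∀ g : UT F n, (∀ a b, a < b → t.rel (e a) (e b) → utMat g a b = 0) ↔
        ∀ a b, a < b → t.rel (e a) (e b) → VanishOn g a b := by
      intro g
      refine ⟨fun H a b hab hr j k h1 h2 h3 => H j k h2 ?_,
        fun H a b hab hr => H a b hab hr a b le_rfl hab le_rfl⟩
      exact t.closed _ _ _ _ (e.monotone h1) (e.strictMono h2) (e.monotone h3) hr
    rw [superSetoid_iff] at hgh
    simp only [key, hgh]⟩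

theorem pat_apply (t : IndRel) {n : ℕ} (e : Fin n ↪o ℕ) (g : UT F n) :
    (pat F t e).1 g = if ∀ a b, a < b → t.rel (e a) (e b) → utMat g a b = 0 then 1 else 0 := rfl

theorem pat_congr (t t' : IndRel) {n : ℕ} (e e' : Fin n ↪o ℕ)
    (h : ∀ a b, a < b → (t.rel (e a) (e b) ↔ t'.rel (e' a) (e' b))) : pat F t e = pat F t' e' := by
  refine Subtype.ext (funext fun g => ?_)
  rw [pat_apply, pat_apply]
  congr 1
  refine propext (forall_congr' fun a => forall_congr' fun b => forall_congr' fun hab => ?_)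
  rw [h a b hab]

variable (F) in
/-- The pattern indicator attached to a finite set of naturals and the relation `t` on it. -/
def patElem (t : IndRel) (K : Finset ℕ) : ⨁ n, scf F n :=
  DirectSum.lof ℂ ℕ (fun n => scf F n) K.card (pat F t (K.orderEmbOfFin rfl))

/-- An order embedding is determined by its image, so both the degree and the embedding are absorbed
into the set `K`. This removes dependent types from later computations. -/
theorem lof_pat (t : IndRel) {n : ℕ} (e : Fin n ↪o ℕ) (K : Finset ℕ)
    (h : Finset.univ.map e.toEmbedding = K) :
    DirectSum.lof ℂ ℕ (fun n => scf F n) n (pat F t e) = patElem F t K := by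
  have hn : K.card = n := by rw [← h]; simp
  subst hn
  have : e = K.orderEmbOfFin rfl := Finset.orderEmbOfFin_unique' rfl fun x => by
    have := Finset.mem_map_of_mem e.toEmbedding (Finset.mem_univ x)
    rwa [h] at this
  rw [this, patElem]

theorem patElem_congr (t t' : IndRel) (K : Finset ℕ)
    (h : ∀ a ∈ K, ∀ b ∈ K, a < b → (t.rel a b ↔ t'.rel a b)) : patElem F t K = patElem F t' K := by
  rw [patElem, patElem, pat_congr]
  intro a b hab
  exact h _ (K.orderEmbOfFin_mem rfl a) _ (K.orderEmbOfFin_mem rfl b)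
    ((K.orderEmbOfFin rfl).strictMono hab)

theorem normInd_congr {G : Type*} [Fintype G] (r : Setoid G) {a b : G} (h : r a b) :
    normInd r a = normInd r b := by
  have e : ∀ x, r a x ↔ r b x := fun x => ⟨fun k => r.trans' (r.symm' h) k, fun k => r.trans' h k⟩
  refine Subtype.ext (funext fun x => ?_)
  simp only [normInd, e]

/-- Pattern indicators are unitriangular against superclass indicators up to class sizes: the
indicator of the smallest pattern subgroup containing `g` is the class of `g` plus classes with
strictly more vanishing. Induct on the size of that pattern subgroup. -/
theorem normInd_mem_span {n : ℕ} (g : UT F n) :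
    normInd (superSetoid F n) g ∈
      Submodule.span ℂ {x | ∃ t, x = pat F t (Fin.valOrderEmb n)} := by
  -- The preorder whose associated equivalence is `superSetoid`.
  let le : UT F n → UT F n → Prop := fun g h => ∀ a b, VanishOn g a b → VanishOn h a b
  have le_trans' : ∀ {g h k}, le g h → le h k → le g k := fun h1 h2 a b h => h2 a b (h1 a b h)
  induction hN : Finset.card {h | le g h} using Nat.strong_induction_on generalizing g with
  | _ N ih =>
  -- The largest relation that `g` obeys; by `ht` its pattern indicator is that of the elements
  -- above `g`.
  let t : IndRel :=
    { rel := fun a b => ∃ (ha : a < n) (hb : b < n), VanishOn g ⟨a, ha⟩ ⟨b, hb⟩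
      closed := fun i j k l h1 h2 h3 ⟨hi, hl, hv⟩ =>
        ⟨by omega, by omega, fun a b h4 h5 h6 => hv a b (le_trans (h1) h4) h5
          (h6.trans h3)⟩ }
  have ht : ∀ h, (pat F t (Fin.valOrderEmb n)).1 h = if le g h then 1 else 0 := by
    intro h
    rw [pat_apply]
    congr 1
    refine propext ⟨fun H a b hv j k h1 h2 h3 => H j k h2 ⟨j.2, k.2, ?_⟩,
      fun H a b hab hr => H a b ?_ a b le_rfl hab le_rfl⟩
    · exact fun x y h4 h5 h6 => hv x y (h1.trans h4) h5 (h6.trans h3)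
    · obtain ⟨_, _, h⟩ := hr
      exact h
  have h1 := sum_smul_normInd _ (pat F t (Fin.valOrderEmb n))
  have h2 : ∀ a, (pat F t (Fin.valOrderEmb n)).1 a • normInd (superSetoid F n) a =
      (if superSetoid F n g a then normInd (superSetoid F n) g else 0) +
        if le g a ∧ ¬ le a g then normInd (superSetoid F n) a else 0 := by
    intro a
    rw [ht]
    have hs : superSetoid F n g a ↔ le g a ∧ le a g := by
      rw [superSetoid_iff]
      exact ⟨fun h => ⟨fun a b => (h a b).1, fun a b => (h a b).2⟩,
        fun h a b => ⟨h.1 a b, h.2 a b⟩⟩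
    by_cases h3 : le g a
    · by_cases h4 : le a g
      · simp [h3, h4, hs.2 ⟨h3, h4⟩, normInd_congr _ (hs.2 ⟨h3, h4⟩)]
      · simp [h3, h4, hs]
    · simp [h3, hs]
  rw [Finset.sum_congr rfl fun a _ => h2 a, Finset.sum_add_distrib, ← Finset.sum_filter,
    Finset.sum_const] at h1
  set c := Finset.card {a | superSetoid F n g a} with hc
  have hc0 : (c : ℂ) ≠ 0 := by
    rw [Nat.cast_ne_zero, ← Nat.pos_iff_ne_zero, Finset.card_pos]
    exact ⟨g, by simp⟩
  have h5 : (c : ℂ) • normInd (superSetoid F n) g ∈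
      Submodule.span ℂ {x | ∃ t, x = pat F t (Fin.valOrderEmb n)} := by
    rw [Nat.cast_smul_eq_nsmul, eq_sub_of_add_eq h1]
    refine Submodule.sub_mem _ (Submodule.subset_span ⟨t, rfl⟩) (Submodule.sum_mem _ fun a _ => ?_)
    split_ifs with h6
    -- An element strictly above `g` has fewer elements above it, since `g` itself drops out.
    · refine ih _ ?_ a rfl
      rw [← hN]
      refine Finset.card_lt_card ⟨fun x hx => ?_, fun hx => ?_⟩
      · simp only [Finset.mem_filter, Finset.mem_univ, true_and] at hx ⊢
        exact le_trans' h6.1 hx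
      · have := @hx g (by simp only [Finset.mem_filter, Finset.mem_univ, true_and]; exact fun _ _ h => h)
        simp only [Finset.mem_filter, Finset.mem_univ, true_and] at this
        exact h6.2 this
    · exact Submodule.zero_mem _
  have := Submodule.smul_mem _ (c : ℂ)⁻¹ h5
  rwa [smul_smul, inv_mul_cancel₀ hc0, one_smul] at this

/-- Linear statements need only be tested on patterns on the initial intervals `[0, n)`; other sets
`K` enter only through products and coproducts. -/
theorem scf_induction {P : (⨁ n, scf F n) → Prop}
    (hb : ∀ t n, P (patElem F t (Finset.range n)))
    (ha : ∀ x y, P x → P y → P (x + y)) (hs : ∀ (c : ℂ) x, P x → P (c • x)) (x) : P x := by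
  have h0 : P 0 := by
    have := hs 0 _ (hb ⟨fun _ _ => False, fun _ _ _ _ _ _ _ h => h⟩ 0)
    rwa [zero_smul] at this
  have hr : ∀ n, Finset.univ.map (Fin.valOrderEmb n).toEmbedding = Finset.range n := by
    intro n
    ext a
    simp only [Finset.mem_map, Finset.mem_univ, true_and, Finset.mem_range]
    exact ⟨fun ⟨b, hb⟩ => hb ▸ b.2, fun h => ⟨⟨a, h⟩, rfl⟩⟩
  induction x using DirectSum.induction_on with
  | zero => exact h0
  | add x y hx hy => exact ha x y hx hy
  | of n φ =>
    have hφ : φ ∈ Submodule.span ℂ {x | ∃ t, x = pat F t (Fin.valOrderEmb n)} := by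
      rw [← sum_smul_normInd _ φ]
      exact Submodule.sum_mem _ fun a _ => Submodule.smul_mem _ _ (normInd_mem_span a)
    change P (DirectSum.lof ℂ ℕ (fun n => scf F n) n φ)
    induction hφ using Submodule.span_induction with
    | mem x hx =>
      obtain ⟨t, rfl⟩ := hx
      rw [lof_pat t _ _ (hr n)]
      exact hb t n
    | zero => rw [map_zero]; exact h0
    | add x y _ _ hx hy => rw [map_add]; exact ha _ _ hx hy
    | smul c x _ hx => rw [map_smul]; exact hs _ _ hx

/-! ### Multiplication of pattern indicators -/

theorem scfHopf_mul_lof (m n : ℕ) (φ : scf F m) (ψ : scf F n) :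
    (scfHopf F).mul (DirectSum.lof ℂ ℕ (fun n => scf F n) m φ ⊗ₜ
      DirectSum.lof ℂ ℕ (fun n => scf F n) n ψ) =
    DirectSum.lof ℂ ℕ (fun n => scf F n) (m + n) (scfMul F m n φ ψ) := by
  change gradedMul (A := fun n => scf F n) (scfMul F) _ = _
  exact gradedMul_lof (A := fun n => scf F n) (scfMul F) m n φ ψ

theorem scfMul_apply (m n : ℕ) (φ : scf F m) (ψ : scf F n) (g : UT F (m + n)) :
    (scfMul F m n φ ψ).1 g =
      φ.1 (utSub (Fin.castAddOrderEmb n) g) * ψ.1 (utSub (Fin.natAddOrderEmb m) g) := rfl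

/-- Inflation leaves the entries in the block `K × L` free, which is what the pattern of `K ∪ L`
says when no relation joins `K` to `L`. -/
theorem mul_patElem (t : IndRel) (K L : Finset ℕ) (h : ∀ a ∈ K, ∀ b ∈ L, a < b ∧ ¬ t.rel a b) :
    (scfHopf F).mul (patElem F t K ⊗ₜ patElem F t L) = patElem F t (K ∪ L) := by
  set e := K.orderEmbOfFin rfl with he
  set e' := L.orderEmbOfFin rfl with he'
  have heK : ∀ a, e a ∈ K := K.orderEmbOfFin_mem rfl
  have heL : ∀ a, e' a ∈ L := L.orderEmbOfFin_mem rfl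
  let f : Fin (K.card + L.card) ↪o ℕ := OrderEmbedding.ofStrictMono (Fin.append e e') (by
    intro a b hab
    induction a using Fin.addCases with
    | left a =>
      induction b using Fin.addCases with
      | left b => simpa using e.strictMono ((Fin.castAddOrderEmb _).lt_iff_lt.1 hab)
      | right b => simpa using (h _ (heK a) _ (heL b)).1
    | right a =>
      induction b using Fin.addCases with
      | left b => simp [Fin.lt_def] at hab; omega
      | right b => simpa using e'.strictMono ((Fin.natAddOrderEmb _).lt_iff_lt.1 hab))
  have hf1 : ∀ a, f (Fin.castAdd _ a) = e a := fun a => Fin.append_left e e' a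
  have hf2 : ∀ a, f (Fin.natAdd _ a) = e' a := fun a => Fin.append_right e e' a
  rw [patElem, patElem, scfHopf_mul_lof, ← lof_pat t f]
  · congr 1
    refine Subtype.ext (funext fun g => ?_)
    rw [scfMul_apply, pat_apply, pat_apply, pat_apply, ite_mul, one_mul, zero_mul, ← ite_and]
    congr 1
    refine propext ⟨fun H a b hab ht => ?_, fun H => ⟨fun a b hab ht => ?_, fun a b hab ht => ?_⟩⟩
    · induction a using Fin.addCases with
      | left a =>
        induction b using Fin.addCases with
        | left b => exact H.1 a b ((Fin.castAddOrderEmb _).lt_iff_lt.1 hab) (by rwa [hf1, hf1] at ht)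
        | right b => rw [hf1, hf2] at ht; exact absurd ht (h _ (heK a) _ (heL b)).2
      | right a =>
        induction b using Fin.addCases with
        | left b => simp [Fin.lt_def] at hab; omega
        | right b => exact H.2 a b ((Fin.natAddOrderEmb _).lt_iff_lt.1 hab) (by rwa [hf2, hf2] at ht)
    · exact H (Fin.castAdd _ a) (Fin.castAdd _ b) ((Fin.castAddOrderEmb _).lt_iff_lt.2 hab) (by rwa [hf1, hf1])
    · exact H (Fin.natAdd _ a) (Fin.natAdd _ b) ((Fin.natAddOrderEmb _).lt_iff_lt.2 hab) (by rwa [hf2, hf2])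
  · ext a
    have hK : a ∈ K ↔ ∃ b, e b = a := by
      rw [← Set.mem_range, Finset.range_orderEmbOfFin]; rfl
    have hL : a ∈ L ↔ ∃ b, e' b = a := by
      rw [← Set.mem_range, Finset.range_orderEmbOfFin]; rfl
    simp only [Finset.mem_map, Finset.mem_univ, true_and, Finset.mem_union, hK, hL]
    constructor
    · rintro ⟨b, rfl⟩
      induction b using Fin.addCases with
      | left b => exact Or.inl ⟨b, (hf1 b).symm⟩
      | right b => exact Or.inr ⟨b, (hf2 b).symm⟩
    · rintro (⟨b, rfl⟩ | ⟨b, rfl⟩)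
      · exact ⟨_, hf1 b⟩
      · exact ⟨_, hf2 b⟩

/-- The relation which is `t` below `m`, and `s` shifted by `m` from `m` on. -/
def IndRel.combine (t s : IndRel) (m : ℕ) : IndRel where
  rel a b := (b < m ∧ t.rel a b) ∨ (m ≤ a ∧ s.rel (a - m) (b - m))
  closed i j k l h1 h2 h3 := by
    rintro (⟨h4, h5⟩ | ⟨h4, h5⟩)
    · exact Or.inl ⟨by omega, t.closed _ _ _ _ h1 h2 h3 h5⟩
    · exact Or.inr ⟨by omega, s.closed _ _ _ _ (by omega) (by omega) (by omega) h5⟩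

theorem patElem_combine_left (t s : IndRel) (m : ℕ) (K : Finset ℕ) (hK : ∀ a ∈ K, a < m) :
    patElem F (t.combine s m) K = patElem F t K := by
  refine patElem_congr _ _ _ fun a ha b hb _ => ?_
  simp only [IndRel.combine, hK b hb, true_and, (hK a ha).not_ge, false_and, or_false]

/-- Only the relative order of the labels counts, so a pattern may be translated. With the previous
lemma, two unrelated patterns become restrictions of one relation to consecutive intervals. -/
theorem patElem_combine_right (t s : IndRel) (m n : ℕ) :
    patElem F (t.combine s m) (Finset.Ico m (m + n)) = patElem F s (Finset.range n) := by
  rw [← lof_pat (n := n) s (Fin.valOrderEmb n), ← lof_pat (n := n) (t.combine s m)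
    (OrderEmbedding.ofStrictMono (fun a : Fin n => m + (a : ℕ)) fun a b h => by
      have : (a : ℕ) < b := h
      dsimp only
      omega)]
  · congr 1
    refine pat_congr _ _ _ _ fun a b _ => ?_
    change (m + (b : ℕ) < m ∧ _) ∨ (m ≤ m + (a : ℕ) ∧ s.rel (m + a - m) (m + b - m)) ↔
      s.rel a b
    simp
  · ext a
    simp only [Finset.mem_map, Finset.mem_univ, true_and, Finset.mem_Ico]
    exact ⟨fun ⟨b, hb⟩ => hb ▸ ⟨Nat.le_add_right _ _, Nat.add_lt_add_left b.2 m⟩,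
      fun h => ⟨⟨a - m, by omega⟩, Nat.add_sub_cancel' h.1⟩⟩
  · ext a
    simp only [Finset.mem_map, Finset.mem_univ, true_and, Finset.mem_range]
    exact ⟨fun ⟨b, hb⟩ => hb ▸ b.2, fun h => ⟨⟨a, h⟩, rfl⟩⟩

theorem IndRel.not_combine (t s : IndRel) {m a b : ℕ} (ha : a < m) (hb : m ≤ b) :
    ¬ (t.combine s m).rel a b := by
  rintro (⟨h, _⟩ | ⟨h, _⟩) <;> omega

/-! ### The coproduct of pattern indicators -/

variable (F) in
/-- The weight of a pair of sets in the coproduct of a pattern indicator. -/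
def patWeight (t : IndRel) (I J : Finset ℕ) : ℂ :=
  ∏ i ∈ I, ∏ j ∈ J, if i < j ∧ t.rel i j then (Fintype.card F : ℂ)⁻¹ else 1

theorem patWeight_union_left (t : IndRel) {I I' J : Finset ℕ} (h : Disjoint I I') :
    patWeight F t (I ∪ I') J = patWeight F t I J * patWeight F t I' J :=
  Finset.prod_union h

theorem patWeight_union_right (t : IndRel) {I J J' : Finset ℕ} (h : Disjoint J J') :
    patWeight F t I (J ∪ J') = patWeight F t I J * patWeight F t I J' := by
  rw [patWeight, patWeight, patWeight, ← Finset.prod_mul_distrib]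
  exact Finset.prod_congr rfl fun i _ => Finset.prod_union h

theorem patWeight_eq_one (t : IndRel) {I J : Finset ℕ}
    (h : ∀ i ∈ I, ∀ j ∈ J, i < j → ¬ t.rel i j) : patWeight F t I J = 1 :=
  Finset.prod_eq_one fun i hi => Finset.prod_eq_one fun j hj =>
    if_neg fun k => h i hi j hj k.1 k.2

/-- The number of elements of the stabilizer of `I` with given diagonal blocks whose entries in the
off-diagonal block at the positions in a set `Z` vanish. -/
theorem card_UTstab_fibre {n : ℕ} (I : Finset (Fin n)) (Z : Fin n → Fin n → Prop)
    (a : UT F I.card) (b : UT F Iᶜ.card) :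
    Finset.card {g : UTstab F I | UTstabProj I g = (a, b) ∧
      ∀ i ∈ I, ∀ j ∉ I, i < j → Z i j → utMat g.1 i j = 0} =
    ∏ p : Fin n × Fin n, if (p.1 ∈ I ∧ p.2 ∉ I ∧ p.1 < p.2) ∧ ¬ Z p.1 p.2
      then Fintype.card F else 1 := by
  -- The values allowed at each position: free in `I × Iᶜ` above the diagonal and outside `Z`, zero
  -- elsewhere. An element of the fibre amounts to one choice per position.
  let D : Fin n × Fin n → Finset F := fun p =>
    if (p.1 ∈ I ∧ p.2 ∉ I ∧ p.1 < p.2) ∧ ¬ Z p.1 p.2 then Finset.univ else {0}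
  have hD : (∏ p : Fin n × Fin n, if (p.1 ∈ I ∧ p.2 ∉ I ∧ p.1 < p.2) ∧ ¬ Z p.1 p.2
      then Fintype.card F else 1) = (Fintype.piFinset D).card := by
    rw [Fintype.card_piFinset]
    refine Finset.prod_congr rfl fun p _ => ?_
    simp only [D]
    split_ifs <;> simp
  have hD0 : ∀ c ∈ Fintype.piFinset D, ∀ i j,
      ¬ ((i ∈ I ∧ j ∉ I ∧ i < j) ∧ ¬ Z i j) → c (i, j) = 0 := by
    intro c hc i j hij
    have := Fintype.mem_piFinset.1 hc (i, j)
    simp only [D] at this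
    rw [if_neg hij] at this
    simpa using this
  rw [hD]
  refine Finset.card_bij'
    (fun g _ => fun p => if p.1 ∈ I ∧ p.2 ∉ I then utMat g.1 p.1 p.2 else 0)
    -- The inverse adds the entries `c` to the identity matrix and then installs the diagonal blocks
    -- `a` and `b`.
    (fun c hc => replaceBlocks I a b ⟨utMk (1 + Matrix.of fun i j => c (i, j)) (by
      intro i j h
      rw [add_sub_cancel_left, Matrix.of_apply] at h
      by_contra h'
      exact h (hD0 c hc i j fun k => h' k.1.2.2)), by
      intro i hi j hj
      have hij : i ≠ j := fun h => hi (h ▸ hj)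
      rw [utMat_mk, Matrix.add_apply, Matrix.one_apply_ne hij, Matrix.of_apply,
        hD0 c hc i j (fun k => hi k.1.1), add_zero]⟩) ?_ ?_ ?_ ?_
  · intro g hg
    simp only [Finset.mem_filter, Finset.mem_univ, true_and] at hg
    rw [Fintype.mem_piFinset]
    rintro ⟨i, j⟩
    simp only [D]
    split_ifs with h1 h2 h2
    · simp
    · simp
    · rw [Finset.mem_singleton]
      by_cases hij : i < j
      · exact hg.2 i h2.1 j h2.2 hij (by_contra fun k => h1 ⟨⟨h2.1, h2.2, hij⟩, k⟩)
      · rw [utMat_of_not_lt _ hij, Matrix.one_apply_ne]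
        rintro rfl
        exact h2.2 h2.1
    · simp
  · intro c hc
    simp only [Finset.mem_filter, Finset.mem_univ, true_and, proj_replaceBlocks]
    intro i hi j hj hij hZ
    simp only [mat_replaceBlocks, replaceMat, Matrix.of_apply, hi, hj, dif_pos, dif_neg,
      not_false_eq_true, utMat_mk, Matrix.add_apply, Matrix.one_apply_ne hij.ne, zero_add]
    exact hD0 c hc i j fun k => k.2 hZ
  · intro g hg
    simp only [Finset.mem_filter, Finset.mem_univ, true_and] at hg
    refine Eq.trans ?_ (replaceBlocks_replaceBlocks I a a b b g hg.1)
    refine Subtype.ext (ut_ext ?_)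
    ext i j
    have hij : i ∈ I → j ∉ I → i ≠ j := fun h1 h2 h => h2 (h ▸ h1)
    by_cases hi : i ∈ I <;> by_cases hj : j ∈ I <;>
      simp [mat_replaceBlocks, replaceMat, hi, hj, utMat_mk, Matrix.add_apply, Matrix.one_apply, hij]
    rw [if_neg (by rintro rfl; exact hi hj), g.2 i hi j hj]
  · intro c hc
    ext ⟨i, j⟩
    by_cases hi : i ∈ I <;> by_cases hj : j ∈ I
    · simp [hi, hj, hD0 c hc i j (fun k => k.1.2.1 hj)]
    · have hij : i ≠ j := fun h => hj (h ▸ hi)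
      simp [hi, hj, mat_replaceBlocks, replaceMat, utMat_mk, Matrix.one_apply_ne hij]
    · simp [hi, hj, hD0 c hc i j (fun k => k.1.2.1 hj)]
    · simp [hi, hj, hD0 c hc i j (fun k => hi k.1.1)]

end pattern

section comul

variable {F : Type*} [Field F] [Fintype F]

theorem deflate_apply {X Y : Type*} [Fintype X] (π : X → Y) (φ : X → ℂ) (y : Y) :
    deflate π φ y = (∑ x with π x = y, φ x) / (Finset.card {x | π x = y} : ℂ) := rfl

/-- The coproduct component `I` of a superclass function, as an average. -/
theorem scfDeflate_apply {n : ℕ} (I : Finset (Fin n)) (φ : scf F n)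
    (p : UT F I.card × UT F Iᶜ.card) :
    (scfDeflate F I φ).1 p = (∑ g : UTstab F I with UTstabProj I g = p, φ.1 g.1) /
      (Finset.card {g : UTstab F I | UTstabProj I g = p} : ℂ) := by
  refine Eq.trans (b := deflate (UTstabProj I) (fun g => φ.1 g.1) p) rfl ?_
  rw [deflate_apply]
  congr!

/-- The conditions at pairs inside `I` or inside `Iᶜ` concern the two projections, those from `I` to
`Iᶜ` the off-diagonal block, and those from `Iᶜ` to `I` hold on the stabilizer anyway. -/
theorem pat_stab_iff (t : IndRel) {n : ℕ} (e : Fin n ↪o ℕ) (I : Finset (Fin n))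
    (g : UTstab F I) :
    (∀ a b, a < b → t.rel (e a) (e b) → utMat g.1 a b = 0) ↔
      ((∀ a b, a < b → t.rel (e (I.orderEmbOfFin rfl a)) (e (I.orderEmbOfFin rfl b)) →
        utMat (UTstabProj I g).1 a b = 0) ∧
      (∀ a b, a < b → t.rel (e (Iᶜ.orderEmbOfFin rfl a)) (e (Iᶜ.orderEmbOfFin rfl b)) →
        utMat (UTstabProj I g).2 a b = 0)) ∧
      ∀ i ∈ I, ∀ j ∉ I, i < j → t.rel (e i) (e j) → utMat g.1 i j = 0 := by
  refine ⟨fun H => ⟨⟨fun a b hab h => H _ _ ((I.orderEmbOfFin rfl).strictMono hab) h,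
    fun a b hab h => H _ _ ((Iᶜ.orderEmbOfFin rfl).strictMono hab) h⟩,
    fun i _ j _ hij h => H i j hij h⟩, ?_⟩
  rintro ⟨⟨H1, H2⟩, H3⟩ a b hab h
  have aux : ∀ (J : Finset (Fin n)), (∀ a b, a < b →
      t.rel (e (J.orderEmbOfFin rfl a)) (e (J.orderEmbOfFin rfl b)) →
        utMat g.1 (J.orderEmbOfFin rfl a) (J.orderEmbOfFin rfl b) = 0) → a ∈ J → b ∈ J →
        utMat g.1 a b = 0 := by
    intro J hJ ha hb
    have := hJ ((J.orderIsoOfFin rfl).symm ⟨a, ha⟩) ((J.orderIsoOfFin rfl).symm ⟨b, hb⟩)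
      (by simpa using hab)
    rw [emb_orderIso_symm, emb_orderIso_symm] at this
    exact this h
  by_cases ha : a ∈ I <;> by_cases hb : b ∈ I
  · exact aux I H1 ha hb
  · exact H3 a ha b hb hab h
  · exact g.2 a ha b hb
  · exact aux Iᶜ H2 (Finset.mem_compl.2 ha) (Finset.mem_compl.2 hb)

/-- Over a fibre whose diagonal blocks satisfy the pattern, the average is the proportion of
off-diagonal blocks that also do, one factor `q⁻¹` per constrained entry; over every other fibre it
is zero. -/
theorem scfDeflate_pat (t : IndRel) {n : ℕ} (e : Fin n ↪o ℕ) (I : Finset (Fin n)) :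
    (extEquiv (superSetoid F I.card) (superSetoid F Iᶜ.card)).symm (scfDeflate F I (pat F t e)) =
      patWeight F t (I.map e.toEmbedding) (Iᶜ.map e.toEmbedding) •
        (pat F t ((I.orderEmbOfFin rfl).trans e) ⊗ₜ[ℂ]
          pat F t ((Iᶜ.orderEmbOfFin rfl).trans e)) := by
  rw [LinearEquiv.symm_apply_eq, map_smul]
  refine Subtype.ext (funext fun p => ?_)
  obtain ⟨a, b⟩ := p
  change _ = patWeight F t _ _ * ((pat F t ((I.orderEmbOfFin rfl).trans e)).1 a *
    (pat F t ((Iᶜ.orderEmbOfFin rfl).trans e)).1 b)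
  rw [scfDeflate_apply]
  simp only [pat_apply, Finset.sum_boole, Finset.filter_filter]
  -- With no constrained positions, the count is the size of the fibre, the denominator of the
  -- average.
  have h0 : Finset.card {g : UTstab F I | UTstabProj I g = (a, b)} =
      ∏ p : Fin n × Fin n, if p.1 ∈ I ∧ p.2 ∉ I ∧ p.1 < p.2 then Fintype.card F else 1 := by
    have := card_UTstab_fibre I (fun _ _ => False) a b
    simpa using this
  have h1 := card_UTstab_fibre I (fun i j => t.rel (e i) (e j)) a b
  have hq : (Fintype.card F : ℂ) ≠ 0 := Nat.cast_ne_zero.2 Fintype.card_ne_zero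
  have hw : patWeight F t (I.map e.toEmbedding) (Iᶜ.map e.toEmbedding) =
      ∏ p : Fin n × Fin n, if (p.1 ∈ I ∧ p.2 ∉ I ∧ p.1 < p.2) ∧ t.rel (e p.1) (e p.2)
        then (Fintype.card F : ℂ)⁻¹ else 1 := by
    rw [Fintype.prod_prod_type, patWeight, Finset.prod_map]
    have : ∀ i : Fin n, (∏ j : Fin n, if (i ∈ I ∧ j ∉ I ∧ i < j) ∧ t.rel (e i) (e j)
        then (Fintype.card F : ℂ)⁻¹ else 1) = if i ∈ I then ∏ j : Fin n, if j ∈ Iᶜ then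
          (if i < j ∧ t.rel (e i) (e j) then (Fintype.card F : ℂ)⁻¹ else 1) else 1 else 1 := by
      intro i
      split_ifs with hi
      · refine Finset.prod_congr rfl fun j _ => ?_
        by_cases hj : j ∈ I <;> simp [hi, hj]
      · exact Finset.prod_eq_one fun j _ => by simp [hi]
    simp only [this, Finset.prod_ite_mem, Finset.univ_inter, Finset.prod_map]
    refine Finset.prod_congr rfl fun i _ => Finset.prod_congr rfl fun j _ => ?_
    simp
  by_cases hab : (∀ x y, x < y → t.rel (((I.orderEmbOfFin rfl).trans e) x)
      (((I.orderEmbOfFin rfl).trans e) y) → utMat a x y = 0) ∧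
      (∀ x y, x < y → t.rel (((Iᶜ.orderEmbOfFin rfl).trans e) x)
      (((Iᶜ.orderEmbOfFin rfl).trans e) y) → utMat b x y = 0)
  · have h2 : Finset.card {g : UTstab F I | UTstabProj I g = (a, b) ∧
        ∀ x y, x < y → t.rel (e x) (e y) → utMat g.1 x y = 0} =
        ∏ p : Fin n × Fin n, if (p.1 ∈ I ∧ p.2 ∉ I ∧ p.1 < p.2) ∧ ¬ t.rel (e p.1) (e p.2)
          then Fintype.card F else 1 := by
      rw [← h1]
      congr 1
      refine Finset.filter_congr fun g _ => and_congr_right fun hg => ?_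
      rw [pat_stab_iff, hg]
      exact and_iff_right hab
    rw [h2, h0, if_pos hab.1, if_pos hab.2, mul_one, mul_one, hw, Nat.cast_prod, Nat.cast_prod,
      ← Finset.prod_div_distrib]
    refine Finset.prod_congr rfl fun p _ => ?_
    by_cases h3 : p.1 ∈ I ∧ p.2 ∉ I ∧ p.1 < p.2 <;> by_cases h4 : t.rel (e p.1) (e p.2) <;>
      simp [h3, h4, hq]
  · have h2 : Finset.card {g : UTstab F I | UTstabProj I g = (a, b) ∧
        ∀ x y, x < y → t.rel (e x) (e y) → utMat g.1 x y = 0} = 0 := by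
      rw [Finset.card_eq_zero, Finset.filter_eq_empty_iff]
      rintro g _ ⟨hg, H⟩
      rw [pat_stab_iff, hg] at H
      exact hab H.1
    rw [h2]
    rw [not_and_or] at hab
    rcases hab with hab | hab <;> simp only [hab, if_false] <;> simp

theorem scfHopf_comul_lof (n : ℕ) (φ : scf F n) :
    (scfHopf F).comul (DirectSum.lof ℂ ℕ (fun n => scf F n) n φ) = ∑ I : Finset (Fin n),
      TensorProduct.map (DirectSum.lof ℂ ℕ (fun n => scf F n) I.card)
        (DirectSum.lof ℂ ℕ (fun n => scf F n) Iᶜ.card)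
        ((extEquiv (superSetoid F I.card) (superSetoid F Iᶜ.card)).symm (scfDeflate F I φ)) := by
  simp only [scfHopf]
  rw [DirectSum.toModule_lof, LinearMap.sum_apply]
  rfl

/-- Numbering `K` in increasing order matches the subsets of `Fin K.card` with those of `K`, so all
reindexing is confined to this proof. -/
theorem comul_patElem (t : IndRel) (K : Finset ℕ) :
    (scfHopf F).comul (patElem F t K) = ∑ I ∈ K.powerset,
      patWeight F t I (K \ I) • (patElem F t I ⊗ₜ[ℂ] patElem F t (K \ I)) := by
  set e := K.orderEmbOfFin rfl with he
  have hmem : ∀ a, a ∈ K ↔ ∃ b, e b = a := fun a => by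
    rw [← Set.mem_range, Finset.range_orderEmbOfFin]; rfl
  rw [patElem, scfHopf_comul_lof]
  refine Finset.sum_bij (fun I _ => I.map e.toEmbedding) ?_ ?_ ?_ ?_
  · intro I _
    rw [Finset.mem_powerset]
    intro a ha
    obtain ⟨b, _, rfl⟩ := Finset.mem_map.1 ha
    exact (hmem _).2 ⟨b, rfl⟩
  · intro I _ J _ h
    exact Finset.map_injective _ h
  · intro L hL
    rw [Finset.mem_powerset] at hL
    refine ⟨Finset.univ.filter fun a => e a ∈ L, Finset.mem_univ _, ?_⟩
    ext a
    simp only [Finset.mem_map, Finset.mem_filter, Finset.mem_univ, true_and]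
    constructor
    · rintro ⟨b, hb, rfl⟩
      exact hb
    · intro ha
      obtain ⟨b, rfl⟩ := (hmem a).1 (hL ha)
      exact ⟨b, ha, rfl⟩
  · intro I _
    have hc : Iᶜ.map e.toEmbedding = K \ I.map e.toEmbedding := by
      ext a
      rw [Finset.mem_sdiff, hmem]
      simp only [Finset.mem_map, Finset.mem_compl]
      constructor
      · rintro ⟨b, hb, rfl⟩
        exact ⟨⟨b, rfl⟩, fun ⟨c, hc, h⟩ => hb (e.injective h ▸ hc)⟩
      · rintro ⟨⟨b, rfl⟩, h⟩
        exact ⟨b, fun hb => h ⟨b, hb, rfl⟩, rfl⟩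
    have hm : ∀ J : Finset (Fin K.card), Finset.univ.map
        ((J.orderEmbOfFin rfl).trans e).toEmbedding = J.map e.toEmbedding := by
      intro J
      ext a
      simp only [Finset.mem_map, Finset.mem_univ, true_and]
      constructor
      · rintro ⟨b, rfl⟩
        exact ⟨_, J.orderEmbOfFin_mem rfl b, rfl⟩
      · rintro ⟨b, hb, rfl⟩
        refine ⟨(J.orderIsoOfFin rfl).symm ⟨b, hb⟩, ?_⟩
        exact congrArg e (emb_orderIso_symm J rfl b hb)
    rw [scfDeflate_pat, map_smul, TensorProduct.map_tmul, lof_pat t _ _ (hm I),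
      lof_pat t _ _ (hm Iᶜ), hc]

theorem pat_eq_one (t : IndRel) {n : ℕ} (e : Fin n ↪o ℕ) (hn : n = 0) (g : UT F n) :
    (pat F t e).1 g = 1 := by
  subst hn
  rw [pat_apply, if_pos]
  exact fun a => a.elim0

theorem unit_scfHopf (t : IndRel) : (scfHopf F).unit 1 = patElem F t ∅ := by
  have : (scfHopf F).unit 1 =
    DirectSum.lof ℂ ℕ (fun n => scf F n) 0 ⟨fun _ => 1, fun _ _ _ => rfl⟩ := by
    simp [scfHopf]
  rw [this, patElem]
  refine congrArg (DirectSum.lof ℂ ℕ (fun n => scf F n) 0) (Subtype.ext (funext fun g => ?_))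
  exact (pat_eq_one t _ rfl g).symm

theorem counit_scfHopf_lof (n : ℕ) (hn : n ≠ 0) (φ : scf F n) :
    (scfHopf F).counit (DirectSum.lof ℂ ℕ (fun n => scf F n) n φ) = 0 := by
  simp only [scfHopf, LinearMap.comp_apply]
  rw [DirectSum.component.of, dif_neg hn]
  simp

theorem counit_scfHopf_lof_zero (φ : scf F 0) :
    (scfHopf F).counit (DirectSum.lof ℂ ℕ (fun n => scf F n) 0 φ) = φ.1 1 := by
  simp only [scfHopf, LinearMap.comp_apply]
  rw [DirectSum.component.lof_self]
  rfl

theorem counit_patElem (t : IndRel) (K : Finset ℕ) :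
    (scfHopf F).counit (patElem F t K) = if K = ∅ then 1 else 0 := by
  split_ifs with h
  · subst h
    refine (counit_scfHopf_lof_zero _).trans ?_
    exact pat_eq_one t _ rfl 1
  · exact counit_scfHopf_lof _ (by simpa using h) _

end comul

/-! ### The Hopf algebra axioms for superclass functions. -/

section hopf

variable (F : Type*) [Field F] [Fintype F]

theorem scfHopf_unit_mul (x) : (scfHopf F).mul ((scfHopf F).unit 1 ⊗ₜ x) = x := by
  induction x using scf_induction with
  | hb t n => rw [unit_scfHopf t, mul_patElem _ _ _ (by simp), Finset.empty_union]
  | ha x y hx hy => rw [TensorProduct.tmul_add, map_add, hx, hy]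
  | hs c x hx => rw [TensorProduct.tmul_smul, map_smul, hx]

theorem scfHopf_mul_unit (x) : (scfHopf F).mul (x ⊗ₜ (scfHopf F).unit 1) = x := by
  induction x using scf_induction with
  | hb t n => rw [unit_scfHopf t, mul_patElem _ _ _ (by simp), Finset.union_empty]
  | ha x y hx hy => rw [TensorProduct.add_tmul, map_add, hx, hy]
  | hs c x hx => rw [← TensorProduct.smul_tmul', map_smul, hx]

variable {F}

theorem scf_linear_ext {M : Type*} [AddCommMonoid M] [Module ℂ M] {f g : (⨁ n, scf F n) →ₗ[ℂ] M}
    (h : ∀ t K, f (patElem F t K) = g (patElem F t K)) : f = g := by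
  refine LinearMap.ext fun x => ?_
  induction x using scf_induction with
  | hb t n => exact h t _
  | ha x y hx hy => rw [map_add, map_add, hx, hy]
  | hs c x hx => rw [map_smul, map_smul, hx]

/-- Any two basic patterns can be placed side by side under one combined relation with nothing
across, so bilinear identities need only be checked where `mul_patElem` applies. -/
theorem scf_bilinear_ext {M : Type*} [AddCommMonoid M] [Module ℂ M]
    {f g : (⨁ n, scf F n) ⊗[ℂ] (⨁ n, scf F n) →ₗ[ℂ] M}
    (h : ∀ (t : IndRel) (K L : Finset ℕ), (∀ a ∈ K, ∀ b ∈ L, a < b ∧ ¬ t.rel a b) →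
      f (patElem F t K ⊗ₜ patElem F t L) = g (patElem F t K ⊗ₜ patElem F t L)) : f = g := by
  refine TensorProduct.ext' fun x y => ?_
  induction x using scf_induction with
  | ha x x' hx hx' => rw [TensorProduct.add_tmul, map_add, map_add, hx, hx']
  | hs c x hx => rw [← TensorProduct.smul_tmul', map_smul, map_smul, hx]
  | hb t m =>
    induction y using scf_induction with
    | ha x x' hx hx' => rw [TensorProduct.tmul_add, map_add, map_add, hx, hx']
    | hs c x hx => rw [TensorProduct.tmul_smul, map_smul, map_smul, hx]
    | hb s n =>
      rw [← patElem_combine_left t s m _ (by simp), ← patElem_combine_right t s m n]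
      refine h _ _ _ fun a ha b hb => ?_
      simp only [Finset.mem_range, Finset.mem_Ico] at ha hb
      exact ⟨by omega, IndRel.not_combine _ _ ha hb.1⟩

variable (F)

/-- Place the three patterns on consecutive intervals under one relation; both sides are then the
pattern of the union. -/
theorem scfHopf_mul_assoc (x y z) : (scfHopf F).mul ((scfHopf F).mul (x ⊗ₜ y) ⊗ₜ z) =
    (scfHopf F).mul (x ⊗ₜ (scfHopf F).mul (y ⊗ₜ z)) := by
  induction x using scf_induction with
  | ha x x' hx hx' => simp only [TensorProduct.add_tmul, map_add, hx, hx']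
  | hs c x hx => simp only [← TensorProduct.smul_tmul', map_smul, hx]
  | hb t m =>
  induction y using scf_induction with
  | ha x x' hx hx' => simp only [TensorProduct.tmul_add, TensorProduct.add_tmul, map_add, hx, hx']
  | hs c x hx => simp only [TensorProduct.tmul_smul, ← TensorProduct.smul_tmul', map_smul, hx]
  | hb s n =>
  induction z using scf_induction with
  | ha x x' hx hx' => simp only [TensorProduct.tmul_add, map_add, hx, hx']
  | hs c x hx => simp only [TensorProduct.tmul_smul, map_smul, hx]
  | hb r p =>
  rw [← patElem_combine_left t s m _ (by simp), ← patElem_combine_right t s m n]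
  set u := t.combine s m with hu
  rw [← patElem_combine_left u r (m + n) (Finset.range m) (by simp; omega),
    ← patElem_combine_left u r (m + n) (Finset.Ico m (m + n)) (by simp),
    ← patElem_combine_right u r (m + n) p]
  have h1 : ∀ a < m + n, ∀ b, m + n ≤ b → ¬ (u.combine r (m + n)).rel a b :=
    fun a ha b hb => IndRel.not_combine _ _ ha hb
  have h2 : ∀ a < m, ∀ b, m ≤ b → b < m + n → ¬ (u.combine r (m + n)).rel a b := by
    rintro a ha b hb hb' (⟨_, h⟩ | ⟨h, _⟩)
    · exact IndRel.not_combine _ _ ha hb h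
    · omega
  have h3 : ∀ a < m, ∀ b, m ≤ b → ¬ (u.combine r (m + n)).rel a b := by
    intro a ha b hb
    by_cases h : b < m + n
    · exact h2 a ha b hb h
    · exact h1 a (by omega) b (by omega)
  rw [mul_patElem, mul_patElem, mul_patElem, mul_patElem, Finset.union_assoc]
  all_goals
    intro a ha b hb
    simp only [Finset.mem_range, Finset.mem_Ico, Finset.mem_union] at ha hb
    refine ⟨by omega, ?_⟩
    first
    | exact h1 a (by omega) b (by omega)
    | exact h3 a (by omega) b (by omega)

/-- Both sides sum over ordered splittings of `K` into three parts, and in both the weight is the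
product of the weights of the three ordered pairs of parts. -/
theorem scfHopf_coassoc : (TensorProduct.assoc ℂ (⨁ n, scf F n) (⨁ n, scf F n) (⨁ n, scf F n)).toLinearMap ∘ₗ
    (scfHopf F).comul.rTensor _ ∘ₗ (scfHopf F).comul =
      (scfHopf F).comul.lTensor _ ∘ₗ (scfHopf F).comul := by
  refine scf_linear_ext fun t K => ?_
  simp only [LinearMap.comp_apply, comul_patElem, map_sum, map_smul, LinearMap.rTensor_tmul,
    LinearMap.lTensor_tmul, TensorProduct.sum_tmul, TensorProduct.tmul_sum,
    ← TensorProduct.smul_tmul', TensorProduct.tmul_smul, LinearEquiv.coe_coe,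
    TensorProduct.assoc_tmul, Finset.smul_sum, smul_smul]
  rw [Finset.sum_sigma', Finset.sum_sigma']
  -- On the left `I ⊆ K` is split again by `I' ⊆ I`; on the right the first part `I'` is chosen
  -- first, and then `I \ I'` inside `K \ I'`.
  refine Finset.sum_bij' (fun p _ => ⟨p.2, p.1 \ p.2⟩) (fun p _ => ⟨p.1 ∪ p.2, p.1⟩) ?_ ?_ ?_ ?_ ?_
  · rintro ⟨I, I'⟩ h
    simp only [Finset.mem_sigma, Finset.mem_powerset] at h ⊢
    exact ⟨h.2.trans h.1, Finset.sdiff_subset_sdiff h.1 le_rfl⟩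
  · rintro ⟨I, I'⟩ h
    simp only [Finset.mem_sigma, Finset.mem_powerset] at h ⊢
    exact ⟨Finset.union_subset h.1 (h.2.trans Finset.sdiff_subset), Finset.subset_union_left⟩
  · rintro ⟨I, I'⟩ h
    simp only [Finset.mem_sigma, Finset.mem_powerset] at h
    simp [Finset.union_sdiff_of_subset h.2]
  · rintro ⟨I, I'⟩ h
    simp only [Finset.mem_sigma, Finset.mem_powerset, Finset.subset_sdiff] at h
    simp [Finset.union_sdiff_cancel_left h.2.2.symm]
  · rintro ⟨I, I'⟩ h
    simp only [Finset.mem_sigma, Finset.mem_powerset] at h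
    have e1 : (K \ I') \ (I \ I') = K \ I := by
      ext a
      have := @h.2 a
      simp only [Finset.mem_sdiff]
      tauto
    have e2 : K \ I' = (I \ I') ∪ (K \ I) := by
      ext a
      have := @h.2 a
      have := @h.1 a
      simp only [Finset.mem_sdiff, Finset.mem_union]
      tauto
    simp only [e1]
    refine congrArg (· • _) ?_
    have e3 : patWeight F t I (K \ I) =
        patWeight F t I' (K \ I) * patWeight F t (I \ I') (K \ I) := by
      rw [← patWeight_union_left t Finset.disjoint_sdiff, Finset.union_sdiff_of_subset h.2]
    rw [e3, e2, patWeight_union_right]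
    · ring
    · exact Finset.disjoint_sdiff.mono_left Finset.sdiff_subset

/-- A splitting of `K ∪ L` is a splitting of `K` together with one of `L`, and the weights multiply
because the mixed pairs contribute nothing. -/
theorem scfHopf_comul_mul : (scfHopf F).comul ∘ₗ (scfHopf F).mul =
    TensorProduct.map (scfHopf F).mul (scfHopf F).mul ∘ₗ
      (TensorProduct.tensorTensorTensorComm ℂ (⨁ n, scf F n) (⨁ n, scf F n) (⨁ n, scf F n)
        (⨁ n, scf F n)).toLinearMap ∘ₗ
        TensorProduct.map (scfHopf F).comul (scfHopf F).comul := by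
  refine scf_bilinear_ext fun t K L h => ?_
  have hd : Disjoint K L := Finset.disjoint_left.2 fun a ha hb => (h a ha a hb).1.false
  simp only [LinearMap.comp_apply, TensorProduct.map_tmul, mul_patElem t K L h, comul_patElem]
  simp only [TensorProduct.sum_tmul, TensorProduct.tmul_sum, ← TensorProduct.smul_tmul',
    TensorProduct.tmul_smul, Finset.smul_sum, smul_smul, map_sum, map_smul, LinearEquiv.coe_coe,
    TensorProduct.tensorTensorTensorComm_tmul, TensorProduct.map_tmul]
  rw [Finset.sum_sigma']
  symm
  refine Finset.sum_bij' (fun p _ => p.2 ∪ p.1) (fun I _ => ⟨I ∩ L, I ∩ K⟩) ?_ ?_ ?_ ?_ ?_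
  · rintro ⟨J, I⟩ hp
    simp only [Finset.mem_sigma, Finset.mem_powerset] at hp ⊢
    exact Finset.union_subset_union hp.2 hp.1
  · intro I _
    simp
  · rintro ⟨J, I⟩ hp
    simp only [Finset.mem_sigma, Finset.mem_powerset] at hp
    have h1 : I ∩ L = ∅ := Finset.disjoint_iff_inter_eq_empty.1 (hd.mono_left hp.2)
    have h2 : J ∩ K = ∅ := Finset.disjoint_iff_inter_eq_empty.1 (hd.symm.mono_left hp.1)
    simp [Finset.union_inter_distrib_right, h1, h2, Finset.inter_eq_left.2 hp.1,
      Finset.inter_eq_left.2 hp.2]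
  · intro I hI
    rw [Finset.mem_powerset] at hI
    rw [← Finset.inter_union_distrib_left, Finset.inter_eq_left.2 hI]
  · rintro ⟨J, I⟩ hp
    simp only [Finset.mem_sigma, Finset.mem_powerset] at hp
    have e : (K ∪ L) \ (I ∪ J) = (K \ I) ∪ (L \ J) := by
      ext a
      have : a ∈ K → a ∉ L := fun h => Finset.disjoint_left.1 hd h
      have := @hp.1 a
      have := @hp.2 a
      simp only [Finset.mem_sdiff, Finset.mem_union]
      tauto
    simp only [e]
    rw [mul_patElem t I J fun a ha b hb => h a (hp.2 ha) b (hp.1 hb), mul_patElem t (K \ I) (L \ J)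
      fun a ha b hb => h a (Finset.sdiff_subset ha) b (Finset.sdiff_subset hb)]
    refine congrArg (· • _) ?_
    -- The pairs in `I × (L \ J)` are in order but unrelated, and those in `J × (K \ I)` are in the
    -- wrong order.
    rw [patWeight_union_left t (hd.mono hp.2 hp.1),
      patWeight_union_right t (hd.mono Finset.sdiff_subset Finset.sdiff_subset),
      patWeight_union_right t (hd.mono Finset.sdiff_subset Finset.sdiff_subset),
      patWeight_eq_one t (I := I) (J := L \ J)
        fun i hi j hj _ => (h i (hp.2 hi) j (Finset.sdiff_subset hj)).2,
      patWeight_eq_one t (I := J) (J := K \ I)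
        fun i hi j hj hij => absurd (h j (Finset.sdiff_subset hj) i (hp.1 hi)).1 hij.not_gt]
    ring

theorem scfHopf_counit_comul (x) :
    TensorProduct.lid ℂ _ ((scfHopf F).counit.rTensor _ ((scfHopf F).comul x)) = x := by
  refine LinearMap.congr_fun (f := (TensorProduct.lid ℂ _).toLinearMap ∘ₗ
    (scfHopf F).counit.rTensor _ ∘ₗ (scfHopf F).comul) (g := LinearMap.id)
    (scf_linear_ext fun t K => ?_) x
  simp only [LinearMap.comp_apply, comul_patElem, map_sum, map_smul, LinearMap.rTensor_tmul,
    LinearEquiv.coe_coe, TensorProduct.lid_tmul, counit_patElem, LinearMap.id_apply]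
  rw [Finset.sum_eq_single ∅]
  · simp [patWeight]
  · intro I _ hI
    simp [hI]
  · simp

theorem scfHopf_comul_counit (x) :
    TensorProduct.rid ℂ _ ((scfHopf F).counit.lTensor _ ((scfHopf F).comul x)) = x := by
  refine LinearMap.congr_fun (f := (TensorProduct.rid ℂ _).toLinearMap ∘ₗ
    (scfHopf F).counit.lTensor _ ∘ₗ (scfHopf F).comul) (g := LinearMap.id)
    (scf_linear_ext fun t K => ?_) x
  simp only [LinearMap.comp_apply, comul_patElem, map_sum, map_smul, LinearMap.lTensor_tmul,
    LinearEquiv.coe_coe, TensorProduct.rid_tmul, counit_patElem, LinearMap.id_apply]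
  rw [Finset.sum_eq_single K]
  · simp [patWeight]
  · intro I hI hIK
    have : K \ I ≠ ∅ := fun h => hIK
      (Finset.Subset.antisymm (Finset.mem_powerset.1 hI) (Finset.sdiff_eq_empty_iff_subset.1 h))
    simp [this]
  · simp

theorem scfHopf_comul_unit : (scfHopf F).comul ((scfHopf F).unit 1) =
    (scfHopf F).unit 1 ⊗ₜ (scfHopf F).unit 1 := by
  rw [unit_scfHopf ⟨fun _ _ => False, fun _ _ _ _ _ _ _ h => h⟩, comul_patElem]
  simp [patWeight]

theorem scfHopf_counit_unit : (scfHopf F).counit ((scfHopf F).unit 1) = 1 := by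
  rw [unit_scfHopf ⟨fun _ _ => False, fun _ _ _ _ _ _ _ h => h⟩, counit_patElem, if_pos rfl]

theorem scfHopf_counit_mul (x y) : (scfHopf F).counit ((scfHopf F).mul (x ⊗ₜ y)) =
    (scfHopf F).counit x * (scfHopf F).counit y := by
  refine LinearMap.congr_fun (f := (scfHopf F).counit ∘ₗ (scfHopf F).mul)
    (g := tmulFun (A := ⨁ n, scf F n) (B := ⨁ n, scf F n) (scfHopf F).counit (scfHopf F).counit) (scf_bilinear_ext fun t K L h => ?_)
    (x ⊗ₜ y)
  rw [LinearMap.comp_apply, mul_patElem t K L h, tmulFun_tmul, counit_patElem, counit_patElem,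
    counit_patElem]
  by_cases hK : K = ∅ <;> by_cases hL : L = ∅ <;> simp [Finset.union_eq_empty, hK, hL]

theorem scfHopf_comul_mem (n : ℕ) (x : scf F n) :
    (scfHopf F).comul (DirectSum.lof ℂ ℕ (fun n => scf F n) n x) ∈
      ⨆ p ∈ Finset.HasAntidiagonal.antidiagonal n,
        LinearMap.range (TensorProduct.map (DirectSum.lof ℂ ℕ (fun n => scf F n) p.1)
          (DirectSum.lof ℂ ℕ (fun n => scf F n) p.2)) := by
  rw [scfHopf_comul_lof]
  refine Submodule.sum_mem _ fun I _ => ?_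
  refine Submodule.mem_iSup_of_mem (I.card, Iᶜ.card) (Submodule.mem_iSup_of_mem ?_ ⟨_, rfl⟩)
  rw [Finset.HasAntidiagonal.mem_antidiagonal, Finset.card_add_card_compl, Fintype.card_fin]

instance : Subsingleton (UT F 0) := ⟨fun _ _ => ut_ext (Subsingleton.elim _ _)⟩

theorem finrank_classSpace_of_subsingleton {G : Type*} [Nonempty G] [Subsingleton G]
    (r : Setoid G) : Module.finrank ℂ (classSpace r) = 1 := by
  obtain ⟨a⟩ := ‹Nonempty G›
  refine finrank_eq_one (⟨fun _ => 1, fun _ _ _ => rfl⟩ : classSpace r) ?_ fun φ => ⟨φ.1 a, ?_⟩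
  · intro h
    exact one_ne_zero (congrFun (congrArg Subtype.val h) a)
  · refine Subtype.ext (funext fun x => ?_)
    rw [Subsingleton.elim x a]
    exact mul_one _

theorem isGradedConnectedHopf_scfHopf : IsGradedConnectedHopf (scfHopf F) where
  mul_assoc := scfHopf_mul_assoc F
  unit_mul := scfHopf_unit_mul F
  mul_unit := scfHopf_mul_unit F
  coassoc := scfHopf_coassoc F
  counit_comul := scfHopf_counit_comul F
  comul_counit := scfHopf_comul_counit F
  comul_mul := scfHopf_comul_mul F
  comul_unit := scfHopf_comul_unit F
  counit_mul := scfHopf_counit_mul F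
  counit_unit := scfHopf_counit_unit F
  exists_antipode := by
    refine exists_antipode_of_connected (scfHopf_mul_assoc F) (scfHopf_unit_mul F)
      (scfHopf_mul_unit F) (scfHopf_coassoc F) (scfHopf_counit_comul F) (scfHopf_comul_counit F)
      (scfHopf_comul_mem F) fun x => ?_
    rw [counit_scfHopf_lof_zero, HopfMaps.unit_apply]
    have : (scfHopf F).unit 1 =
        DirectSum.lof ℂ ℕ (fun n => scf F n) 0 ⟨fun _ => 1, fun _ _ _ => rfl⟩ := by
      simp [scfHopf]
    rw [this, ← map_smul]
    congr 1
    refine Subtype.ext (funext fun g => ?_)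
    rw [Subsingleton.elim g 1]
    exact mul_one _
  mul_mem m n x y := ⟨_, (scfHopf_mul_lof m n x y).symm⟩
  unit_mem := ⟨⟨fun _ => 1, fun _ _ _ => rfl⟩, by simp [scfHopf]⟩
  comul_mem := scfHopf_comul_mem F
  counit_eq_zero n hn x := counit_scfHopf_lof n hn x
  connected := finrank_classSpace_of_subsingleton _

end hopf

/-! ### Class functions as functions of endomorphisms -/

section ev

variable {F : Type*} [Field F] [Fintype F]
  {V : Type*} [AddCommGroup V] [Module F V] [Finite V]
  {V' : Type*} [AddCommGroup V'] [Module F V'] [Finite V']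

instance Submodule.finite_quotient_of_finite (W : Submodule F V) : Finite (V ⧸ W) :=
  Finite.of_surjective _ W.mkQ_surjective

instance LinearMap.finite_of_finite : Finite (V →ₗ[F] V') :=
  Finite.of_injective (fun f : V →ₗ[F] V' => (f : V → V')) DFunLike.coe_injective

instance LinearMap.fintype_of_finite : Fintype (V →ₗ[F] V') := Fintype.ofFinite _

instance Submodule.fintype_of_finite : Fintype (Submodule F V) := Fintype.ofFinite _

/-- Extension by zero of a class function to all matrices. -/
def matFun {n : ℕ} (φ : cfGL F n) (M : Matrix (Fin n) (Fin n) F) : ℂ :=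
  if h : IsUnit M then φ.1 h.unit else 0

theorem matFun_coe {n : ℕ} (φ : cfGL F n) (g : GL (Fin n) F) : matFun φ g.1 = φ.1 g := by
  rw [matFun, dif_pos g.isUnit, IsUnit.unit_of_val_units]

theorem matFun_of_not_isUnit {n : ℕ} (φ : cfGL F n) {M : Matrix (Fin n) (Fin n) F}
    (h : ¬ IsUnit M) : matFun φ M = 0 := dif_neg h

theorem matFun_add {n : ℕ} (φ ψ : cfGL F n) (M : Matrix (Fin n) (Fin n) F) :
    matFun (φ + ψ) M = matFun φ M + matFun ψ M := by
  rw [matFun, matFun, matFun]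
  split_ifs
  · rfl
  · rw [add_zero]

theorem matFun_smul {n : ℕ} (c : ℂ) (φ : cfGL F n) (M : Matrix (Fin n) (Fin n) F) :
    matFun (c • φ) M = c * matFun φ M := by
  rw [matFun, matFun]
  split_ifs
  · rfl
  · rw [mul_zero]

theorem matFun_zero {n : ℕ} (M : Matrix (Fin n) (Fin n) F) : matFun (0 : cfGL F n) M = 0 := by
  rw [← zero_smul ℂ (0 : cfGL F n), matFun_smul, zero_mul]

attribute [irreducible] matFun

theorem matFun_conj {n : ℕ} (φ : cfGL F n) (M P Q : Matrix (Fin n) (Fin n) F) (h : P * Q = 1) :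
    matFun φ (P * M * Q) = matFun φ M := by
  let u : GL (Fin n) F := ⟨P, Q, h, mul_eq_one_comm.1 h⟩
  by_cases hM : IsUnit M
  · obtain ⟨g, rfl⟩ := hM
    have : P * g.1 * Q = (u * g * u⁻¹ : GL (Fin n) F).1 := rfl
    rw [this, matFun_coe, matFun_coe]
    exact φ.2 _ _ (isConj_iff.2 ⟨u⁻¹, by group⟩)
  · rw [matFun_of_not_isUnit _ hM, matFun_of_not_isUnit]
    intro h'
    have : Q * (P * M * Q) * P = M := by
      have h2 := mul_eq_one_comm.1 h
      calc Q * (P * M * Q) * P = (Q * P) * M * (Q * P) := by noncomm_ring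
        _ = M := by rw [h2, one_mul, mul_one]
    rw [← this] at hM
    exact hM (((u⁻¹).isUnit.mul h').mul u.isUnit)

/-- The value of a family of class functions at an endomorphism of a finite vector space, zero
when the endomorphism is not invertible. -/
def ev (x : ∀ n, cfGL F n) (f : Module.End F V) : ℂ :=
  matFun (x (Module.finrank F V)) (LinearMap.toMatrix (Module.finBasis F V) (Module.finBasis F V) f)

/-- A change of basis conjugates the matrix, which class functions do not see; so the basis chosen
in `ev` is immaterial. -/
theorem ev_eq_matFun (x : ∀ n, cfGL F n) {n : ℕ} (b : Module.Basis (Fin n) F V)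
    (f : Module.End F V) : ev x f = matFun (x n) (LinearMap.toMatrix b b f) := by
  have hn : Module.finrank F V = n := by rw [Module.finrank_eq_card_basis b, Fintype.card_fin]
  subst hn
  rw [ev, ← basis_toMatrix_mul_linearMap_toMatrix_mul_basis_toMatrix (Module.finBasis F V) b
    (Module.finBasis F V) b f, matFun_conj]
  exact Module.Basis.toMatrix_mul_toMatrix_flip _ _

theorem ev_toLin' (x : ∀ n, cfGL F n) {n : ℕ} (M : Matrix (Fin n) (Fin n) F) :
    ev x (Matrix.toLin' M) = matFun (x n) M := by
  rw [ev_eq_matFun x (Pi.basisFun F (Fin n))]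
  congr 1
  exact LinearMap.toMatrix'_toLin' M

theorem ev_equiv (x : ∀ n, cfGL F n) (e : V ≃ₗ[F] V') {f : Module.End F V} {f' : Module.End F V'}
    (h : ∀ v, e (f v) = f' (e v)) : ev x f = ev x f' := by
  rw [ev_eq_matFun x (Module.finBasis F V), ev_eq_matFun x ((Module.finBasis F V).map e)]
  congr 1
  ext i j
  simp [LinearMap.toMatrix_apply, ← h]

theorem ev_of_not_isUnit (x : ∀ n, cfGL F n) {f : Module.End F V} (h : ¬ IsUnit f) :
    ev x f = 0 := by
  refine matFun_of_not_isUnit _ fun h' => h ?_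
  rwa [LinearMap.isUnit_toMatrix_iff] at h'

theorem exists_toLin'_of_isUnit {f : Module.End F V} (hf : IsUnit f) :
    ∃ (g : GL (Fin (Module.finrank F V)) F) (e : V ≃ₗ[F] (Fin (Module.finrank F V) → F)),
      ∀ v, e (f v) = Matrix.toLin' g.1 (e v) := by
  let b := Module.finBasis F V
  obtain ⟨g, hg⟩ := (LinearMap.isUnit_toMatrix_iff b).2 hf
  refine ⟨g, b.equivFun, fun v => ?_⟩
  rw [hg, Matrix.toLin'_apply]
  exact (LinearMap.toMatrix_mulVec_repr b b f v).symm

theorem exists_toLin' (f : Module.End F V) {n : ℕ} (h : Module.finrank F V = n) :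
    ∃ (M : Matrix (Fin n) (Fin n) F) (e : V ≃ₗ[F] (Fin n → F)),
      ∀ v, e (f v) = Matrix.toLin' M (e v) := by
  subst h
  let b := Module.finBasis F V
  refine ⟨LinearMap.toMatrix b b f, b.equivFun, fun v => ?_⟩
  rw [Matrix.toLin'_apply]
  exact (LinearMap.toMatrix_mulVec_repr b b f v).symm

/-- Evaluation at an endomorphism, as a functional on `⨁ n, cf(GL_n)`. -/
def evL (f : Module.End F V) : (⨁ n, cfGL F n) →ₗ[ℂ] ℂ where
  toFun x := ev (fun n => x n) f
  map_add' x y := by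
    simp only [ev, DirectSum.add_apply, matFun_add]
  map_smul' c x := by
    simp only [ev, DirectSum.smul_apply, matFun_smul, RingHom.id_apply, smul_eq_mul]

theorem evL_apply (f : Module.End F V) (x : ⨁ n, cfGL F n) : evL f x = ev (fun n => x n) f := rfl

theorem evL_lof_of_ne {n : ℕ} (φ : cfGL F n) (f : Module.End F V) (h : Module.finrank F V ≠ n) :
    evL f (DirectSum.lof ℂ ℕ (fun n => cfGL F n) n φ) = 0 := by
  have h0 : DirectSum.lof ℂ ℕ (fun n => cfGL F n) n φ (Module.finrank F V) = 0 :=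
    DirectSum.of_eq_of_ne (β := fun n => cfGL F n) n (Module.finrank F V) φ h
  rw [evL_apply, ev, h0, matFun_zero]

attribute [irreducible] ev

theorem evL_lof_toLin' {n : ℕ} (φ : cfGL F n) (M : Matrix (Fin n) (Fin n) F) :
    evL (Matrix.toLin' M) (DirectSum.lof ℂ ℕ (fun n => cfGL F n) n φ) = matFun φ M := by
  rw [evL_apply, ev_toLin', DirectSum.lof_apply]

theorem evL_lof_of_isUnit {n : ℕ} (φ : cfGL F n) (g : GL (Fin n) F) :
    evL (Matrix.toLin' g.1) (DirectSum.lof ℂ ℕ (fun n => cfGL F n) n φ) = φ.1 g := by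
  rw [evL_lof_toLin', matFun_coe]

theorem evL_equiv (e : V ≃ₗ[F] V') {f : Module.End F V} {f' : Module.End F V'}
    (h : ∀ v, e (f v) = f' (e v)) : evL f = evL f' := by
  refine LinearMap.ext fun x => ?_
  rw [evL_apply, evL_apply]
  exact ev_equiv _ e h

-- Invertible matrices acting on coordinate spaces suffice for testing equality, while the
-- functionals themselves exist for all endomorphisms, as needed for subspaces and quotients.
variable (F) in
theorem separating_evL : Separating (A := ⨁ n, cfGL F n) fun p : Σ n, GL (Fin n) F =>
    evL (F := F) (V := Fin p.1 → F) (Matrix.toLin' p.2.1) := by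
  intro x hx
  refine DFinsupp.ext fun n => Subtype.ext (funext fun g => ?_)
  have := hx ⟨n, g⟩
  rw [evL_apply, ev_toLin', matFun_coe] at this
  exact this

/-! ### Invariant subspaces -/

/-- The endomorphism induced on an invariant subspace. -/
def resEnd (f : Module.End F V) (W : Submodule F V) (h : W ≤ W.comap f) : Module.End F W :=
  f.restrict h

/-- The endomorphism induced on the quotient by an invariant subspace. -/
def quoEnd (f : Module.End F V) (W : Submodule F V) (h : W ≤ W.comap f) : Module.End F (V ⧸ W) :=
  W.mapQ W f h

/-- Lets a stable subspace be replaced by any space embedded onto it compatibly with the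
endomorphisms; `ev_quoEnd` is the dual statement. -/
theorem ev_resEnd (x : ∀ n, cfGL F n) {f : Module.End F V} {W : Submodule F V}
    (h : W ≤ W.comap f) (i : V' →ₗ[F] V) (hi : Function.Injective i) (hW : LinearMap.range i = W)
    (f' : Module.End F V') (hf : ∀ v, i (f' v) = f (i v)) : ev x (resEnd f W h) = ev x f' := by
  subst hW
  refine (ev_equiv x (LinearEquiv.ofInjective i hi) fun v => Subtype.ext ?_).symm
  exact hf v

theorem ev_quoEnd (x : ∀ n, cfGL F n) {f : Module.End F V} {W : Submodule F V}
    (h : W ≤ W.comap f) (p : V →ₗ[F] V') (hp : Function.Surjective p) (hW : LinearMap.ker p = W)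
    (f' : Module.End F V') (hf : ∀ v, p (f v) = f' (p v)) : ev x (quoEnd f W h) = ev x f' := by
  subst hW
  refine ev_equiv x (p.quotKerEquivOfSurjective hp) fun v => ?_
  obtain ⟨v, rfl⟩ := Submodule.mkQ_surjective _ v
  exact hf v

/-- A vector killed by `f` dies in the quotient, so it lies in `W`, where it is zero; finiteness
turns injectivity into invertibility. -/
theorem isUnit_of_resEnd_quoEnd {f : Module.End F V} {W : Submodule F V} (h : W ≤ W.comap f)
    (h1 : IsUnit (resEnd f W h)) (h2 : IsUnit (quoEnd f W h)) : IsUnit f := by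
  rw [Module.End.isUnit_iff] at h1 h2 ⊢
  refine Finite.injective_iff_bijective.1 ((injective_iff_map_eq_zero f).2 fun v hv => ?_)
  have hvW : v ∈ W := by
    rw [← Submodule.Quotient.mk_eq_zero]
    refine (injective_iff_map_eq_zero _).1 h2.1 _ ?_
    change W.mapQ W f h (W.mkQ v) = 0
    rw [Submodule.mkQ_apply, Submodule.mapQ_apply, hv, Submodule.Quotient.mk_zero]
  have := (injective_iff_map_eq_zero _).1 h1.1 ⟨v, hvW⟩ (Subtype.ext hv)
  exact congrArg Subtype.val this

/-- The term of the product of two families of class functions at `f` that belongs to the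
subspace `W`. -/
def prodTerm (x y : ∀ n, cfGL F n) (f : Module.End F V) (W : Submodule F V) : ℂ :=
  if h : W ≤ W.comap f then ev x (resEnd f W h) * ev y (quoEnd f W h) else 0

theorem prodTerm_equiv (x y : ∀ n, cfGL F n) (e : V ≃ₗ[F] V') {f : Module.End F V}
    {f' : Module.End F V'} (he : ∀ v, e (f v) = f' (e v)) (W : Submodule F V) :
    prodTerm x y f' (W.map e.toLinearMap) = prodTerm x y f W := by
  have hiff : W.map e.toLinearMap ≤ (W.map e.toLinearMap).comap f' ↔ W ≤ W.comap f := by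
    constructor
    · intro h v hv
      obtain ⟨w, hw, hwe⟩ := h (Submodule.mem_map_of_mem hv)
      have : w = f v := e.injective (hwe.trans (he v).symm)
      rwa [this] at hw
    · rintro h _ ⟨v, hv, rfl⟩
      exact ⟨f v, h hv, he v⟩
  rw [prodTerm, prodTerm]
  by_cases h : W ≤ W.comap f
  · rw [dif_pos h, dif_pos (hiff.2 h)]
    refine congrArg₂ (· * ·) ?_ ?_
    · refine ev_resEnd x (hiff.2 h) (e.toLinearMap ∘ₗ W.subtype)
        (e.injective.comp W.injective_subtype) ?_ _ fun v => he v
      rw [LinearMap.range_comp, Submodule.range_subtype]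
    · refine (ev_quoEnd y h ((W.map e.toLinearMap).mkQ ∘ₗ e.toLinearMap)
        ((Submodule.mkQ_surjective _).comp e.surjective) ?_ _ fun v => ?_).symm
      · ext v
        simp
      · change Submodule.Quotient.mk (e (f v)) = _
        rw [he]
        rfl
  · rw [dif_neg h, dif_neg (fun h' => h (hiff.1 h'))]

theorem sum_prodTerm_equiv (x y : ∀ n, cfGL F n) (e : V ≃ₗ[F] V') {f : Module.End F V}
    {f' : Module.End F V'} (he : ∀ v, e (f v) = f' (e v)) :
    ∑ W, prodTerm x y f W = ∑ W, prodTerm x y f' W :=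
  Fintype.sum_equiv (Submodule.orderIsoMapComap e).toEquiv _ _
    fun W => (prodTerm_equiv x y e he W).symm

theorem prodTerm_of_not_isUnit (x y : ∀ n, cfGL F n) {f : Module.End F V} (hf : ¬ IsUnit f)
    (W : Submodule F V) : prodTerm x y f W = 0 := by
  rw [prodTerm]
  split_ifs with h
  · by_cases h1 : IsUnit (resEnd f W h)
    · rw [ev_of_not_isUnit y fun h2 => hf (isUnit_of_resEnd_quoEnd h h1 h2), mul_zero]
    · rw [ev_of_not_isUnit x h1, zero_mul]
  · rfl

/-- The family of class functions supported in one degree. -/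
abbrev lofFam {n : ℕ} (φ : cfGL F n) : ∀ n, cfGL F n :=
  fun m => DirectSum.lof ℂ ℕ (fun n => cfGL F n) n φ m

theorem ev_lofFam_of_ne {n : ℕ} (φ : cfGL F n) (f : Module.End F V) (h : Module.finrank F V ≠ n) :
    ev (lofFam φ) f = 0 := evL_lof_of_ne φ f h

theorem prodTerm_lofFam_of_ne {k l : ℕ} (φ : cfGL F k) (ψ : cfGL F l) (f : Module.End F V)
    (W : Submodule F V) (h : Module.finrank F W ≠ k ∨ Module.finrank F (V ⧸ W) ≠ l) :
    prodTerm (lofFam φ) (lofFam ψ) f W = 0 := by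
  rw [prodTerm]
  split_ifs
  · rcases h with h | h
    · rw [ev_lofFam_of_ne φ _ h, zero_mul]
    · rw [ev_lofFam_of_ne ψ _ h, mul_zero]
  · rfl

/-! ### Parabolic induction as a sum over invariant subspaces -/

variable (F) in
/-- The span of the first `k` coordinate vectors. -/
def coordSub (k l : ℕ) : Submodule F (Fin (k + l) → F) where
  carrier := {v | ∀ j, v (Fin.natAdd k j) = 0}
  zero_mem' _ := rfl
  add_mem' hv hw j := by rw [Pi.add_apply, hv j, hw j, add_zero]
  smul_mem' c v hv j := by rw [Pi.smul_apply, hv j, smul_zero]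

variable (F) in
/-- The inclusion of the first `k` coordinates. -/
def coordIncl (k l : ℕ) : (Fin k → F) →ₗ[F] (Fin (k + l) → F) where
  toFun v := Fin.append v 0
  map_add' v w := by
    ext i
    induction i using Fin.addCases <;> simp
  map_smul' c v := by
    ext i
    induction i using Fin.addCases <;> simp

variable (F) in
/-- The projection onto the last `l` coordinates. -/
def coordProj (k l : ℕ) : (Fin (k + l) → F) →ₗ[F] (Fin l → F) := LinearMap.funLeft F F (Fin.natAdd k)

theorem coordIncl_injective (k l : ℕ) : Function.Injective (coordIncl F k l) := by
  intro v w h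
  ext i
  have := congrFun h (Fin.castAdd l i)
  simpa [coordIncl] using this

theorem range_coordIncl (k l : ℕ) : LinearMap.range (coordIncl F k l) = coordSub F k l := by
  ext v
  constructor
  · rintro ⟨w, rfl⟩ j
    simp [coordIncl]
  · intro hv
    refine ⟨fun i => v (Fin.castAdd l i), ?_⟩
    ext i
    induction i using Fin.addCases with
    | left i => simp [coordIncl]
    | right i => simpa [coordIncl] using (hv i).symm

theorem finrank_coordSub (k l : ℕ) : Module.finrank F (coordSub F k l) = k := by
  rw [← range_coordIncl, LinearMap.finrank_range_of_inj (coordIncl_injective k l),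
    Module.finrank_fin_fun]

theorem coordProj_surjective (k l : ℕ) : Function.Surjective (coordProj F k l) := by
  intro v
  refine ⟨Fin.append 0 v, ?_⟩
  ext i
  simp [coordProj, LinearMap.funLeft_apply]

theorem ker_coordProj (k l : ℕ) : LinearMap.ker (coordProj F k l) = coordSub F k l := by
  ext v
  exact ⟨fun h j => congrFun h j, fun h => funext h⟩

theorem mem_maxParabolic_iff (k l : ℕ) (g : GL (Fin (k + l)) F) :
    g ∈ maxParabolic F k l ↔ coordSub F k l ≤ (coordSub F k l).comap (Matrix.toLin' g.1) := by
  constructor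
  · intro hg v hv j
    have hl : ∀ i j, g.1 (Fin.natAdd k i) (Fin.castAdd l j) = 0 := maxParabolic_lower ⟨g, hg⟩
    rw [Matrix.toLin'_apply, Matrix.mulVec, dotProduct, Fin.sum_univ_add]
    simp only [hl, zero_mul, Finset.sum_const_zero, zero_add]
    exact Finset.sum_eq_zero fun i _ => by rw [hv i, mul_zero]
  · intro h i j hij
    induction i using Fin.addCases with
    | left i => induction j using Fin.addCases <;> simp at hij
    | right i =>
      induction j using Fin.addCases with
      | left j =>
        have h1 : Pi.single (Fin.castAdd l j) (1 : F) ∈ coordSub F k l := fun i => by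
          rw [Pi.single_eq_of_ne]
          intro h
          have := congrArg Fin.val h
          simp only [Fin.val_natAdd, Fin.val_castAdd] at this
          omega
        have := h h1 i
        rwa [Matrix.toLin'_apply, Matrix.mulVec_single_one] at this
      | right j => simp at hij

/-- `P_{k,l}` is the stabilizer of `coordSub`, and its two Levi projections are the actions on this
subspace and on its quotient. -/
theorem prodTerm_coordSub {k l : ℕ} (φ : cfGL F k) (ψ : cfGL F l) (g : GL (Fin (k + l)) F) :
    prodTerm (lofFam φ) (lofFam ψ) (Matrix.toLin' g.1) (coordSub F k l) =
      if h : g ∈ maxParabolic F k l then φ.1 (leviFst k l ⟨g, h⟩) * ψ.1 (leviSnd k l ⟨g, h⟩)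
      else 0 := by
  rw [prodTerm]
  by_cases h : g ∈ maxParabolic F k l
  · have h' := (mem_maxParabolic_iff k l g).1 h
    have hl : ∀ i j, g.1 (Fin.natAdd k i) (Fin.castAdd l j) = 0 := maxParabolic_lower ⟨g, h⟩
    rw [dif_pos h, dif_pos h']
    rw [ev_resEnd (lofFam φ) h' (coordIncl F k l) (coordIncl_injective k l) (range_coordIncl k l)
      (Matrix.toLin' (leviFst k l ⟨g, h⟩).1), ev_quoEnd (lofFam ψ) h' (coordProj F k l)
      (coordProj_surjective k l) (ker_coordProj k l) (Matrix.toLin' (leviSnd k l ⟨g, h⟩).1)]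
    · exact congrArg₂ _ (evL_lof_of_isUnit φ _) (evL_lof_of_isUnit ψ _)
    · intro v
      ext i
      change (g.1.mulVec v) (Fin.natAdd k i) = ∑ j, g.1 (Fin.natAdd k i) (Fin.natAdd k j) *
        v (Fin.natAdd k j)
      rw [Matrix.mulVec, dotProduct, Fin.sum_univ_add]
      simp [hl]
    · intro v
      ext i
      change Fin.append ((g.1.submatrix (Fin.castAdd l) (Fin.castAdd l)).mulVec v) 0 i =
        ∑ j, g.1 i j * Fin.append v 0 j
      rw [Fin.sum_univ_add]
      induction i using Fin.addCases with
      | left i => simp [Matrix.mulVec, dotProduct]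
      | right i => simp [hl]
  · rw [dif_neg h, dif_neg fun h' => h ((mem_maxParabolic_iff k l g).2 h')]

/-- An invertible matrix as an automorphism of the space of column vectors. -/
def glEquiv {n : ℕ} (g : GL (Fin n) F) : (Fin n → F) ≃ₗ[F] (Fin n → F) :=
  LinearEquiv.ofLinearMap (Matrix.toLin' g.1) (Matrix.toLin' (g⁻¹).1)
    (by rw [← Matrix.toLin'_mul, ← Units.val_mul, mul_inv_cancel, Units.val_one, Matrix.toLin'_one])
    (by rw [← Matrix.toLin'_mul, ← Units.val_mul, inv_mul_cancel, Units.val_one, Matrix.toLin'_one])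

theorem glEquiv_apply {n : ℕ} (g : GL (Fin n) F) (v : Fin n → F) :
    glEquiv g v = Matrix.toLin' g.1 v := rfl

theorem exists_linearEquiv_map_eq {W W' : Submodule F V}
    (h : Module.finrank F W = Module.finrank F W') :
    ∃ e : V ≃ₗ[F] V, W.map e.toLinearMap = W' := by
  obtain ⟨U, hU⟩ := W.exists_isCompl
  obtain ⟨U', hU'⟩ := W'.exists_isCompl
  have h1 := Submodule.finrank_add_eq_of_isCompl hU
  have h2 := Submodule.finrank_add_eq_of_isCompl hU'
  let a := LinearEquiv.ofFinrankEq (R := F) W W' h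
  let b := LinearEquiv.ofFinrankEq (R := F) U U' (by omega)
  let e := (Submodule.prodEquivOfIsCompl W U hU).symm.trans
    ((a.prodCongr b).trans (Submodule.prodEquivOfIsCompl W' U' hU'))
  have he : ∀ w : W, e w = a w := by
    intro w
    simp [e]
  refine ⟨e, ?_⟩
  ext v
  constructor
  · rintro ⟨w, hw, rfl⟩
    exact he ⟨w, hw⟩ ▸ (a ⟨w, hw⟩).2
  · intro hv
    refine ⟨a.symm ⟨v, hv⟩, (a.symm ⟨v, hv⟩).2, ?_⟩
    change e _ = v
    rw [he]
    simp

theorem exists_glEquiv_map_eq {n : ℕ} {W W' : Submodule F (Fin n → F)}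
    (h : Module.finrank F W = Module.finrank F W') :
    ∃ g : GL (Fin n) F, W.map (Matrix.toLin' g.1) = W' := by
  obtain ⟨e, he⟩ := exists_linearEquiv_map_eq h
  have h1 : LinearMap.toMatrix' e.toLinearMap * LinearMap.toMatrix' e.symm.toLinearMap = 1 := by
    rw [← LinearMap.toMatrix'_comp, LinearEquiv.comp_symm, LinearMap.toMatrix'_id]
  refine ⟨⟨_, _, h1, mul_eq_one_comm.1 h1⟩, ?_⟩
  change W.map (Matrix.toLin' (LinearMap.toMatrix' e.toLinearMap)) = W'
  rwa [Matrix.toLin'_toMatrix']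

/-- `GL` is transitive on subspaces of a given dimension, so the elements carrying `coordSub` to `W`
form a left coset of its stabilizer `P_{k,l}`. -/
theorem card_map_coordSub {k l : ℕ} (W : Submodule F (Fin (k + l) → F))
    (hW : Module.finrank F W = k) :
    Finset.card {x : GL (Fin (k + l)) F | (coordSub F k l).map (Matrix.toLin' x.1) = W} =
      Fintype.card (maxParabolic F k l) := by
  obtain ⟨x₀, rfl⟩ := exists_glEquiv_map_eq (W := coordSub F k l) (W' := W)
    (by rw [hW, finrank_coordSub])
  have hmul : ∀ x y : GL (Fin (k + l)) F, (coordSub F k l).map (Matrix.toLin' (x * y).1) =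
      ((coordSub F k l).map (Matrix.toLin' y.1)).map (Matrix.toLin' x.1) := fun x y => by
    rw [Units.val_mul, Matrix.toLin'_mul, Submodule.map_comp]
  have hP : ∀ p : GL (Fin (k + l)) F, p ∈ maxParabolic F k l ↔
      (coordSub F k l).map (Matrix.toLin' p.1) = coordSub F k l := by
    intro p
    rw [mem_maxParabolic_iff, ← Submodule.map_le_iff_le_comap]
    refine ⟨fun h => Submodule.eq_of_le_of_finrank_eq h ?_, fun h => h.le⟩
    exact LinearEquiv.finrank_map_eq (glEquiv p) _
  rw [Fintype.card_subtype]
  refine Finset.card_bij' (fun x _ => x₀⁻¹ * x) (fun p _ => x₀ * p) ?_ ?_ ?_ ?_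
  · intro x hx
    simp only [Finset.mem_filter, Finset.mem_univ, true_and] at hx ⊢
    rw [hP, hmul, hx, ← hmul, inv_mul_cancel, Units.val_one, Matrix.toLin'_one, Submodule.map_id]
  · intro p hp
    simp only [Finset.mem_filter, Finset.mem_univ, true_and] at hp ⊢
    rw [hmul, (hP p).1 hp]
  · intro x _
    group
  · intro x _
    group

/-- The summand at `x` in the induction formula is the term of the subspace `x · coordSub`. Each
subspace of dimension `k` arises `|P_{k,l}|` times, cancelling the normalization, and terms of other
dimensions vanish. -/
theorem cfGLMul_apply {k l : ℕ} (φ : cfGL F k) (ψ : cfGL F l) (g : GL (Fin (k + l)) F) :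
    (cfGLMul F k l φ ψ).1 g = ∑ W, prodTerm (lofFam φ) (lofFam ψ) (Matrix.toLin' g.1) W := by
  have h1 : (cfGLMul F k l φ ψ).1 g = (Fintype.card (maxParabolic F k l) : ℂ)⁻¹ *
      ∑ x : GL (Fin (k + l)) F, prodTerm (lofFam φ) (lofFam ψ) (Matrix.toLin' g.1)
        ((coordSub F k l).map (Matrix.toLin' x.1)) := by
    change _ * _ = _
    congr 1
    refine Finset.sum_congr rfl fun x _ => ?_
    rw [← prodTerm_coordSub]
    refine (prodTerm_equiv _ _ (glEquiv x) (fun v => ?_) _).symm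
    rw [glEquiv_apply, glEquiv_apply, ← LinearMap.comp_apply, ← LinearMap.comp_apply,
      ← Matrix.toLin'_mul, ← Matrix.toLin'_mul, ← Units.val_mul, ← Units.val_mul]
    congr 3
    group
  have h2 : ∑ x : GL (Fin (k + l)) F, prodTerm (lofFam φ) (lofFam ψ) (Matrix.toLin' g.1)
        ((coordSub F k l).map (Matrix.toLin' x.1)) =
      ∑ W, (Fintype.card (maxParabolic F k l) : ℂ) *
        prodTerm (lofFam φ) (lofFam ψ) (Matrix.toLin' g.1) W := by
    rw [← Finset.sum_fiberwise_of_maps_to (t := Finset.univ)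
      (g := fun x : GL (Fin (k + l)) F => (coordSub F k l).map (Matrix.toLin' x.1))
      (fun _ _ => Finset.mem_univ _)]
    refine Finset.sum_congr rfl fun W _ => ?_
    by_cases hW : Module.finrank F W = k
    · rw [Finset.sum_congr rfl (g := fun _ =>
        prodTerm (lofFam φ) (lofFam ψ) (Matrix.toLin' g.1) W), Finset.sum_const,
        card_map_coordSub W hW, nsmul_eq_mul]
      intro x hx
      simp only [Finset.mem_filter, Finset.mem_univ, true_and] at hx
      rw [hx]
    · rw [prodTerm_lofFam_of_ne φ ψ _ W (Or.inl hW), mul_zero]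
      refine Finset.sum_eq_zero fun x hx => ?_
      simp only [Finset.mem_filter, Finset.mem_univ, true_and] at hx
      rw [hx, prodTerm_lofFam_of_ne φ ψ _ W (Or.inl hW)]
  rw [h1, h2, ← Finset.mul_sum, inv_mul_cancel_left₀]
  exact Nat.cast_ne_zero.2 Fintype.card_ne_zero

theorem cfGLHopf_mul_lof (m n : ℕ) (φ : cfGL F m) (ψ : cfGL F n) :
    (cfGLHopf F).mul (DirectSum.lof ℂ ℕ (fun n => cfGL F n) m φ ⊗ₜ
      DirectSum.lof ℂ ℕ (fun n => cfGL F n) n ψ) =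
    DirectSum.lof ℂ ℕ (fun n => cfGL F n) (m + n) (cfGLMul F m n φ ψ) := by
  change gradedMul (A := fun n => cfGL F n) (cfGLMul F) _ = _
  exact gradedMul_lof (A := fun n => cfGL F n) (cfGLMul F) m n φ ψ

/-- Extension to all endomorphisms: if `f` is singular or the dimension is not `k + l`, both sides
vanish term by term. -/
theorem evL_cfGLMul {k l : ℕ} (φ : cfGL F k) (ψ : cfGL F l) (f : Module.End F V) :
    evL f (DirectSum.lof ℂ ℕ (fun n => cfGL F n) (k + l) (cfGLMul F k l φ ψ)) =
      ∑ W, prodTerm (lofFam φ) (lofFam ψ) f W := by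
  by_cases hn : Module.finrank F V = k + l
  · obtain ⟨M, e, he⟩ := exists_toLin' f hn
    rw [evL_equiv e he, sum_prodTerm_equiv _ _ e he, evL_lof_toLin']
    by_cases hM : IsUnit M
    · obtain ⟨g, rfl⟩ := hM
      rw [matFun_coe, cfGLMul_apply]
    · rw [matFun_of_not_isUnit _ hM]
      refine (Finset.sum_eq_zero fun W _ => prodTerm_of_not_isUnit _ _ (fun h => hM ?_) W).symm
      rw [← LinearMap.toMatrix'_toLin' M]
      exact (LinearMap.isUnit_toMatrix_iff (Pi.basisFun F _)).2 h
  · rw [evL_lof_of_ne _ _ hn]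
    refine (Finset.sum_eq_zero fun W _ => prodTerm_lofFam_of_ne _ _ _ _ ?_).symm
    have := Submodule.finrank_quotient_add_finrank W
    by_contra! h
    omega

theorem prodTerm_eq (x y : ⨁ n, cfGL F n) (f : Module.End F V) (W : Submodule F V) :
    prodTerm (fun n => x n) (fun n => y n) f W =
      if h : W ≤ W.comap f then evL (resEnd f W h) x * evL (quoEnd f W h) y else 0 := rfl

/-- The product of `⨁ n, cf(GL_n)` as a sum over invariant subspaces. -/
theorem evL_mul (x y : ⨁ n, cfGL F n) (f : Module.End F V) :
    evL f ((cfGLHopf F).mul (x ⊗ₜ y)) = ∑ W, prodTerm (fun n => x n) (fun n => y n) f W := by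
  simp only [prodTerm_eq]
  induction x using DirectSum.induction_on with
  | zero => simp
  | add x x' hx hx' =>
    simp only [TensorProduct.add_tmul, map_add, hx, hx', ← Finset.sum_add_distrib, add_mul]
    refine Finset.sum_congr rfl fun W _ => ?_
    split_ifs <;> simp
  | of k φ =>
    induction y using DirectSum.induction_on with
    | zero => simp
    | add x x' hx hx' =>
      simp only [TensorProduct.tmul_add, map_add, hx, hx', ← Finset.sum_add_distrib, mul_add]
      refine Finset.sum_congr rfl fun W _ => ?_
      split_ifs <;> simp
    | of l ψ =>
      have := evL_cfGLMul φ ψ f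
      simp only [prodTerm] at this
      rw [← cfGLHopf_mul_lof] at this
      exact this

end ev

/-! ### Parabolic restriction as an average -/

section comul_cf

variable {F : Type*} [Field F] [Fintype F]
  {A : Type*} [AddCommGroup A] [Module F A] [Finite A]
  {B : Type*} [AddCommGroup B] [Module F B] [Finite B]
  {A' : Type*} [AddCommGroup A'] [Module F A'] [Finite A']
  {B' : Type*} [AddCommGroup B'] [Module F B'] [Finite B']

/-- The block upper triangular endomorphism with diagonal blocks `a`, `b` and off-diagonal
block `c`. -/
def blk (a : Module.End F A) (b : Module.End F B) (c : B →ₗ[F] A) : Module.End F (A × B) :=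
  (a ∘ₗ LinearMap.fst F A B + c ∘ₗ LinearMap.snd F A B).prod (b ∘ₗ LinearMap.snd F A B)

theorem blk_apply (a : Module.End F A) (b : Module.End F B) (c : B →ₗ[F] A) (v : A × B) :
    blk a b c v = (a v.1 + c v.2, b v.2) := rfl

theorem isUnit_of_isUnit_blk {a : Module.End F A} {b : Module.End F B} {c : B →ₗ[F] A}
    (h : IsUnit (blk a b c)) : IsUnit a ∧ IsUnit b := by
  rw [Module.End.isUnit_iff] at h
  constructor
  · rw [Module.End.isUnit_iff]
    refine Finite.injective_iff_bijective.1 ((injective_iff_map_eq_zero a).2 fun v hv => ?_)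
    have := (injective_iff_map_eq_zero _).1 h.1 (v, 0) (by simp [blk_apply, hv])
    exact congrArg Prod.fst this
  · rw [Module.End.isUnit_iff]
    refine Finite.surjective_iff_bijective.1 fun w => ?_
    obtain ⟨v, hv⟩ := h.2 (0, w)
    exact ⟨v.2, congrArg Prod.snd hv⟩

/-- The average of the values of `x` at all block upper triangular endomorphisms with given
diagonal blocks. -/
def avgEv (x : ∀ n, cfGL F n) (a : Module.End F A) (b : Module.End F B) : ℂ :=
  (Fintype.card (B →ₗ[F] A) : ℂ)⁻¹ * ∑ c : B →ₗ[F] A, ev x (blk a b c)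

theorem avgEv_of_not_isUnit (x : ∀ n, cfGL F n) (a : Module.End F A) (b : Module.End F B)
    (h : ¬ IsUnit a ∨ ¬ IsUnit b) : avgEv x a b = 0 := by
  rw [avgEv, Finset.sum_eq_zero, mul_zero]
  intro c _
  refine ev_of_not_isUnit _ fun hc => ?_
  have := isUnit_of_isUnit_blk hc
  tauto

theorem avgEv_equiv (x : ∀ n, cfGL F n) (e : A ≃ₗ[F] A') (e' : B ≃ₗ[F] B')
    {a : Module.End F A} {b : Module.End F B} {a' : Module.End F A'} {b' : Module.End F B'}
    (h : ∀ v, e (a v) = a' (e v)) (h' : ∀ v, e' (b v) = b' (e' v)) :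
    avgEv x a b = avgEv x a' b' := by
  let E : (B →ₗ[F] A) ≃ (B' →ₗ[F] A') := (e'.arrowCongr e).toEquiv
  rw [avgEv, avgEv, Fintype.card_congr E]
  refine congrArg _ (Fintype.sum_equiv E _ _ fun c => ev_equiv x (e.prodCongr e') fun v => ?_)
  have : ∀ w, E c (e' w) = e (c w) := fun w => by simp [E]
  rw [blk_apply, blk_apply]
  change (e _, e' _) = (a' (e v.1) + E c (e' v.2), b' (e' v.2))
  rw [this, map_add, h, h']

theorem tmulFun_map {M N M' N' : Type*} [AddCommGroup M] [Module ℂ M] [AddCommGroup N] [Module ℂ N]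
    [AddCommGroup M'] [Module ℂ M'] [AddCommGroup N'] [Module ℂ N'] (f : M' →ₗ[ℂ] ℂ)
    (g : N' →ₗ[ℂ] ℂ) (p : M →ₗ[ℂ] M') (q : N →ₗ[ℂ] N') (t : M ⊗[ℂ] N) :
    tmulFun f g (TensorProduct.map p q t) = tmulFun (f ∘ₗ p) (g ∘ₗ q) t := by
  rw [tmulFun, tmulFun, LinearMap.comp_apply, LinearMap.comp_apply, TensorProduct.map_comp]
  rfl

theorem tmulFun_zero_left {M N : Type*} [AddCommGroup M] [Module ℂ M] [AddCommGroup N]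
    [Module ℂ N] (g : N →ₗ[ℂ] ℂ) (t : M ⊗[ℂ] N) : tmulFun 0 g t = 0 := by
  rw [tmulFun, LinearMap.comp_apply, TensorProduct.map_zero_left, LinearMap.zero_apply, map_zero]

theorem tmulFun_zero_right {M N : Type*} [AddCommGroup M] [Module ℂ M] [AddCommGroup N]
    [Module ℂ N] (f : M →ₗ[ℂ] ℂ) (t : M ⊗[ℂ] N) : tmulFun f 0 t = 0 := by
  rw [tmulFun, LinearMap.comp_apply, TensorProduct.map_zero_right, LinearMap.zero_apply, map_zero]

theorem evL_comp_lof_of_ne {n : ℕ} (f : Module.End F A) (h : Module.finrank F A ≠ n) :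
    evL f ∘ₗ DirectSum.lof ℂ ℕ (fun n => cfGL F n) n = 0 :=
  LinearMap.ext fun φ => evL_lof_of_ne φ f h

theorem evL_of_not_isUnit {f : Module.End F A} (h : ¬ IsUnit f) : evL f = 0 := by
  refine LinearMap.ext fun x => ?_
  rw [evL_apply]
  exact ev_of_not_isUnit _ h

/-- The functional `x ⊗ y ↦ x(a) y(b)`. -/
abbrev evL₂ (a : Module.End F A) (b : Module.End F B) :
    (⨁ n, cfGL F n) ⊗[ℂ] (⨁ n, cfGL F n) →ₗ[ℂ] ℂ :=
  tmulFun (A := ⨁ n, cfGL F n) (B := ⨁ n, cfGL F n) (evL a) (evL b)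

theorem tmulFun_extEquiv {k l : ℕ} (g : GL (Fin k) F) (h : GL (Fin l) F)
    (t : cfGL F k ⊗[ℂ] cfGL F l) :
    tmulFun (evL (Matrix.toLin' g.1) ∘ₗ DirectSum.lof ℂ ℕ (fun n => cfGL F n) k)
      (evL (Matrix.toLin' h.1) ∘ₗ DirectSum.lof ℂ ℕ (fun n => cfGL F n) l) t =
      (extEquiv (IsConj.setoid (GL (Fin k) F)) (IsConj.setoid (GL (Fin l) F)) t).1 (g, h) := by
  change _ = (extProd _ _ t).1 (g, h)
  induction t using TensorProduct.induction_on with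
  | zero => rw [LinearMap.map_zero, LinearMap.map_zero]; rfl
  | add s t hs ht => rw [map_add, hs, ht, map_add]; rfl
  | tmul φ ψ =>
    rw [tmulFun_tmul, LinearMap.comp_apply, LinearMap.comp_apply, evL_lof_of_isUnit,
      evL_lof_of_isUnit]
    rfl

variable (F) in
/-- Splitting a vector into its first `k` and last `l` coordinates. -/
def splitEquiv (k l : ℕ) : (Fin (k + l) → F) ≃ₗ[F] (Fin k → F) × (Fin l → F) where
  toFun v := (fun i => v (Fin.castAdd l i), fun i => v (Fin.natAdd k i))
  map_add' _ _ := rfl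
  map_smul' _ _ := rfl
  invFun w := Fin.append w.1 w.2
  left_inv v := by
    ext i
    induction i using Fin.addCases <;> simp
  right_inv w := by
    refine Prod.ext ?_ ?_
    · ext i; simp
    · ext i; simp

/-- The upper right block parametrizes the fibre of the Levi projection: it is unrestricted, since
invertible diagonal blocks already force an invertible matrix. -/
theorem deflate_levi {k l : ℕ} (φ : cfGL F (k + l)) (g : GL (Fin k) F) (h : GL (Fin l) F) :
    (cfGLDeflate F k l φ).1 (g, h) =
      avgEv (lofFam φ) (Matrix.toLin' g.1) (Matrix.toLin' h.1) := by
  let T : maxParabolic F k l → ((Fin l → F) →ₗ[F] (Fin k → F)) := fun p =>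
    Matrix.toLin' (p.1.1.submatrix (Fin.castAdd l) (Fin.natAdd k))
  have h1 : (cfGLDeflate F k l φ).1 (g, h) =
      deflate (levi k l) (fun p : maxParabolic F k l => φ.1 p.1) (g, h) := rfl
  have hlevi : ∀ p : maxParabolic F k l, levi k l p = (g, h) ↔
      p.1.1.submatrix (Fin.castAdd l) (Fin.castAdd l) = g.1 ∧
        p.1.1.submatrix (Fin.natAdd k) (Fin.natAdd k) = h.1 := by
    intro p
    rw [Prod.ext_iff, Units.ext_iff, Units.ext_iff]
    rfl
  have hTinj : ∀ p q : maxParabolic F k l, levi k l p = (g, h) → levi k l q = (g, h) →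
      T p = T q → p = q := by
    intro p q hp hq hT
    rw [hlevi] at hp hq
    have hT := Matrix.toLin'.injective hT
    refine Subtype.ext (Units.ext ?_)
    ext i j
    induction i using Fin.addCases with
    | left i =>
      induction j using Fin.addCases with
      | left j => exact congrFun₂ (hp.1.trans hq.1.symm) i j
      | right j => exact congrFun₂ hT i j
    | right i =>
      induction j using Fin.addCases with
      | left j => rw [maxParabolic_lower p, maxParabolic_lower q]
      | right j => exact congrFun₂ (hp.2.trans hq.2.symm) i j
  have hTsurj : ∀ c, ∃ p : maxParabolic F k l, levi k l p = (g, h) ∧ T p = c := by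
    intro c
    let D : Matrix (Fin (k + l)) (Fin (k + l)) F := Matrix.reindex finSumFinEquiv finSumFinEquiv
      (Matrix.fromBlocks g.1 (LinearMap.toMatrix' c) 0 h.1)
    have hD : D.det ≠ 0 := by
      rw [Matrix.det_reindex_self, Matrix.det_fromBlocks_zero₂₁]
      exact mul_ne_zero ((Matrix.isUnit_iff_isUnit_det _).1 g.isUnit).ne_zero
        ((Matrix.isUnit_iff_isUnit_det _).1 h.isUnit).ne_zero
    refine ⟨⟨Matrix.GeneralLinearGroup.mkOfDetNeZero D hD, ?_⟩, (hlevi _).2 ⟨?_, ?_⟩, ?_⟩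
    · intro i j
      induction i using Fin.addCases with
      | left i => induction j using Fin.addCases <;> simp
      | right i =>
        induction j using Fin.addCases with
        | left j =>
          intro _
          change D _ _ = 0
          simp [D]
        | right j => simp
    · ext i j
      change D (Fin.castAdd l i) (Fin.castAdd l j) = _
      simp [D]
    · ext i j
      change D (Fin.natAdd k i) (Fin.natAdd k j) = _
      simp [D]
    · refine (congrArg Matrix.toLin' (?_ : _ = LinearMap.toMatrix' c)).trans
        (Matrix.toLin'_toMatrix' c)
      ext i j
      change D (Fin.castAdd l i) (Fin.natAdd k j) = _
      simp [D]
  have hval : ∀ p : maxParabolic F k l, levi k l p = (g, h) →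
      φ.1 p.1 = ev (lofFam φ) (blk (Matrix.toLin' g.1) (Matrix.toLin' h.1) (T p)) := by
    intro p hp
    rw [hlevi] at hp
    rw [← evL_lof_of_isUnit φ p.1, evL_apply]
    refine ev_equiv _ (splitEquiv F k l) fun v => ?_
    rw [blk_apply, ← hp.1, ← hp.2]
    refine Prod.ext ?_ ?_
    · ext i
      change ∑ j, p.1.1 (Fin.castAdd l i) j * v j =
        (∑ j, p.1.1 (Fin.castAdd l i) (Fin.castAdd l j) * v (Fin.castAdd l j)) +
          ∑ j, p.1.1 (Fin.castAdd l i) (Fin.natAdd k j) * v (Fin.natAdd k j)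
      rw [Fin.sum_univ_add]
    · ext i
      change ∑ j, p.1.1 (Fin.natAdd k i) j * v j =
        ∑ j, p.1.1 (Fin.natAdd k i) (Fin.natAdd k j) * v (Fin.natAdd k j)
      rw [Fin.sum_univ_add]
      simp only [maxParabolic_lower p, zero_mul, Finset.sum_const_zero, zero_add]
  rw [h1, deflate_apply, avgEv, div_eq_inv_mul]
  refine congrArg₂ (· * ·) (congrArg (fun m : ℕ => (m : ℂ)⁻¹) ?_) ?_
  · refine Finset.card_bij (fun p _ => T p) (fun _ _ => Finset.mem_univ _) ?_ ?_
    · intro p hp q hq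
      simp only [Finset.mem_filter, Finset.mem_univ, true_and] at hp hq
      exact hTinj p q hp hq
    · intro c _
      obtain ⟨p, hp, hc⟩ := hTsurj c
      exact ⟨p, by simpa using hp, hc⟩
  · refine Finset.sum_bij (fun p _ => T p) (fun _ _ => Finset.mem_univ _) ?_ ?_ ?_
    · intro p hp q hq
      simp only [Finset.mem_filter, Finset.mem_univ, true_and] at hp hq
      exact hTinj p q hp hq
    · intro c _
      obtain ⟨p, hp, hc⟩ := hTsurj c
      exact ⟨p, by simpa using hp, hc⟩
    · intro p hp
      simp only [Finset.mem_filter, Finset.mem_univ, true_and] at hp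
      exact hval p hp

theorem cfGLHopf_comul_lof (n : ℕ) (φ : cfGL F n) :
    (cfGLHopf F).comul (DirectSum.lof ℂ ℕ (fun n => cfGL F n) n φ) =
      ∑ p ∈ Finset.HasAntidiagonal.antidiagonal n,
      TensorProduct.map (DirectSum.lof ℂ ℕ (fun n => cfGL F n) p.1)
        (DirectSum.lof ℂ ℕ (fun n => cfGL F n) p.2)
        ((extEquiv (IsConj.setoid (GL (Fin p.1) F)) (IsConj.setoid (GL (Fin p.2) F))).symm
          (cfGLDeflate F p.1 p.2 (lofFam φ (p.1 + p.2)))) := by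
  simp only [cfGLHopf]
  rw [DirectSum.toModule_lof, LinearMap.sum_apply]
  rfl

/-- Only the component of bidegree `(dim A, dim B)` is seen by the evaluation, and for it
`deflate_levi` applies after choosing bases. A singular `a` or `b` makes both sides zero. -/
theorem evL₂_comul_lof (n : ℕ) (φ : cfGL F n) (a : Module.End F A) (b : Module.End F B) :
    evL₂ a b ((cfGLHopf F).comul (DirectSum.lof ℂ ℕ (fun n => cfGL F n) n φ)) =
      avgEv (lofFam φ) a b := by
  rw [cfGLHopf_comul_lof, map_sum]
  simp only [evL₂, tmulFun_map]
  by_cases hab : ¬ IsUnit a ∨ ¬ IsUnit b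
  · rw [avgEv_of_not_isUnit _ _ _ hab]
    refine Finset.sum_eq_zero fun p _ => ?_
    rcases hab with h | h
    · rw [evL_of_not_isUnit h, LinearMap.zero_comp, tmulFun_zero_left]
    · rw [evL_of_not_isUnit h, LinearMap.zero_comp, tmulFun_zero_right]
  rw [not_or, not_not, not_not] at hab
  obtain ⟨g, e, he⟩ := exists_toLin'_of_isUnit hab.1
  obtain ⟨h, e', he'⟩ := exists_toLin'_of_isUnit hab.2
  by_cases hn : Module.finrank F A + Module.finrank F B = n
  · subst hn
    rw [Finset.sum_eq_single (Module.finrank F A, Module.finrank F B)]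
    · rw [avgEv_equiv _ e e' he he', evL_equiv e he, evL_equiv e' he', tmulFun_extEquiv,
        LinearEquiv.apply_symm_apply, ← deflate_levi]
      have : lofFam φ (Module.finrank F A + Module.finrank F B) = φ := DirectSum.lof_apply _ _ _
      rw [this]
    · rintro ⟨i, j⟩ _ hp
      by_cases h1 : Module.finrank F A = i
      · have h2 : Module.finrank F B ≠ j := fun h2 => hp (by rw [h1, h2])
        rw [evL_comp_lof_of_ne b h2, tmulFun_zero_right]
      · rw [evL_comp_lof_of_ne a h1, tmulFun_zero_left]
    · intro h
      rw [Finset.HasAntidiagonal.mem_antidiagonal] at h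
      exact absurd rfl h
  · rw [avgEv, Finset.sum_eq_zero, Finset.sum_eq_zero, mul_zero]
    · intro c _
      refine ev_lofFam_of_ne φ _ ?_
      rwa [Module.finrank_prod]
    · rintro ⟨i, j⟩ hp
      rw [Finset.HasAntidiagonal.mem_antidiagonal] at hp
      by_cases h1 : Module.finrank F A = i
      · have h2 : Module.finrank F B ≠ j := fun h2 => hn (by rw [h1, h2]; exact hp)
        rw [evL_comp_lof_of_ne b h2, tmulFun_zero_right]
      · rw [evL_comp_lof_of_ne a h1, tmulFun_zero_left]

/-- The coproduct of `⨁ n, cf(GL_n)` as an average. -/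
theorem evL₂_comul (a : Module.End F A) (b : Module.End F B) (x : ⨁ n, cfGL F n) :
    evL₂ a b ((cfGLHopf F).comul x) =
      (Fintype.card (B →ₗ[F] A) : ℂ)⁻¹ * ∑ c : B →ₗ[F] A, evL (blk a b c) x := by
  induction x using DirectSum.induction_on with
  | zero => simp
  | add x y hx hy => simp only [map_add, hx, hy, Finset.sum_add_distrib, mul_add]
  | of n φ =>
    refine (evL₂_comul_lof n φ a b).trans ?_
    simp only [avgEv, ← evL_apply]
    rfl

theorem evL₂_comul_eq_avgEv (a : Module.End F A) (b : Module.End F B) (x : ⨁ n, cfGL F n) :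
    evL₂ a b ((cfGLHopf F).comul x) = avgEv (fun n => x n) a b :=
  evL₂_comul a b x

end comul_cf

/-! ### Tensor identities from separating functionals. -/

section generic

variable {A B C : Type*} [AddCommGroup A] [Module ℂ A] [AddCommGroup B] [Module ℂ B]
  [AddCommGroup C] [Module ℂ C]

theorem Separating.eq_tmul {ι κ : Type*} {f : ι → A →ₗ[ℂ] ℂ} {g : κ → B →ₗ[ℂ] ℂ}
    (hf : Separating f) (hg : Separating g) {t t' : A ⊗[ℂ] B}
    (h : ∀ i j, tmulFun (f i) (g j) t = tmulFun (f i) (g j) t') : t = t' :=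
  (hf.tmul hg).eq fun p => h p.1 p.2

theorem Separating.eq_tmul_tmul {ι κ l : Type*} {f : ι → A →ₗ[ℂ] ℂ} {g : κ → B →ₗ[ℂ] ℂ}
    {k : l → C →ₗ[ℂ] ℂ} (hf : Separating f) (hg : Separating g) (hk : Separating k)
    {t t' : A ⊗[ℂ] (B ⊗[ℂ] C)}
    (h : ∀ i j m, tmulFun (f i) (tmulFun (g j) (k m)) t =
      tmulFun (f i) (tmulFun (g j) (k m)) t') : t = t' :=
  (hf.tmul (hg.tmul hk)).eq fun p => h p.1 p.2.1 p.2.2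

theorem tmulFun_assoc (f : A →ₗ[ℂ] ℂ) (g : B →ₗ[ℂ] ℂ) (h : C →ₗ[ℂ] ℂ) (t : (A ⊗[ℂ] B) ⊗[ℂ] C) :
    tmulFun f (tmulFun g h) (TensorProduct.assoc ℂ A B C t) = tmulFun (tmulFun f g) h t := by
  refine LinearMap.congr_fun
    (f := tmulFun f (tmulFun g h) ∘ₗ (TensorProduct.assoc ℂ A B C).toLinearMap)
    (TensorProduct.ext_threefold fun x y z => ?_) t
  simp [mul_assoc]

/-- Carries an averaging formula for one coproduct through an iterated coproduct. -/
theorem tmulFun_rTensor {ι : Type*} [Fintype ι] {Δ : A →ₗ[ℂ] A ⊗[ℂ] A} {T : A ⊗[ℂ] A →ₗ[ℂ] ℂ} {r : ℂ}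
    {φ : ι → A →ₗ[ℂ] ℂ} (h : ∀ x, T (Δ x) = r * ∑ c, φ c x) (g : B →ₗ[ℂ] ℂ) (t : A ⊗[ℂ] B) :
    tmulFun T g (Δ.rTensor B t) = r * ∑ c, tmulFun (φ c) g t := by
  induction t using TensorProduct.induction_on with
  | zero => simp
  | add s t hs ht => simp only [map_add, hs, ht, Finset.sum_add_distrib, mul_add]
  | tmul x y => simp only [LinearMap.rTensor_tmul, tmulFun_tmul, h, mul_assoc, Finset.sum_mul]

theorem tmulFun_lTensor {ι : Type*} [Fintype ι] {Δ : A →ₗ[ℂ] A ⊗[ℂ] A} {T : A ⊗[ℂ] A →ₗ[ℂ] ℂ} {r : ℂ}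
    {φ : ι → A →ₗ[ℂ] ℂ} (h : ∀ x, T (Δ x) = r * ∑ c, φ c x) (g : B →ₗ[ℂ] ℂ) (t : B ⊗[ℂ] A) :
    tmulFun g T (Δ.lTensor B t) = r * ∑ c, tmulFun g (φ c) t := by
  induction t using TensorProduct.induction_on with
  | zero => simp
  | add s t hs ht => simp only [map_add, hs, ht, Finset.sum_add_distrib, mul_add]
  | tmul x y =>
    simp only [LinearMap.lTensor_tmul, tmulFun_tmul, h, mul_left_comm, Finset.mul_sum]

theorem coassoc_of_separating {ι : Type*} {f : ι → A →ₗ[ℂ] ℂ} (hf : Separating f)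
    {Δ : A →ₗ[ℂ] A ⊗[ℂ] A} (h : ∀ i j k x, tmulFun (tmulFun (f i) (f j)) (f k) (Δ.rTensor A (Δ x)) =
      tmulFun (f i) (tmulFun (f j) (f k)) (Δ.lTensor A (Δ x))) :
    TensorProduct.assoc ℂ A A A ∘ₗ Δ.rTensor A ∘ₗ Δ = Δ.lTensor A ∘ₗ Δ :=
  LinearMap.ext fun x => hf.eq_tmul_tmul hf hf fun i j k =>
    (tmulFun_assoc _ _ _ _).trans (h i j k x)

end generic

section algebra_cf

variable {F : Type*} [Field F] [Fintype F]
  {V : Type*} [AddCommGroup V] [Module F V] [Finite V]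

/-! ### Associativity -/

theorem stable_quot {f : Module.End F V} {P Q : Submodule F V} (hP : P ≤ P.comap f)
    (hQ : Q ≤ Q.comap f) :
    P.comap Q.subtype ≤ (P.comap Q.subtype).comap (resEnd f Q hQ) := fun _ hv => hP hv

/-- The endomorphism induced on a subquotient. -/
def midEnd (f : Module.End F V) (P Q : Submodule F V) (hP : P ≤ P.comap f) (hQ : Q ≤ Q.comap f) :
    Module.End F (Q ⧸ P.comap Q.subtype) :=
  quoEnd (resEnd f Q hQ) (P.comap Q.subtype) (stable_quot hP hQ)

/-- A subspace `P` of a stable `Q` is stable under `f|Q` exactly when it is stable under `f`; the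
two factors live on `P` and on `Q/P`. -/
theorem prodTerm_resEnd (x y : ∀ n, cfGL F n) {f : Module.End F V} {P Q : Submodule F V}
    (h : P ≤ Q) (hQ : Q ≤ Q.comap f) : prodTerm x y (resEnd f Q hQ) (P.comap Q.subtype) =
      if hP : P ≤ P.comap f then ev x (resEnd f P hP) * ev y (midEnd f P Q hP hQ) else 0 := by
  rw [prodTerm]
  by_cases hP : P ≤ P.comap f
  · rw [dif_pos hP, dif_pos (stable_quot hP hQ), midEnd]
    rw [ev_resEnd x (stable_quot hP hQ) (Submodule.inclusion h) (Submodule.inclusion_injective h)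
      (Submodule.range_inclusion _ _ h) (resEnd f P hP)]
    exact fun v => rfl
  · rw [dif_neg hP, dif_neg]
    exact fun h' => hP fun v hv => @h' ⟨v, h hv⟩ hv

/-- The isomorphism theorems: the image of `Q` in `V/P` is a copy of `Q/P`, and its quotient is
`V/Q`. -/
theorem prodTerm_quoEnd (x y : ∀ n, cfGL F n) {f : Module.End F V} {P Q : Submodule F V}
    (h : P ≤ Q) (hP : P ≤ P.comap f) : prodTerm x y (quoEnd f P hP) (Q.map P.mkQ) =
      if hQ : Q ≤ Q.comap f then ev x (midEnd f P Q hP hQ) * ev y (quoEnd f Q hQ) else 0 := by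
  have hcm : (Q.map P.mkQ).comap P.mkQ = Q := by
    rw [Submodule.comap_map_mkQ, sup_eq_right.2 h]
  rw [prodTerm]
  by_cases hQ : Q ≤ Q.comap f
  · have h' : Q.map P.mkQ ≤ (Q.map P.mkQ).comap (quoEnd f P hP) := by
      rintro _ ⟨v, hv, rfl⟩
      exact ⟨f v, hQ hv, rfl⟩
    rw [dif_pos hQ, dif_pos h']
    rw [ev_resEnd x h' ((P.comap Q.subtype).mapQ P Q.subtype le_rfl) ?_ ?_ (midEnd f P Q hP hQ),
      ev_quoEnd y hQ ((Q.map P.mkQ).mkQ ∘ₗ P.mkQ) ((Submodule.mkQ_surjective _).comp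
        (Submodule.mkQ_surjective _)) _ (quoEnd (quoEnd f P hP) (Q.map P.mkQ) h')]
    · exact fun v => rfl
    · rw [LinearMap.ker_comp, Submodule.ker_mkQ, hcm]
    · intro v
      obtain ⟨v, rfl⟩ := Submodule.mkQ_surjective _ v
      rfl
    · rw [← LinearMap.ker_eq_bot, Submodule.ker_mapQ, Submodule.mkQ_map_self]
    · rw [Submodule.range_mapQ, Submodule.range_subtype]
  · rw [dif_neg hQ, dif_neg]
    intro h'
    refine hQ fun v hv => ?_
    have : P.mkQ (f v) ∈ Q.map P.mkQ := h' (Submodule.mem_map_of_mem hv)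
    rw [← Submodule.mem_comap, hcm] at this
    exact this

theorem evL_resEnd_mul (x y : ⨁ n, cfGL F n) {f : Module.End F V} {Q : Submodule F V}
    (hQ : Q ≤ Q.comap f) : evL (resEnd f Q hQ) ((cfGLHopf F).mul (x ⊗ₜ y)) =
      ∑ P, if h : P ≤ Q ∧ P ≤ P.comap f then
        evL (resEnd f P h.2) x * evL (midEnd f P Q h.2 hQ) y else 0 := by
  rw [evL_mul]
  have : ∀ P : Submodule F V, (if h : P ≤ Q ∧ P ≤ P.comap f then
      evL (resEnd f P h.2) x * evL (midEnd f P Q h.2 hQ) y else 0) = if P ≤ Q then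
        prodTerm (fun n => x n) (fun n => y n) (resEnd f Q hQ) (P.comap Q.subtype) else 0 := by
    intro P
    by_cases h : P ≤ Q
    · rw [if_pos h, prodTerm_resEnd _ _ h hQ]
      by_cases hP : P ≤ P.comap f
      · rw [dif_pos hP, dif_pos ⟨h, hP⟩]
        rfl
      · rw [dif_neg hP, dif_neg fun k => hP k.2]
    · rw [if_neg h, dif_neg fun k => h k.1]
  simp only [this]
  rw [← Finset.sum_filter]
  refine Finset.sum_bij' (fun U _ => U.map Q.subtype) (fun P _ => P.comap Q.subtype) ?_ ?_ ?_ ?_ ?_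
  · intro U _
    simpa using Submodule.map_subtype_le Q U
  · intro P _
    exact Finset.mem_univ _
  · intro U _
    exact Submodule.comap_map_eq_of_injective Q.injective_subtype U
  · intro P hP
    simp only [Finset.mem_filter, Finset.mem_univ, true_and] at hP
    rw [Submodule.map_comap_subtype, inf_eq_right.2 hP]
  · intro U _
    rw [Submodule.comap_map_eq_of_injective Q.injective_subtype U]

theorem evL_quoEnd_mul (x y : ⨁ n, cfGL F n) {f : Module.End F V} {P : Submodule F V}
    (hP : P ≤ P.comap f) : evL (quoEnd f P hP) ((cfGLHopf F).mul (x ⊗ₜ y)) =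
      ∑ Q, if h : P ≤ Q ∧ Q ≤ Q.comap f then
        evL (midEnd f P Q hP h.2) x * evL (quoEnd f Q h.2) y else 0 := by
  rw [evL_mul]
  have : ∀ Q : Submodule F V, (if h : P ≤ Q ∧ Q ≤ Q.comap f then
      evL (midEnd f P Q hP h.2) x * evL (quoEnd f Q h.2) y else 0) = if P ≤ Q then
        prodTerm (fun n => x n) (fun n => y n) (quoEnd f P hP) (Q.map P.mkQ) else 0 := by
    intro Q
    by_cases h : P ≤ Q
    · rw [if_pos h, prodTerm_quoEnd _ _ h hP]
      by_cases hQ : Q ≤ Q.comap f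
      · rw [dif_pos hQ, dif_pos ⟨h, hQ⟩]
        rfl
      · rw [dif_neg hQ, dif_neg fun k => hQ k.2]
    · rw [if_neg h, dif_neg fun k => h k.1]
  simp only [this]
  rw [← Finset.sum_filter]
  refine Finset.sum_bij' (fun U _ => U.comap P.mkQ) (fun Q _ => Q.map P.mkQ) ?_ ?_ ?_ ?_ ?_
  · intro U _
    simpa using Submodule.le_comap_mkQ P U
  · intro Q _
    exact Finset.mem_univ _
  · intro U _
    exact Submodule.map_comap_eq_of_surjective P.mkQ_surjective U
  · intro Q hQ
    simp only [Finset.mem_filter, Finset.mem_univ, true_and] at hQ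
    rw [Submodule.comap_map_mkQ, sup_eq_right.2 hQ]
  · intro U _
    rw [Submodule.map_comap_eq_of_surjective P.mkQ_surjective U]

-- Both sides are the sum over stable flags `P ≤ Q` of the values on `P`, `Q/P` and `V/Q`, with the
-- two summations interchanged.
variable (F) in
theorem cfGLHopf_mul_assoc (x y z) : (cfGLHopf F).mul ((cfGLHopf F).mul (x ⊗ₜ y) ⊗ₜ z) =
    (cfGLHopf F).mul (x ⊗ₜ (cfGLHopf F).mul (y ⊗ₜ z)) := by
  refine (separating_evL F).eq fun p => ?_
  set f := Matrix.toLin' p.2.1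
  rw [evL_mul, evL_mul]
  simp only [prodTerm_eq, evL_resEnd_mul, evL_quoEnd_mul]
  have h1 : ∀ Q : Submodule F (Fin p.1 → F), (if hQ : Q ≤ Q.comap f then
      (∑ P, if h : P ≤ Q ∧ P ≤ P.comap f then
        evL (resEnd f P h.2) x * evL (midEnd f P Q h.2 hQ) y else 0) * evL (quoEnd f Q hQ) z
      else 0) = ∑ P : Submodule F (Fin p.1 → F),
        if h : P ≤ Q ∧ P ≤ P.comap f ∧ Q ≤ Q.comap f then
        evL (resEnd f P h.2.1) x * evL (midEnd f P Q h.2.1 h.2.2) y * evL (quoEnd f Q h.2.2) z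
        else 0 := by
    intro Q
    by_cases hQ : Q ≤ Q.comap f
    · rw [dif_pos hQ, Finset.sum_mul]
      refine Finset.sum_congr rfl fun P _ => ?_
      by_cases h : P ≤ Q ∧ P ≤ P.comap f
      · rw [dif_pos h, dif_pos ⟨h.1, h.2, hQ⟩]
      · rw [dif_neg h, dif_neg fun k => h ⟨k.1, k.2.1⟩, zero_mul]
    · rw [dif_neg hQ]
      exact (Finset.sum_eq_zero fun P _ => dif_neg fun k => hQ k.2.2).symm
  have h2 : ∀ P : Submodule F (Fin p.1 → F), (if hP : P ≤ P.comap f then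
      evL (resEnd f P hP) x * (∑ Q, if h : P ≤ Q ∧ Q ≤ Q.comap f then
        evL (midEnd f P Q hP h.2) y * evL (quoEnd f Q h.2) z else 0)
      else 0) = ∑ Q : Submodule F (Fin p.1 → F),
        if h : P ≤ Q ∧ P ≤ P.comap f ∧ Q ≤ Q.comap f then
        evL (resEnd f P h.2.1) x * evL (midEnd f P Q h.2.1 h.2.2) y * evL (quoEnd f Q h.2.2) z
        else 0 := by
    intro P
    by_cases hP : P ≤ P.comap f
    · rw [dif_pos hP, Finset.mul_sum]
      refine Finset.sum_congr rfl fun Q _ => ?_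
      by_cases h : P ≤ Q ∧ Q ≤ Q.comap f
      · rw [dif_pos h, dif_pos ⟨h.1, hP, h.2⟩, mul_assoc]
      · rw [dif_neg h, dif_neg fun k => h ⟨k.1, k.2.2⟩, mul_zero]
    · rw [dif_neg hP]
      exact (Finset.sum_eq_zero fun P _ => dif_neg fun k => hP k.2.1).symm
  rw [Finset.sum_congr rfl fun Q _ => h1 Q, Finset.sum_congr rfl fun P _ => h2 P, Finset.sum_comm]

/-! ### Unit and counit -/

variable (F) in
theorem unit_cfGLHopf : (cfGLHopf F).unit 1 =
    DirectSum.lof ℂ ℕ (fun n => cfGL F n) 0 ⟨fun _ => 1, fun _ _ _ => rfl⟩ := by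
  simp [cfGLHopf]

theorem evL_unit [Subsingleton V] (f : Module.End F V) :
    evL f ((cfGLHopf F).unit 1) = 1 := by
  have h0 : Module.finrank F V = 0 := Module.finrank_zero_of_subsingleton
  obtain ⟨M, e, he⟩ := exists_toLin' f h0
  have hM : M = (1 : GL (Fin 0) F).1 := Subsingleton.elim _ _
  rw [evL_equiv e he, unit_cfGLHopf, hM, evL_lof_of_isUnit]

theorem evL_unit_of_nontrivial (hV : ¬ Subsingleton V) (f : Module.End F V) :
    evL f ((cfGLHopf F).unit 1) = 0 := by
  rw [unit_cfGLHopf]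
  refine evL_lof_of_ne _ f fun h => hV ?_
  exact Module.finrank_zero_iff.1 h

/-- Viewed as evaluation on a zero space, the counit is covered by the general formulas for products
and coproducts. -/
theorem counit_eq_evL [Subsingleton V] (f : Module.End F V) (x : ⨁ n, cfGL F n) :
    (cfGLHopf F).counit x = evL f x := by
  have h0 : Module.finrank F V = 0 := Module.finrank_zero_of_subsingleton
  obtain ⟨M, e, he⟩ := exists_toLin' f h0
  have hM : M = (1 : GL (Fin 0) F).1 := Subsingleton.elim _ _
  rw [evL_equiv e he, hM, evL_apply, ev_toLin', matFun_coe]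
  rfl

variable (F) in
theorem cfGLHopf_unit_mul (x) : (cfGLHopf F).mul ((cfGLHopf F).unit 1 ⊗ₜ x) = x := by
  refine (separating_evL F).eq fun p => ?_
  set f := Matrix.toLin' p.2.1
  rw [evL_mul, Finset.sum_eq_single ⊥]
  · rw [prodTerm_eq, dif_pos bot_le, evL_unit, one_mul, evL_apply, evL_apply]
    exact ev_quoEnd _ _ LinearMap.id Function.surjective_id (LinearMap.ker_id) _ fun v => rfl
  · intro W _ hW
    rw [prodTerm_eq]
    split_ifs with h
    · rw [evL_unit_of_nontrivial, zero_mul]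
      rwa [Submodule.subsingleton_iff_eq_bot]
    · rfl
  · simp

variable (F) in
theorem cfGLHopf_mul_unit (x) : (cfGLHopf F).mul (x ⊗ₜ (cfGLHopf F).unit 1) = x := by
  refine (separating_evL F).eq fun p => ?_
  set f := Matrix.toLin' p.2.1
  rw [evL_mul, Finset.sum_eq_single ⊤]
  · have : Subsingleton ((Fin p.1 → F) ⧸ (⊤ : Submodule F (Fin p.1 → F))) :=
      Submodule.Quotient.subsingleton_iff.2 rfl
    rw [prodTerm_eq, dif_pos (show (⊤ : Submodule F (Fin p.1 → F)) ≤ Submodule.comap f ⊤ from fun _ _ => trivial), evL_unit, mul_one, evL_apply, evL_apply]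
    exact ev_resEnd _ _ LinearMap.id Function.injective_id (LinearMap.range_id) _ fun v => rfl
  · intro W _ hW
    rw [prodTerm_eq]
    split_ifs with h
    · rw [evL_unit_of_nontrivial, mul_zero]
      rwa [Submodule.Quotient.subsingleton_iff]
    · rfl
  · simp

variable (F) in
theorem cfGLHopf_counit_unit : (cfGLHopf F).counit ((cfGLHopf F).unit 1) = 1 := by
  rw [counit_eq_evL (1 : Module.End F (Fin 0 → F)), evL_unit]

variable (F) in
theorem cfGLHopf_counit_mul (x y) : (cfGLHopf F).counit ((cfGLHopf F).mul (x ⊗ₜ y)) =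
    (cfGLHopf F).counit x * (cfGLHopf F).counit y := by
  rw [counit_eq_evL (1 : Module.End F (Fin 0 → F)), evL_mul, Finset.sum_eq_single ⊥]
  · rw [prodTerm_eq, dif_pos bot_le, ← counit_eq_evL, ← counit_eq_evL]
  · intro W _ hW
    exact absurd (Subsingleton.elim _ _) hW
  · exact fun h => absurd (Finset.mem_univ _) h

/-! ### Coassociativity -/

variable (F) in
theorem cfGLHopf_comul_unit : (cfGLHopf F).comul ((cfGLHopf F).unit 1) =
    (cfGLHopf F).unit 1 ⊗ₜ (cfGLHopf F).unit 1 := by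
  refine Separating.eq_tmul (A := ⨁ n, cfGL F n) (B := ⨁ n, cfGL F n) (separating_evL F)
    (separating_evL F) fun p q => ?_
  rw [evL₂_comul, tmulFun_tmul]
  by_cases h1 : Subsingleton (Fin p.1 → F)
  · by_cases h2 : Subsingleton (Fin q.1 → F)
    · have : Subsingleton ((Fin q.1 → F) →ₗ[F] (Fin p.1 → F)) :=
        ⟨fun f g => LinearMap.ext fun v => Subsingleton.elim _ _⟩
      simp [evL_unit]
    · rw [evL_unit_of_nontrivial h2, mul_zero, Finset.sum_eq_zero, mul_zero]
      intro c _
      refine evL_unit_of_nontrivial (fun h => h2 ?_) _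
      exact (Prod.snd_surjective (α := Fin p.1 → F)).subsingleton
  · rw [evL_unit_of_nontrivial h1, zero_mul, Finset.sum_eq_zero, mul_zero]
    intro c _
    refine evL_unit_of_nontrivial (fun h => h1 ?_) _
    exact (Prod.fst_surjective (β := Fin q.1 → F)).subsingleton

/-- With one diagonal block of size zero there is a single off-diagonal block, and the block
endomorphism is `f` itself. -/
theorem sum_evL_blk_left {U : Type*} [AddCommGroup U] [Module F U] [Finite U] [Subsingleton U]
    (u : Module.End F U) (f : Module.End F V) (x : ⨁ n, cfGL F n) :
    evL₂ u f ((cfGLHopf F).comul x) = evL f x := by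
  have : Subsingleton (V →ₗ[F] U) := ⟨fun f g => LinearMap.ext fun v => Subsingleton.elim _ _⟩
  rw [evL₂_comul, Fintype.card_eq_one_iff_nonempty_unique.2 ⟨⟨⟨0⟩, fun _ => Subsingleton.elim _ _⟩⟩,
    Fintype.sum_subsingleton _ 0, Nat.cast_one, inv_one, one_mul]
  refine LinearMap.congr_fun (evL_equiv (LinearEquiv.ofBijective (LinearMap.snd F U V)
    ⟨fun v w h => Prod.ext (Subsingleton.elim _ _) h, LinearMap.snd_surjective⟩) fun v => rfl) x

theorem sum_evL_blk_right {U : Type*} [AddCommGroup U] [Module F U] [Finite U] [Subsingleton U]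
    (u : Module.End F U) (f : Module.End F V) (x : ⨁ n, cfGL F n) :
    evL₂ f u ((cfGLHopf F).comul x) = evL f x := by
  have : Subsingleton (U →ₗ[F] V) := ⟨fun f g => LinearMap.ext fun v => by
    rw [Subsingleton.elim v 0, map_zero, map_zero]⟩
  rw [evL₂_comul, Fintype.card_eq_one_iff_nonempty_unique.2 ⟨⟨⟨0⟩, fun _ => Subsingleton.elim _ _⟩⟩,
    Fintype.sum_subsingleton _ 0, Nat.cast_one, inv_one, one_mul]
  refine LinearMap.congr_fun (evL_equiv (LinearEquiv.ofBijective (LinearMap.fst F V U)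
    ⟨fun v w h => Prod.ext h (Subsingleton.elim _ _), LinearMap.fst_surjective⟩) fun v => ?_) x
  change f v.1 + 0 = f v.1
  rw [add_zero]

variable (F) in
theorem cfGLHopf_counit_comul (x) :
    TensorProduct.lid ℂ _ ((cfGLHopf F).counit.rTensor _ ((cfGLHopf F).comul x)) = x := by
  refine (separating_evL F).eq fun p => ?_
  set f := Matrix.toLin' p.2.1
  have h : ∀ t : (⨁ n, cfGL F n) ⊗[ℂ] (⨁ n, cfGL F n),
      evL f (TensorProduct.lid ℂ _ ((cfGLHopf F).counit.rTensor _ t)) =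
        evL₂ (1 : Module.End F (Fin 0 → F)) f t := by
    intro t
    refine LinearMap.congr_fun (f := evL f ∘ₗ (TensorProduct.lid ℂ _).toLinearMap ∘ₗ
      (cfGLHopf F).counit.rTensor _) (TensorProduct.ext' fun x y => ?_) t
    simp [counit_eq_evL (1 : Module.End F (Fin 0 → F))]
  rw [h, sum_evL_blk_left]

variable (F) in
theorem cfGLHopf_comul_counit (x) :
    TensorProduct.rid ℂ _ ((cfGLHopf F).counit.lTensor _ ((cfGLHopf F).comul x)) = x := by
  refine (separating_evL F).eq fun p => ?_
  set f := Matrix.toLin' p.2.1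
  have h : ∀ t : (⨁ n, cfGL F n) ⊗[ℂ] (⨁ n, cfGL F n),
      evL f (TensorProduct.rid ℂ _ ((cfGLHopf F).counit.lTensor _ t)) =
        evL₂ f (1 : Module.End F (Fin 0 → F)) t := by
    intro t
    refine LinearMap.congr_fun (f := evL f ∘ₗ (TensorProduct.rid ℂ _).toLinearMap ∘ₗ
      (cfGLHopf F).counit.lTensor _) (TensorProduct.ext' fun x y => ?_) t
    simp [counit_eq_evL (1 : Module.End F (Fin 0 → F)), mul_comm]
  rw [h, sum_evL_blk_right]

section coassoc

variable {A B D : Type*} [AddCommGroup A] [Module F A] [Finite A]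
  [AddCommGroup B] [Module F B] [Finite B] [AddCommGroup D] [Module F D] [Finite D]

/-- The two ways of splitting a strictly upper triangular `3 × 3` block matrix. -/
def stageEquiv : ((B →ₗ[F] A) × (D →ₗ[F] A × B)) ≃ ((D →ₗ[F] B) × (B × D →ₗ[F] A)) where
  toFun c := (LinearMap.snd F A B ∘ₗ c.2, c.1.coprod (LinearMap.fst F A B ∘ₗ c.2))
  invFun c := (c.2 ∘ₗ LinearMap.inl F B D, (c.2 ∘ₗ LinearMap.inr F B D).prod c.1)
  left_inv c := by
    refine Prod.ext ?_ ?_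
    · ext; simp
    · ext; simp; simp
  right_inv c := by
    refine Prod.ext ?_ ?_
    · ext; simp
    · ext <;> simp

theorem evL_blk_blk (a : Module.End F A) (b : Module.End F B) (d : Module.End F D)
    (c : (B →ₗ[F] A) × (D →ₗ[F] A × B)) :
    evL (blk (blk a b c.1) d c.2) =
      evL (blk a (blk b d (stageEquiv c).1) (stageEquiv c).2) := by
  refine evL_equiv (LinearEquiv.prodAssoc F A B D) fun v => ?_
  refine Prod.ext ?_ (Prod.ext ?_ ?_)
  · exact add_assoc _ _ _
  · rfl
  · rfl

theorem evL₂_comul_eq (a : Module.End F A) (b : Module.End F B) (x : ⨁ n, cfGL F n) :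
    evL₂ a b ((cfGLHopf F).comul x) =
      (Fintype.card (B →ₗ[F] A) : ℂ)⁻¹ * ∑ c : B →ₗ[F] A, evL (blk a b c) x :=
  evL₂_comul a b x

/-- Both sides average over all block upper triangular endomorphisms with diagonal `a`, `b`, `d`;
only the order in which the three upper blocks are chosen differs. -/
theorem sum_evL_stage (a : Module.End F A) (b : Module.End F B) (d : Module.End F D)
    (x : ⨁ n, cfGL F n) :
    (Fintype.card (B →ₗ[F] A) : ℂ)⁻¹ *
      ∑ c : B →ₗ[F] A, evL₂ (blk a b c) d ((cfGLHopf F).comul x) =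
    (Fintype.card (D →ₗ[F] B) : ℂ)⁻¹ *
      ∑ c : D →ₗ[F] B, evL₂ a (blk b d c) ((cfGLHopf F).comul x) := by
  simp only [evL₂_comul, ← Finset.mul_sum, ← mul_assoc, ← mul_inv, ← Nat.cast_mul,
    ← Fintype.card_prod, Fintype.card_congr (stageEquiv (F := F) (A := A) (B := B) (D := D))]
  rw [← Fintype.sum_prod_type', ← Fintype.sum_prod_type']
  refine congrArg _ (Fintype.sum_equiv stageEquiv _ _ fun c => ?_)
  rw [evL_blk_blk]

end coassoc

variable (F) in
theorem cfGLHopf_coassoc :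
    TensorProduct.assoc ℂ (⨁ n, cfGL F n) (⨁ n, cfGL F n) (⨁ n, cfGL F n) ∘ₗ
    (cfGLHopf F).comul.rTensor _ ∘ₗ (cfGLHopf F).comul =
      (cfGLHopf F).comul.lTensor _ ∘ₗ (cfGLHopf F).comul := by
  refine coassoc_of_separating (A := ⨁ n, cfGL F n) (separating_evL F) fun i j k x => ?_
  refine (tmulFun_rTensor (A := ⨁ n, cfGL F n) (B := ⨁ n, cfGL F n)
    (evL₂_comul_eq _ _) _ _).trans ?_
  refine (sum_evL_stage _ _ _ x).trans ?_
  exact (tmulFun_lTensor (A := ⨁ n, cfGL F n) (B := ⨁ n, cfGL F n)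
    (evL₂_comul_eq _ _) _ _).symm

end algebra_cf

/-! ### The bialgebra axiom in terms of separating functionals. -/

section generic_bialgebra

variable {A : Type*} [AddCommGroup A] [Module ℂ A] {S : HopfMaps A}

theorem tmulFun_map_mul {ι κ : Type*} [Fintype ι] [Fintype κ] {f g : A →ₗ[ℂ] ℂ}
    {f₁ f₂ : ι → A →ₗ[ℂ] ℂ} {g₁ g₂ : κ → A →ₗ[ℂ] ℂ}
    (hf : ∀ x y, f (S.mul (x ⊗ₜ y)) = ∑ i, f₁ i x * f₂ i y)
    (hg : ∀ x y, g (S.mul (x ⊗ₜ y)) = ∑ j, g₁ j x * g₂ j y) (t u : A ⊗[ℂ] A) :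
    tmulFun f g (TensorProduct.map S.mul S.mul
      (TensorProduct.tensorTensorTensorComm ℂ A A A A (t ⊗ₜ u))) =
      ∑ i, ∑ j, tmulFun (f₁ i) (g₁ j) t * tmulFun (f₂ i) (g₂ j) u := by
  induction t using TensorProduct.induction_on with
  | zero => simp
  | add s t hs ht =>
    simp only [TensorProduct.add_tmul, map_add, hs, ht, add_mul, Finset.sum_add_distrib]
  | tmul x x' =>
    induction u using TensorProduct.induction_on with
    | zero => simp
    | add s t hs ht =>
      simp only [TensorProduct.tmul_add, map_add, hs, ht, mul_add, Finset.sum_add_distrib]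
    | tmul y y' =>
      rw [TensorProduct.tensorTensorTensorComm_tmul, TensorProduct.map_tmul, tmulFun_tmul, hf, hg,
        Finset.sum_mul_sum]
      simp only [tmulFun_tmul]
      exact Finset.sum_congr rfl fun i _ => Finset.sum_congr rfl fun j _ => by ring

theorem comul_mul_of_separating {ι : Type*} {f : ι → A →ₗ[ℂ] ℂ} (hf : Separating f)
    (h : ∀ i j x y, tmulFun (f i) (f j) (S.comul (S.mul (x ⊗ₜ y))) =
      tmulFun (f i) (f j) (TensorProduct.map S.mul S.mul
        (TensorProduct.tensorTensorTensorComm ℂ A A A A (S.comul x ⊗ₜ S.comul y)))) :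
    S.comul ∘ₗ S.mul = TensorProduct.map S.mul S.mul ∘ₗ
      (TensorProduct.tensorTensorTensorComm ℂ A A A A).toLinearMap ∘ₗ
        TensorProduct.map S.comul S.comul :=
  TensorProduct.ext' fun x y => hf.eq_tmul hf fun i j => h i j x y

end generic_bialgebra

/-! ### Averages along surjective homomorphisms. -/

section averages

/-- All fibres of a surjective homomorphism have the size of the kernel. -/
theorem sum_comp_surjective {K P : Type*} [AddGroup K] [AddGroup P] [Fintype K] [Fintype P]
    (ρ : K →+ P) (hρ : Function.Surjective ρ) (h : P → ℂ) :
    (Fintype.card K : ℂ)⁻¹ * ∑ k, h (ρ k) = (Fintype.card P : ℂ)⁻¹ * ∑ p, h p := by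
  have hc : ∀ p, Finset.card {k | ρ k = p} = Finset.card {k | ρ k = 0} := fun p =>
    AddMonoidHom.card_fiber_eq_of_mem_range ρ (hρ p) (hρ 0)
  have h1 : ∑ k, h (ρ k) = (Finset.card {k | ρ k = 0} : ℂ) * ∑ p, h p := by
    rw [← Finset.sum_fiberwise Finset.univ ρ, Finset.mul_sum]
    refine Finset.sum_congr rfl fun p _ => ?_
    rw [Finset.sum_congr rfl fun k hk => congrArg h (Finset.mem_filter.1 hk).2, Finset.sum_const,
      hc, nsmul_eq_mul]
  have h2 : Fintype.card K = Finset.card {k | ρ k = 0} * Fintype.card P := by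
    rw [← Finset.card_univ, Finset.card_eq_sum_card_fiberwise (f := ρ) (t := Finset.univ)
      (fun _ _ => Finset.mem_univ _), Finset.sum_congr rfl fun p _ => hc p, Finset.sum_const,
      smul_eq_mul, Finset.card_univ, mul_comm]
  have h3 : (Finset.card {k | ρ k = 0} : ℂ) ≠ 0 := by
    rw [Nat.cast_ne_zero, ← Nat.pos_iff_ne_zero, Finset.card_pos]
    exact ⟨0, by simp⟩
  have h4 : (Fintype.card P : ℂ) ≠ 0 := Nat.cast_ne_zero.2 Fintype.card_ne_zero
  rw [h1, h2, Nat.cast_mul]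
  field_simp

end averages

/-! ### Compatibility of parabolic restriction with parabolic induction. -/

section comul_mul_cf

variable {F : Type*} [Field F] [Fintype F]
  {A : Type*} [AddCommGroup A] [Module F A] [Finite A]
  {B : Type*} [AddCommGroup B] [Module F B] [Finite B]

/-- The shear `(v, w) ↦ (v + s w, w)`. -/
def shear (s : B →ₗ[F] A) : (A × B) ≃ₗ[F] A × B where
  toFun v := (v.1 + s v.2, v.2)
  map_add' v w := by
    refine Prod.ext ?_ rfl
    simp only [Prod.fst_add, Prod.snd_add, map_add]
    abel
  map_smul' c v := by
    refine Prod.ext ?_ rfl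
    simp only [Prod.smul_fst, Prod.smul_snd, map_smul, smul_add, RingHom.id_apply]
  invFun v := (v.1 - s v.2, v.2)
  left_inv v := by simp
  right_inv v := by simp

/-- The subspaces of `A × B` with intersection `A'` with `A` and image `B'` in `B`. -/
def shearSub (A' : Submodule F A) (B' : Submodule F B) (s : B →ₗ[F] A) : Submodule F (A × B) :=
  (A'.prod B').map (shear s).toLinearMap

theorem mem_shearSub {A' : Submodule F A} {B' : Submodule F B} {s : B →ₗ[F] A} {v : A × B} :
    v ∈ shearSub A' B' s ↔ v.1 - s v.2 ∈ A' ∧ v.2 ∈ B' := by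
  rw [shearSub, Submodule.mem_map_equiv]
  rfl

theorem comap_inl_shearSub (A' : Submodule F A) (B' : Submodule F B) (s : B →ₗ[F] A) :
    (shearSub A' B' s).comap (LinearMap.inl F A B) = A' := by
  ext v
  simp [mem_shearSub]

theorem map_snd_shearSub (A' : Submodule F A) (B' : Submodule F B) (s : B →ₗ[F] A) :
    (shearSub A' B' s).map (LinearMap.snd F A B) = B' := by
  ext w
  constructor
  · rintro ⟨v, hv, rfl⟩
    exact (mem_shearSub.1 hv).2
  · intro hw
    exact ⟨(s w, w), mem_shearSub.2 ⟨by simp, hw⟩, rfl⟩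

/-- Such a subspace is the graph of the map `B' → A/A'` induced by `s`, which depends on `s` only up
to maps taking `B'` into `A'`. -/
theorem shearSub_eq_iff {A' : Submodule F A} {B' : Submodule F B} {s t : B →ₗ[F] A} :
    shearSub A' B' s = shearSub A' B' t ↔ B' ≤ A'.comap (s - t) := by
  constructor
  · intro h w hw
    have : (s w, w) ∈ shearSub A' B' t := h ▸ mem_shearSub.2 ⟨by simp, hw⟩
    exact (mem_shearSub.1 this).1
  · intro h
    ext v
    rw [mem_shearSub, mem_shearSub]
    refine and_congr_left fun hv => ?_
    have h' : (s - t) v.2 ∈ A' := h hv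
    rw [← A'.add_mem_iff_left h', LinearMap.sub_apply]
    abel_nf

/-- Split the surjection from `W` onto its image in `B`, take the `A`-component of the splitting,
and extend it to all of `B`. -/
theorem exists_shearSub_eq (W : Submodule F (A × B)) :
    ∃ s, shearSub (W.comap (LinearMap.inl F A B)) (W.map (LinearMap.snd F A B)) s = W := by
  set B' := W.map (LinearMap.snd F A B)
  let p : W →ₗ[F] B' := (LinearMap.snd F A B).restrict fun v hv => Submodule.mem_map_of_mem hv
  have hp : LinearMap.range p = ⊤ := by
    refine LinearMap.range_eq_top.2 ?_
    rintro ⟨_, v, hv, rfl⟩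
    exact ⟨⟨v, hv⟩, rfl⟩
  obtain ⟨r, hr⟩ := p.exists_rightInverse_of_surjective hp
  obtain ⟨s, hs⟩ := LinearMap.exists_extend (LinearMap.fst F A B ∘ₗ W.subtype ∘ₗ r)
  have key : ∀ w ∈ B', (s w, w) ∈ W := by
    intro w hw
    have h1 : s w = (r ⟨w, hw⟩).1.1 := LinearMap.congr_fun hs ⟨w, hw⟩
    have h2 : (r ⟨w, hw⟩).1.2 = w := congrArg Subtype.val (LinearMap.congr_fun hr ⟨w, hw⟩)
    have h3 : (s w, w) = (r ⟨w, hw⟩).1 := Prod.ext h1 h2.symm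
    rw [h3]
    exact (r ⟨w, hw⟩).2
  refine ⟨s, ?_⟩
  ext v
  rw [mem_shearSub]
  have hv : v = (v.1 - s v.2, 0) + (s v.2, v.2) := by simp
  constructor
  · rintro ⟨h1, h2⟩
    rw [hv]
    exact W.add_mem h1 (key _ h2)
  · intro h
    have h2 : v.2 ∈ B' := Submodule.mem_map_of_mem (f := LinearMap.snd F A B) h
    refine ⟨?_, h2⟩
    have := W.sub_mem h (key _ h2)
    rw [Submodule.mem_comap]
    convert this using 1
    exact Prod.ext rfl (by simp)

/-- The maps sending `B'` into `A'`. -/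
abbrev compatHom (A' : Submodule F A) (B' : Submodule F B) : Submodule F (B →ₗ[F] A) :=
  Submodule.compatibleMaps B' A'

/-- Each subspace with invariants `A'`, `B'` comes from one coset of `compatHom A' B'`, so a sum
over subspaces can be traded for a sum over shears. -/
theorem sum_shearSub (A' : Submodule F A) (B' : Submodule F B) (g : Submodule F (A × B) → ℂ) :
    ∑ s, g (shearSub A' B' s) = (Nat.card (compatHom A' B') : ℂ) *
      ∑ W with W.comap (LinearMap.inl F A B) = A' ∧ W.map (LinearMap.snd F A B) = B', g W := by
  rw [← Finset.sum_fiberwise Finset.univ (shearSub A' B'), Finset.mul_sum, Finset.sum_filter]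
  refine Finset.sum_congr rfl fun W _ => ?_
  rw [Finset.sum_congr rfl fun s hs => congrArg g (Finset.mem_filter.1 hs).2, Finset.sum_const,
    nsmul_eq_mul]
  split_ifs with h
  · obtain ⟨s, hs⟩ := exists_shearSub_eq W
    rw [h.1, h.2] at hs
    rw [Nat.card_eq_fintype_card, ← Fintype.card_coe]
    refine congrArg (fun n : ℕ => (n : ℂ) * g W) (Fintype.card_congr ?_)
    refine ((Equiv.subRight s).subtypeEquiv fun t => ?_)
    rw [Finset.mem_filter, ← hs, shearSub_eq_iff]
    exact ⟨fun k => k.2, fun k => ⟨Finset.mem_univ _, k⟩⟩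
  · rw [Finset.filter_eq_empty_iff.2, Finset.card_empty, Nat.cast_zero, zero_mul]
    rintro s _ rfl
    exact h ⟨comap_inl_shearSub _ _ _, map_snd_shearSub _ _ _⟩

/-- Conjugation by the shear straightens the subspace into `A' × B'` and changes the off-diagonal
block by the commutator-like term `a s - s b`. -/
theorem prodTerm_shearSub (x y : ∀ n, cfGL F n) (a : Module.End F A) (b : Module.End F B)
    (c s : B →ₗ[F] A) (A' : Submodule F A) (B' : Submodule F B) :
    prodTerm x y (blk a b c) (shearSub A' B' s) =
      prodTerm x y (blk a b (c + (a ∘ₗ s - s ∘ₗ b))) (A'.prod B') := by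
  refine prodTerm_equiv x y (shear s) (fun v => ?_) (A'.prod B')
  refine Prod.ext ?_ rfl
  change a v.1 + (c v.2 + (a (s v.2) - s (b v.2))) + s (b v.2) = a (v.1 + s v.2) + c v.2
  rw [map_add]
  abel

theorem prod_stable_iff {a : Module.End F A} {b : Module.End F B} {c : B →ₗ[F] A}
    {A' : Submodule F A} {B' : Submodule F B} :
    A'.prod B' ≤ (A'.prod B').comap (blk a b c) ↔
      (A' ≤ A'.comap a ∧ B' ≤ B'.comap b) ∧ B' ≤ A'.comap c := by
  constructor
  · intro h
    have h1 : ∀ v ∈ A', ∀ w ∈ B', a v + c w ∈ A' ∧ b w ∈ B' := fun v hv w hw =>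
      @h (v, w) ⟨hv, hw⟩
    refine ⟨⟨fun v hv => ?_, fun w hw => (h1 0 A'.zero_mem w hw).2⟩, fun w hw => ?_⟩
    · simpa using (h1 v hv 0 B'.zero_mem).1
    · simpa using (h1 0 A'.zero_mem w hw).1
  · rintro ⟨⟨ha, hb⟩, hc⟩ v hv
    exact ⟨A'.add_mem (ha hv.1) (hc hv.2), hb hv.2⟩

/-- The map induced by `c` on the subspaces. -/
def compatRes (A' : Submodule F A) (B' : Submodule F B) :
    compatHom A' B' →ₗ[F] (B' →ₗ[F] A') where
  toFun c := c.1.restrict c.2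
  map_add' _ _ := rfl
  map_smul' _ _ := rfl

/-- The map induced by `c` on the quotients. -/
def compatQuo (A' : Submodule F A) (B' : Submodule F B) :
    compatHom A' B' →ₗ[F] (B ⧸ B' →ₗ[F] A ⧸ A') := Submodule.mapQLinear B' A'

/-- A prescribed pair is realized by extending `p` through a retraction onto `B'` and lifting `q`
through a section of `A → A/A'`; the two summands do not interfere. -/
theorem compatRes_prod_compatQuo_surjective (A' : Submodule F A) (B' : Submodule F B) :
    Function.Surjective ((compatRes A' B').prod (compatQuo A' B')) := by
  rintro ⟨p, q⟩
  obtain ⟨r, hr⟩ := B'.subtype.exists_leftInverse_of_injective B'.ker_subtype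
  obtain ⟨σ, hσ⟩ := A'.mkQ.exists_rightInverse_of_surjective A'.range_mkQ
  have hr' : ∀ w : B', r w.1 = w := fun w => LinearMap.congr_fun hr w
  have hσ' : ∀ v, A'.mkQ (σ v) = v := fun v => LinearMap.congr_fun hσ v
  have hB : ∀ w : B', B'.mkQ w.1 = 0 := fun w => (Submodule.Quotient.mk_eq_zero B').2 w.2
  have hc : ∀ w : B', (A'.subtype ∘ₗ p ∘ₗ r + σ ∘ₗ q ∘ₗ B'.mkQ) w.1 = (p w).1 := by
    intro w
    simp only [LinearMap.add_apply, LinearMap.comp_apply, hr', hB, map_zero, add_zero,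
      Submodule.subtype_apply]
  refine ⟨⟨A'.subtype ∘ₗ p ∘ₗ r + σ ∘ₗ q ∘ₗ B'.mkQ, fun w hw => ?_⟩, Prod.ext ?_ ?_⟩
  · rw [Submodule.mem_comap, hc ⟨w, hw⟩]
    exact (p ⟨w, hw⟩).2
  · ext w
    exact hc w
  · refine LinearMap.ext fun w => ?_
    obtain ⟨w, rfl⟩ := B'.mkQ_surjective w
    change A'.mkQ ((p (r w)).1 + σ (q (B'.mkQ w))) = _
    rw [map_add, hσ', show A'.mkQ (p (r w)).1 = 0 from
      (Submodule.Quotient.mk_eq_zero A').2 (p (r w)).2, zero_add]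

theorem prodTerm_prod (x y : ∀ n, cfGL F n) {a : Module.End F A} {b : Module.End F B}
    {A' : Submodule F A} {B' : Submodule F B} (ha : A' ≤ A'.comap a) (hb : B' ≤ B'.comap b)
    (c : compatHom A' B') : prodTerm x y (blk a b c.1) (A'.prod B') =
      ev x (blk (resEnd a A' ha) (resEnd b B' hb) (compatRes A' B' c)) *
        ev y (blk (quoEnd a A' ha) (quoEnd b B' hb) (compatQuo A' B' c)) := by
  have h := prod_stable_iff.2 ⟨⟨ha, hb⟩, c.2⟩
  rw [prodTerm, dif_pos h]
  refine congrArg₂ (· * ·) (ev_resEnd x h (A'.subtype.prodMap B'.subtype) ?_ ?_ _ ?_)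
    (ev_quoEnd y h (A'.mkQ.prodMap B'.mkQ) ?_ ?_ _ ?_)
  · exact Function.Injective.prodMap A'.injective_subtype B'.injective_subtype
  · rw [LinearMap.range_prodMap, Submodule.range_subtype, Submodule.range_subtype]
  · exact fun v => rfl
  · exact Function.Surjective.prodMap A'.mkQ_surjective B'.mkQ_surjective
  · rw [LinearMap.ker_prodMap, Submodule.ker_mkQ, Submodule.ker_mkQ]
  · exact fun v => rfl

/-- Only blocks `c` taking `B'` into `A'` keep `A' × B'` stable. For them the term depends on the
induced maps on subspaces and on quotients, which are jointly equidistributed, so the average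
factors. -/
theorem sum_prodTerm_prod (x y : ∀ n, cfGL F n) (a : Module.End F A) (b : Module.End F B)
    (A' : Submodule F A) (B' : Submodule F B) :
    (Nat.card (compatHom A' B') : ℂ)⁻¹ * ∑ c, prodTerm x y (blk a b c) (A'.prod B') =
      if h : A' ≤ A'.comap a ∧ B' ≤ B'.comap b then
        avgEv x (resEnd a A' h.1) (resEnd b B' h.2) * avgEv y (quoEnd a A' h.1) (quoEnd b B' h.2)
      else 0 := by
  by_cases h : A' ≤ A'.comap a ∧ B' ≤ B'.comap b
  · rw [dif_pos h]
    have h1 : ∑ c, prodTerm x y (blk a b c) (A'.prod B') =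
        ∑ c : compatHom A' B', prodTerm x y (blk a b c.1) (A'.prod B') := by
      rw [← Finset.sum_subset (Finset.subset_univ
        (Finset.univ.filter fun c => c ∈ compatHom A' B'))]
      · exact Finset.sum_subtype _ (by simp) _
      · intro c _ hc
        rw [prodTerm, dif_neg]
        intro k
        exact hc (Finset.mem_filter.2 ⟨Finset.mem_univ _, (prod_stable_iff.1 k).2⟩)
    simp only [h1, prodTerm_prod x y h.1 h.2]
    have := sum_comp_surjective ((compatRes A' B').prod (compatQuo A' B')).toAddMonoidHom
      (compatRes_prod_compatQuo_surjective A' B') fun p =>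
        ev x (blk (resEnd a A' h.1) (resEnd b B' h.2) p.1) *
        ev y (blk (quoEnd a A' h.1) (quoEnd b B' h.2) p.2)
    rw [Nat.card_eq_fintype_card]
    refine this.trans ?_
    rw [Fintype.card_prod, Nat.cast_mul, mul_inv, Fintype.sum_prod_type, avgEv, avgEv, mul_mul_mul_comm,
      Finset.sum_mul_sum]
  · rw [dif_neg h, Finset.sum_eq_zero, mul_zero]
    intro c _
    rw [prodTerm, dif_neg fun k => h (prod_stable_iff.1 k).1]

/-- The heart of the bialgebra axiom. Sort the subspaces by `(A', B')` and parametrize each class by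
shears; averaged over `c`, every shear gives the same contribution as `A' × B'`, and the numbers of
shears cancel. -/
theorem sum_sum_prodTerm (x y : ∀ n, cfGL F n) (a : Module.End F A) (b : Module.End F B) :
    (Fintype.card (B →ₗ[F] A) : ℂ)⁻¹ * ∑ c : B →ₗ[F] A, ∑ W, prodTerm x y (blk a b c) W =
      ∑ A', ∑ B', if h : A' ≤ A'.comap a ∧ B' ≤ B'.comap b then
        avgEv x (resEnd a A' h.1) (resEnd b B' h.2) * avgEv y (quoEnd a A' h.1) (quoEnd b B' h.2)
      else 0 := by
  have h1 : ∀ c : B →ₗ[F] A, ∑ W, prodTerm x y (blk a b c) W = ∑ A', ∑ B',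
      ∑ W with W.comap (LinearMap.inl F A B) = A' ∧ W.map (LinearMap.snd F A B) = B',
        prodTerm x y (blk a b c) W := by
    intro c
    rw [← Fintype.sum_prod_type', ← Finset.sum_fiberwise Finset.univ
      fun W : Submodule F (A × B) => (W.comap (LinearMap.inl F A B), W.map (LinearMap.snd F A B))]
    refine Finset.sum_congr rfl fun p _ => Finset.sum_congr ?_ fun _ _ => rfl
    ext W
    simp [Prod.ext_iff]
  simp only [h1]
  rw [Finset.sum_comm, Finset.mul_sum]
  refine Finset.sum_congr rfl fun A' _ => ?_
  rw [Finset.sum_comm, Finset.mul_sum]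
  refine Finset.sum_congr rfl fun B' _ => ?_
  rw [← sum_prodTerm_prod]
  have hN : (Nat.card (compatHom A' B') : ℂ) ≠ 0 := Nat.cast_ne_zero.2 Nat.card_pos.ne'
  have hH : (Fintype.card (B →ₗ[F] A) : ℂ) ≠ 0 := Nat.cast_ne_zero.2 Fintype.card_ne_zero
  rw [inv_mul_eq_iff_eq_mul₀ hH, ← mul_right_inj' hN, Finset.mul_sum,
    Finset.sum_congr rfl fun c _ => (sum_shearSub A' B' _).symm, Finset.sum_comm]
  have h2 : ∀ s : B →ₗ[F] A, ∑ c, prodTerm x y (blk a b c) (shearSub A' B' s) =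
      ∑ c, prodTerm x y (blk a b c) (A'.prod B') := by
    intro s
    simp only [prodTerm_shearSub]
    -- The correction does not involve `c`, so translating the summation variable absorbs it.
    exact Fintype.sum_equiv (Equiv.addRight (a ∘ₗ s - s ∘ₗ b)) _ _ fun c => rfl
  rw [Finset.sum_congr rfl fun s _ => h2 s, Finset.sum_const, nsmul_eq_mul, Finset.card_univ]
  field_simp

/-- The functional `x ↦ x(f|W)`, zero if `W` is not stable. -/
def resL (f : Module.End F A) (W : Submodule F A) : (⨁ n, cfGL F n) →ₗ[ℂ] ℂ :=
  if h : W ≤ W.comap f then evL (resEnd f W h) else 0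

/-- The functional `x ↦ x(f on A ⧸ W)`, zero if `W` is not stable. -/
def quoL (f : Module.End F A) (W : Submodule F A) : (⨁ n, cfGL F n) →ₗ[ℂ] ℂ :=
  if h : W ≤ W.comap f then evL (quoEnd f W h) else 0

theorem evL_mul_eq (f : Module.End F A) (x y : ⨁ n, cfGL F n) :
    evL f ((cfGLHopf F).mul (x ⊗ₜ y)) = ∑ W, resL f W x * quoL f W y := by
  rw [evL_mul]
  refine Finset.sum_congr rfl fun W _ => ?_
  rw [prodTerm_eq, resL, quoL]
  split_ifs
  · rfl
  · exact (mul_zero _).symm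

variable (F) in
theorem cfGLHopf_comul_mul : (cfGLHopf F).comul ∘ₗ (cfGLHopf F).mul =
    TensorProduct.map (cfGLHopf F).mul (cfGLHopf F).mul ∘ₗ
      (TensorProduct.tensorTensorTensorComm ℂ (⨁ n, cfGL F n) (⨁ n, cfGL F n) (⨁ n, cfGL F n)
        (⨁ n, cfGL F n)).toLinearMap ∘ₗ
        TensorProduct.map (cfGLHopf F).comul (cfGLHopf F).comul := by
  refine comul_mul_of_separating (A := ⨁ n, cfGL F n) (separating_evL F) fun i j x y => ?_
  refine Eq.trans ?_ (tmulFun_map_mul (A := ⨁ n, cfGL F n) (evL_mul_eq _) (evL_mul_eq _)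
    _ _).symm
  refine (evL₂_comul_eq _ _ _).trans ?_
  simp only [evL_mul]
  refine (sum_sum_prodTerm _ _ _ _).trans ?_
  refine Finset.sum_congr rfl fun A' _ => Finset.sum_congr rfl fun B' _ => ?_
  by_cases hA : A' ≤ A'.comap (Matrix.toLin' i.2.1)
  · by_cases hB : B' ≤ B'.comap (Matrix.toLin' j.2.1)
    · rw [dif_pos ⟨hA, hB⟩, resL, resL, quoL, quoL, dif_pos hA, dif_pos hB, dif_pos hA, dif_pos hB]
      exact congrArg₂ (· * ·) (evL₂_comul_eq_avgEv _ _ _).symm (evL₂_comul_eq_avgEv _ _ _).symm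
    · rw [dif_neg fun h => hB h.2, resL, resL, dif_neg hB]
      exact ((congrArg (· * _) (tmulFun_zero_right _ _)).trans (zero_mul _)).symm
  · rw [dif_neg fun h => hA h.1, resL, dif_neg hA]
    exact ((congrArg (· * _) (tmulFun_zero_left _ _)).trans (zero_mul _)).symm

end comul_mul_cf

/-! ### The Hopf algebra of class functions, assembled. -/

section hopf_cf

variable (F : Type*) [Field F] [Fintype F]

theorem cfGLHopf_comul_mem (n : ℕ) (φ : cfGL F n) :
    (cfGLHopf F).comul (DirectSum.lof ℂ ℕ (fun n => cfGL F n) n φ) ∈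
      ⨆ p ∈ Finset.HasAntidiagonal.antidiagonal n,
        LinearMap.range (TensorProduct.map (DirectSum.lof ℂ ℕ (fun n => cfGL F n) p.1)
          (DirectSum.lof ℂ ℕ (fun n => cfGL F n) p.2)) := by
  rw [cfGLHopf_comul_lof]
  refine Submodule.sum_mem _ fun p hp => ?_
  exact Submodule.mem_iSup_of_mem p (Submodule.mem_iSup_of_mem hp ⟨_, rfl⟩)

theorem counit_cfGLHopf_lof (n : ℕ) (hn : n ≠ 0) (φ : cfGL F n) :
    (cfGLHopf F).counit (DirectSum.lof ℂ ℕ (fun n => cfGL F n) n φ) = 0 := by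
  rw [counit_eq_evL (1 : Module.End F (Fin 0 → F))]
  exact evL_lof_of_ne _ _ (by rw [Module.finrank_fin_fun]; exact hn.symm)

theorem counit_cfGLHopf_lof_zero (φ : cfGL F 0) :
    (cfGLHopf F).counit (DirectSum.lof ℂ ℕ (fun n => cfGL F n) 0 φ) = φ.1 1 := by
  simp only [cfGLHopf, LinearMap.comp_apply]
  rw [DirectSum.component.lof_self]
  rfl

theorem unit_counit_cfGLHopf_lof (φ : cfGL F 0) : (cfGLHopf F).unit
    ((cfGLHopf F).counit (DirectSum.lof ℂ ℕ (fun n => cfGL F n) 0 φ)) =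
      DirectSum.lof ℂ ℕ (fun n => cfGL F n) 0 φ := by
  rw [counit_cfGLHopf_lof_zero, HopfMaps.unit_apply, unit_cfGLHopf, ← map_smul]
  refine congrArg _ (Subtype.ext (funext fun g => ?_))
  rw [Subsingleton.elim g 1]
  exact mul_one _

theorem isGradedConnectedHopf_cfGLHopf : IsGradedConnectedHopf (cfGLHopf F) where
  mul_assoc := cfGLHopf_mul_assoc F
  unit_mul := cfGLHopf_unit_mul F
  mul_unit := cfGLHopf_mul_unit F
  coassoc := cfGLHopf_coassoc F
  counit_comul := cfGLHopf_counit_comul F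
  comul_counit := cfGLHopf_comul_counit F
  comul_mul := cfGLHopf_comul_mul F
  comul_unit := cfGLHopf_comul_unit F
  counit_mul := cfGLHopf_counit_mul F
  counit_unit := cfGLHopf_counit_unit F
  exists_antipode := exists_antipode_of_connected (cfGLHopf_mul_assoc F) (cfGLHopf_unit_mul F)
    (cfGLHopf_mul_unit F) (cfGLHopf_coassoc F) (cfGLHopf_counit_comul F)
    (cfGLHopf_comul_counit F) (cfGLHopf_comul_mem F) (unit_counit_cfGLHopf_lof F)
  mul_mem m n x y := ⟨_, (cfGLHopf_mul_lof m n x y).symm⟩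
  unit_mem := ⟨_, (unit_cfGLHopf F).symm⟩
  comul_mem := cfGLHopf_comul_mem F
  counit_eq_zero := counit_cfGLHopf_lof F
  connected := finrank_classSpace_of_subsingleton _

end hopf_cf

/-! ### Induced functions: stages, products and reciprocity. -/

section induction

variable {G : Type*} [Group G] [Fintype G]

/-- Extension of a function on a subgroup by zero. -/
def extendZero (H : Subgroup G) (θ : H → ℂ) (g : G) : ℂ := if h : g ∈ H then θ ⟨g, h⟩ else 0

theorem extendZero_coe (H : Subgroup G) (θ : H → ℂ) (g : H) : extendZero H θ g = θ g := by
  rw [extendZero, dif_pos g.2]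

theorem sum_extendZero_mul (H : Subgroup G) (θ : H → ℂ) (f : G → ℂ) :
    ∑ g, extendZero H θ g * f g = ∑ h : H, θ h * f h := by
  rw [← Finset.sum_subset (Finset.subset_univ (Finset.univ.filter fun g => g ∈ H))]
  · rw [Finset.sum_subtype (p := fun g => g ∈ H) _ (by simp)]
    exact Finset.sum_congr rfl fun h _ => by rw [extendZero_coe]
  · intro g _ hg
    rw [extendZero, dif_neg (by simpa using hg), zero_mul]

theorem induce_apply (H : Subgroup G) (θ : H → ℂ) (g : G) :
    (induce H θ).1 g = (Fintype.card H : ℂ)⁻¹ * ∑ x, extendZero H θ (x⁻¹ * g * x) := rfl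

theorem card_comap_mul {H K : Type*} [Group H] [Group K] [Fintype H] [Fintype K] (π : H →* K)
    (hπ : Function.Surjective π) (Q : Subgroup K) :
    Fintype.card (Q.comap π) * Fintype.card K = Fintype.card H * Fintype.card Q := by
  have h1 := (Q.comap π).card_mul_index
  have h2 := Q.card_mul_index
  rw [Subgroup.index_comap_of_surjective Q hπ] at h1
  rw [← Nat.card_eq_fintype_card, ← Nat.card_eq_fintype_card, ← Nat.card_eq_fintype_card,
    ← Nat.card_eq_fintype_card, ← h1, ← h2]
  ring

/-- Induction in stages, along a surjection from the intermediate subgroup. -/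
theorem induce_induce {K : Type*} [Group K] [Fintype K] (H : Subgroup G) (π : H →* K)
    (hπ : Function.Surjective π) (Q : Subgroup K) (Q' : Subgroup G)
    (hQ : ∀ g, g ∈ Q' ↔ ∃ h : g ∈ H, π ⟨g, h⟩ ∈ Q) (θ : Q → ℂ) (θ' : Q' → ℂ)
    (hθ : ∀ g : H, ∀ (h : π g ∈ Q) (h' : g.1 ∈ Q'), θ' ⟨g, h'⟩ = θ ⟨π g, h⟩) :
    induce H (fun h => (induce Q θ).1 (π h)) = induce Q' θ' := by
  refine Subtype.ext (funext fun g => ?_)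
  have hc : (Fintype.card Q' : ℂ) * Fintype.card K = Fintype.card H * Fintype.card Q := by
    rw [← Nat.cast_mul, ← Nat.cast_mul, ← card_comap_mul π hπ Q]
    refine congrArg (fun n : ℕ => ((n * Fintype.card K : ℕ) : ℂ)) (Fintype.card_congr ?_)
    exact
      { toFun := fun q => ⟨⟨q.1, ((hQ q.1).1 q.2).1⟩, ((hQ q.1).1 q.2).2⟩
        invFun := fun q => ⟨q.1.1, (hQ _).2 ⟨q.1.2, q.2⟩⟩
        left_inv := fun q => rfl
        right_inv := fun q => rfl }
  have hext : ∀ y : H, extendZero Q' θ' y.1 = extendZero Q θ (π y) := by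
    intro y
    by_cases h : π y ∈ Q
    · have h' : y.1 ∈ Q' := (hQ _).2 ⟨y.2, h⟩
      rw [extendZero, extendZero, dif_pos h, dif_pos h', hθ y h h']
    · rw [extendZero, extendZero, dif_neg h, dif_neg]
      rintro h'
      exact h ((hQ _).1 h').2
  have hext0 : ∀ y, y ∉ H → extendZero Q' θ' y = 0 := by
    intro y hy
    rw [extendZero, dif_neg fun h => hy ((hQ _).1 h).1]
  -- Write `k = π t`; the substitution of `x t` for `x` shows that the inner sum does not depend on
  -- `k`.
  have key : ∀ k : K, ∑ x : G, (if h : x⁻¹ * g * x ∈ H then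
      extendZero Q θ (k⁻¹ * π ⟨x⁻¹ * g * x, h⟩ * k) else 0) =
      ∑ x : G, extendZero Q' θ' (x⁻¹ * g * x) := by
    intro k
    obtain ⟨t, rfl⟩ := hπ k
    refine Fintype.sum_equiv (Equiv.mulRight t.1) _ _ fun x => ?_
    have e : (x * t.1)⁻¹ * g * (x * t.1) = t.1⁻¹ * (x⁻¹ * g * x) * t.1 := by group
    rw [Equiv.coe_mulRight, e]
    split_ifs with h
    · rw [← map_inv, ← map_mul, ← map_mul]
      exact (hext (t⁻¹ * ⟨x⁻¹ * g * x, h⟩ * t)).symm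
    · refine (hext0 _ fun h' => h ?_).symm
      have := H.mul_mem (H.mul_mem t.2 h') (H.inv_mem t.2)
      convert this using 1
      group
  have h1 : (induce H (fun h => (induce Q θ).1 (π h))).1 g =
      (Fintype.card H : ℂ)⁻¹ * ((Fintype.card Q : ℂ)⁻¹ * ∑ k : K,
        ∑ x : G, (if h : x⁻¹ * g * x ∈ H then
          extendZero Q θ (k⁻¹ * π ⟨x⁻¹ * g * x, h⟩ * k) else 0)) := by
    rw [induce_apply]
    refine congrArg _ ?_
    rw [Finset.sum_comm, Finset.mul_sum]
    refine Finset.sum_congr rfl fun x _ => ?_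
    rw [extendZero]
    split_ifs
    · exact induce_apply _ _ _
    · simp
  rw [h1, Finset.sum_congr rfl fun k _ => key k, Finset.sum_const, nsmul_eq_mul, Finset.card_univ,
    induce_apply]
  have hQ0 : (Fintype.card Q : ℂ) ≠ 0 := Nat.cast_ne_zero.2 Fintype.card_ne_zero
  have hQ1 : (Fintype.card Q' : ℂ) ≠ 0 := Nat.cast_ne_zero.2 Fintype.card_ne_zero
  have hH0 : (Fintype.card H : ℂ) ≠ 0 := Nat.cast_ne_zero.2 Fintype.card_ne_zero
  field_simp
  rw [← hc]
  ring

theorem induce_prod {G' : Type*} [Group G'] [Fintype G'] (H : Subgroup G) (H' : Subgroup G')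
    (θ : H → ℂ) (θ' : H' → ℂ) (g : G) (g' : G') :
    (induce (H.prod H') fun p => θ ⟨p.1.1, p.2.1⟩ * θ' ⟨p.1.2, p.2.2⟩).1 (g, g') =
      (induce H θ).1 g * (induce H' θ').1 g' := by
  rw [induce_apply, induce_apply, induce_apply, mul_mul_mul_comm, Finset.sum_mul_sum,
    Fintype.sum_prod_type, Fintype.card_congr (Subgroup.prodEquiv H H').toEquiv, Fintype.card_prod,
    Nat.cast_mul, mul_inv]
  refine congrArg _ (Finset.sum_congr rfl fun x _ => Finset.sum_congr rfl fun y _ => ?_)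
  simp only [extendZero, Prod.mk_mul_mk, Prod.inv_mk, Subgroup.mem_prod]
  by_cases h : x⁻¹ * g * x ∈ H
  · by_cases h' : y⁻¹ * g' * y ∈ H'
    · rw [dif_pos ⟨h, h'⟩, dif_pos h, dif_pos h']
    · rw [dif_neg fun k => h' k.2, dif_neg h', mul_zero]
  · rw [dif_neg fun k => h k.1, dif_neg h, zero_mul]

theorem ket_apply (χ ψ : G → ℂ) :
    ket χ ψ = (Fintype.card G : ℂ)⁻¹ * ∑ g, ψ g * (starRingEnd ℂ) (χ g) := rfl

/-- Frobenius reciprocity. -/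
theorem ket_induce (H : Subgroup G) (θ : H → ℂ) (χ : classFun G) :
    ket χ.1 (induce H θ).1 = ket (fun h : H => χ.1 h) θ := by
  have key : ∀ x : G, ∑ g, extendZero H θ (x⁻¹ * g * x) * (starRingEnd ℂ) (χ.1 g) =
      ∑ h : H, θ h * (starRingEnd ℂ) (χ.1 h) := by
    intro x
    rw [← sum_extendZero_mul H θ fun g => (starRingEnd ℂ) (χ.1 g)]
    refine Fintype.sum_equiv (MulAut.conj x⁻¹).toEquiv _ _ fun g => ?_
    have e : (MulAut.conj x⁻¹).toEquiv g = x⁻¹ * g * x := by simp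
    rw [e, χ.2 g (x⁻¹ * g * x) (isConj_iff.2 ⟨x⁻¹, by simp⟩)]
  have h : ∑ g, (induce H θ).1 g * (starRingEnd ℂ) (χ.1 g) = (Fintype.card H : ℂ)⁻¹ *
      ∑ x : G, ∑ g, extendZero H θ (x⁻¹ * g * x) * (starRingEnd ℂ) (χ.1 g) := by
    simp only [induce_apply, mul_assoc, Finset.sum_mul]
    rw [← Finset.mul_sum, Finset.sum_comm]
  rw [ket_apply, ket_apply, h, Finset.sum_congr rfl fun x _ => key x, Finset.sum_const,
    nsmul_eq_mul, Finset.card_univ]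
  have hG : (Fintype.card G : ℂ) ≠ 0 := Nat.cast_ne_zero.2 Fintype.card_ne_zero
  field_simp

/-- Adjunction between inflation and deflation; the normalizations match because all fibres have the
same size `N`. -/
theorem sum_mul_deflate {L : Type*} [Fintype L] {X : Type*} [Fintype X] (π : X → L)
    (θ : L → ℂ) (χ : X → ℂ) (N : ℕ) (hN : ∀ l, Finset.card {x | π x = l} = N) :
    (Fintype.card X : ℂ)⁻¹ * ∑ x, θ (π x) * χ x =
      (Fintype.card L : ℂ)⁻¹ * ∑ l, θ l * deflate π χ l := by
  have h1 : ∑ x, θ (π x) * χ x = ∑ l, θ l * ∑ x with π x = l, χ x := by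
    rw [← Finset.sum_fiberwise Finset.univ π]
    refine Finset.sum_congr rfl fun l _ => ?_
    rw [Finset.mul_sum]
    exact Finset.sum_congr rfl fun x hx => by rw [(Finset.mem_filter.1 hx).2]
  have h2 : Fintype.card X = Fintype.card L * N := by
    rw [← Finset.card_univ, Finset.card_eq_sum_card_fiberwise (f := π) (t := Finset.univ)
      (fun _ _ => Finset.mem_univ _), Finset.sum_congr rfl fun p _ => hN p, Finset.sum_const,
      smul_eq_mul, Finset.card_univ]
  have h3 : ∀ l, deflate π χ l = (∑ x with π x = l, χ x) / N := fun l => by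
    rw [← hN l]
    rfl
  simp only [h1, h2, h3, mul_div_assoc', ← Finset.sum_div, Nat.cast_mul]
  ring

end induction

/-! ### Compositions and sets of boundaries -/

section compositions

/-- The boundaries of a composition other than the two extremal ones. -/
def innerBoundaries {n : ℕ} (α : Composition n) : Finset ℕ :=
  ((α.boundaries.map Fin.valEmbedding).erase 0).erase n

theorem mem_boundaries_iff {n : ℕ} (α : Composition n) (s : Fin (n + 1)) :
    s ∈ α.boundaries ↔ ∃ k ≤ α.length, α.sizeUpTo k = s := by
  simp only [Composition.boundaries, Finset.mem_map, Finset.mem_univ, true_and]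
  constructor
  · rintro ⟨k, rfl⟩
    exact ⟨k, Nat.lt_succ_iff.1 k.2, rfl⟩
  · rintro ⟨k, hk, h⟩
    exact ⟨⟨k, Nat.lt_succ_of_le hk⟩, Fin.ext h⟩

theorem mem_innerBoundaries_iff {n : ℕ} (α : Composition n) (s : ℕ) :
    s ∈ innerBoundaries α ↔ s ≠ 0 ∧ s ≠ n ∧ ∃ k, α.sizeUpTo k = s := by
  simp only [innerBoundaries, Finset.mem_erase, Finset.mem_map, Fin.valEmbedding_apply]
  constructor
  · rintro ⟨h1, h2, t, ht, rfl⟩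
    obtain ⟨k, _, hk⟩ := (mem_boundaries_iff α t).1 ht
    exact ⟨h2, h1, k, hk⟩
  · rintro ⟨h1, h2, k, rfl⟩
    refine ⟨h2, h1, ⟨α.sizeUpTo k, Nat.lt_succ_of_le (α.sizeUpTo_le k)⟩,
      (mem_boundaries_iff α _).2 ⟨k, ?_, rfl⟩, rfl⟩
    by_contra h
    exact h2 (α.sizeUpTo_ofLength_le k (not_le.1 h).le)

theorem innerBoundaries_subset {n : ℕ} (α : Composition n) :
    innerBoundaries α ⊆ Finset.Ico 1 n := by
  intro s hs
  obtain ⟨h1, h2, k, rfl⟩ := (mem_innerBoundaries_iff α s).1 hs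
  exact Finset.mem_Ico.2 ⟨Nat.one_le_iff_ne_zero.2 h1, lt_of_le_of_ne (α.sizeUpTo_le k) h2⟩

/-- A composition has one more boundary than parts, and for `n ≠ 0` the two extremal ones are
distinct. -/
theorem card_innerBoundaries {n : ℕ} (hn : n ≠ 0) (α : Composition n) :
    (innerBoundaries α).card + 1 = α.length := by
  have h0 : 0 ∈ α.boundaries.map Fin.valEmbedding :=
    Finset.mem_map.2 ⟨0, α.toCompositionAsSet.zero_mem, rfl⟩
  have h1 : n ∈ (α.boundaries.map Fin.valEmbedding).erase 0 :=
    Finset.mem_erase.2 ⟨hn, Finset.mem_map.2 ⟨Fin.last n, α.toCompositionAsSet.getLast_mem, rfl⟩⟩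
  rw [innerBoundaries, Finset.card_erase_add_one h1, Finset.card_erase_of_mem h0, Finset.card_map,
    α.card_boundaries_eq_succ_length, Nat.add_sub_cancel]

theorem insert_innerBoundaries {n : ℕ} (α : Composition n) :
    insert 0 (insert n (innerBoundaries α)) = α.boundaries.map Fin.valEmbedding := by
  have h0 : 0 ∈ α.boundaries.map Fin.valEmbedding :=
    Finset.mem_map.2 ⟨0, α.toCompositionAsSet.zero_mem, rfl⟩
  have h1 : n ∈ α.boundaries.map Fin.valEmbedding :=
    Finset.mem_map.2 ⟨Fin.last n, α.toCompositionAsSet.getLast_mem, rfl⟩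
  ext s
  simp only [innerBoundaries, Finset.mem_insert, Finset.mem_erase]
  constructor
  · rintro (rfl | rfl | h)
    · exact h0
    · exact h1
    · exact h.2.2
  · intro h
    by_cases hs : s = 0
    · exact Or.inl hs
    · by_cases hs' : s = n
      · exact Or.inr (Or.inl hs')
      · exact Or.inr (Or.inr ⟨hs', hs, h⟩)

theorem innerBoundaries_injective (n : ℕ) :
    Function.Injective (innerBoundaries : Composition n → Finset ℕ) := by
  intro α β h
  have h1 : α.boundaries = β.boundaries := by
    apply Finset.map_injective Fin.valEmbedding
    rw [← insert_innerBoundaries, ← insert_innerBoundaries, h]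
  exact (compositionEquiv n).injective (CompositionAsSet.ext h1)

theorem exists_innerBoundaries_eq {n : ℕ} {S : Finset ℕ} (hS : S ⊆ Finset.Ico 1 n) :
    ∃ α : Composition n, innerBoundaries α = S := by
  let c : CompositionAsSet n :=
    { boundaries := {s | s = 0 ∨ s = Fin.last n ∨ s.1 ∈ S}
      zero_mem := by simp
      getLast_mem := by simp }
  refine ⟨c.toComposition, ?_⟩
  ext s
  rw [innerBoundaries, c.toComposition_boundaries]
  simp only [Finset.mem_erase, Finset.mem_map, Fin.valEmbedding_apply]
  constructor
  · rintro ⟨h1, h2, t, ht, rfl⟩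
    rcases (Finset.mem_filter.1 ht).2 with rfl | rfl | h
    · exact absurd rfl h2
    · exact absurd rfl h1
    · exact h
  · intro hs
    have := Finset.mem_Ico.1 (hS hs)
    exact ⟨by omega, by omega, ⟨s, by omega⟩,
      Finset.mem_filter.2 ⟨Finset.mem_univ _, Or.inr (Or.inr hs)⟩, rfl⟩

/-- The number of elements of `S` that are at most `i`. -/
def countLE (S : Finset ℕ) (i : ℕ) : ℕ := Finset.card {s ∈ S | s ≤ i}

theorem countLE_lt_iff (S : Finset ℕ) (i j : ℕ) :
    countLE S j < countLE S i ↔ ∃ s ∈ S, j < s ∧ s ≤ i := by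
  constructor
  · intro h
    by_contra! hc
    refine h.not_ge (Finset.card_le_card fun s hs => ?_)
    have hs := Finset.mem_filter.1 hs
    refine Finset.mem_filter.2 ⟨hs.1, not_lt.1 fun k => ?_⟩
    exact (hc s hs.1 k).not_ge hs.2
  · rintro ⟨s, hs, h1, h2⟩
    refine Finset.card_lt_card ⟨fun t ht => ?_, fun h => ?_⟩
    · have ht := Finset.mem_filter.1 ht
      exact Finset.mem_filter.2 ⟨ht.1, ht.2.trans (h1.le.trans h2)⟩
    · exact h1.not_ge (Finset.mem_filter.1 (h (Finset.mem_filter.2 ⟨hs, h2⟩))).2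

/-- Two positions are in different blocks exactly when a boundary `s` satisfies `j < s ≤ i`, as a
boundary is the first position of a block when counting from zero. Hence the parabolic of `α`
depends only on its inner boundaries. -/
theorem index_lt_index_iff {n : ℕ} (α : Composition n) (i j : Fin n) :
    α.index j < α.index i ↔ countLE (innerBoundaries α) j < countLE (innerBoundaries α) i := by
  rw [countLE_lt_iff]
  constructor
  · intro h
    have h1 := α.lt_sizeUpTo_index_succ j
    have h2 := α.sizeUpTo_index_le i
    have h3 : α.sizeUpTo (α.index j).succ ≤ α.sizeUpTo (α.index i) := α.monotone_sizeUpTo h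
    -- The separating boundary is the start of the block of `i`.
    refine ⟨α.sizeUpTo (α.index i), (mem_innerBoundaries_iff α _).2 ⟨by omega, ?_, _, rfl⟩,
      h1.trans_le h3, h2⟩
    have := i.2
    omega
  · rintro ⟨s, hs, h1, h2⟩
    obtain ⟨-, -, k, rfl⟩ := (mem_innerBoundaries_iff α s).1 hs
    have h3 : (α.index j : ℕ) < k := by
      by_contra h
      have := α.monotone_sizeUpTo (not_lt.1 h)
      have := α.sizeUpTo_index_le j
      omega
    have h4 : k ≤ α.index i := by
      by_contra h
      have h5 : α.sizeUpTo (α.index i).succ ≤ α.sizeUpTo k := α.monotone_sizeUpTo (not_le.1 h)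
      have := α.lt_sizeUpTo_index_succ i
      omega
    exact h3.trans_le h4

theorem sum_composition {M : Type*} [AddCommMonoid M] (n : ℕ) (f : Finset ℕ → M) :
    ∑ α : Composition n, f (innerBoundaries α) = ∑ S ∈ (Finset.Ico 1 n).powerset, f S := by
  refine Finset.sum_nbij innerBoundaries ?_ ?_ ?_ ?_
  · exact fun α _ => Finset.mem_powerset.2 (innerBoundaries_subset α)
  · exact (innerBoundaries_injective n).injOn
  · intro S hS
    obtain ⟨α, rfl⟩ := exists_innerBoundaries_eq (Finset.mem_powerset.1 hS)
    exact ⟨α, by simp, rfl⟩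
  · exact fun _ _ => rfl

end compositions

/-! ### The Steinberg character as an alternating sum of flag characters. -/

section steinberg

variable {F : Type*} [Field F] [Fintype F]
  {V : Type*} [AddCommGroup V] [Module F V] [Finite V]

theorem parabolic_congr {n : ℕ} {α β : Type*} [LinearOrder α] [LinearOrder β] {b : Fin n → α}
    {b' : Fin n → β} (h : ∀ i j, b j < b i ↔ b' j < b' i) : parabolic F b = parabolic F b' := by
  ext g
  exact ⟨fun hg i j hij => hg ((h i j).2 hij), fun hg i j hij => hg ((h i j).1 hij)⟩

variable (F) in
/-- The permutation character of `GL_n` on the partial flags with dimensions in `S`. -/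
def flagChar (n : ℕ) (S : Finset ℕ) : cfGL F n :=
  induce (parabolic F fun i : Fin n => countLE S i) fun _ => 1

variable (F) in
/-- The trivial characters. -/
def oneFam (n : ℕ) : cfGL F n := ⟨fun _ => 1, fun _ _ _ => rfl⟩

/-- Prescribing a subspace of dimension `0`, `n` or more has no effect on the block conditions,
since no two positions are separated there. -/
theorem flagChar_congr {n : ℕ} {S T : Finset ℕ}
    (h : ∀ s, 1 ≤ s → s < n → (s ∈ S ↔ s ∈ T)) : flagChar F n S = flagChar F n T := by
  have : parabolic F (fun i : Fin n => countLE S i) = parabolic F fun i : Fin n => countLE T i := by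
    refine parabolic_congr fun i j => ?_
    rw [countLE_lt_iff, countLE_lt_iff]
    have hi := i.2
    constructor
    · rintro ⟨s, hs, h1, h2⟩
      exact ⟨s, (h s (by omega) (by omega)).1 hs, h1, h2⟩
    · rintro ⟨s, hs, h1, h2⟩
      exact ⟨s, (h s (by omega) (by omega)).2 hs, h1, h2⟩
  rw [flagChar, flagChar, this]

theorem steinberg_eq {n : ℕ} (hn : n ≠ 0) : (-1 : ℂ) ^ n • steinberg F n =
    ∑ S ∈ (Finset.Ico 1 n).powerset, (-1 : ℂ) ^ (S.card + 1) • flagChar F n S := by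
  rw [← sum_composition n fun S => (-1 : ℂ) ^ (S.card + 1) • flagChar F n S, steinberg,
    Finset.smul_sum]
  refine Finset.sum_congr rfl fun α _ => ?_
  have h1 : parabolic F α.index = parabolic F fun i : Fin n => countLE (innerBoundaries α) i :=
    parabolic_congr (index_lt_index_iff α)
  rw [card_innerBoundaries hn, smul_smul, ← pow_add, flagChar, h1]
  have h2 := α.length_le
  -- The sign `(-1)^n (-1)^(n - ℓ)` reduces to `(-1)^ℓ`, with `ℓ` one more than the number of inner
  -- boundaries.
  have h3 : n + (n - α.length) = 2 * (n - α.length) + α.length := by omega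
  rw [h3, pow_add, pow_mul, neg_one_sq, one_pow, one_mul]

theorem leviFst_surjective (k l : ℕ) : Function.Surjective (leviFst (F := F) k l) := fun g => by
  obtain ⟨p, hp⟩ := levi_surjective k l (g, 1)
  exact ⟨p, congrArg Prod.fst hp⟩

theorem cfGLMul_eq_induce {k l : ℕ} (φ : cfGL F k) (ψ : cfGL F l) : cfGLMul F k l φ ψ =
    induce (maxParabolic F k l) fun p => φ.1 (leviFst k l p) * ψ.1 (leviSnd k l p) := rfl

/-- A flag whose largest prescribed dimension is `s` is a subspace of dimension `s` with a flag
inside it: the parabolic is the preimage in `P_{s,j}` of the smaller one, and induction in stages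
applies. -/
theorem flagChar_insert {s j : ℕ} {S : Finset ℕ} (hS : ∀ x ∈ S, x < s) :
    flagChar F (s + j) (insert s S) = cfGLMul F s j (flagChar F s S) (oneFam F j) := by
  have h1 : ∀ i : Fin s, countLE (insert s S) (Fin.castAdd j i) = countLE S i := by
    intro i
    have := i.2
    rw [countLE, Finset.filter_insert, if_neg (by simp)]
    rfl
  have h2 : ∀ i : Fin j, countLE (insert s S) (Fin.natAdd s i) = S.card + 1 := by
    intro i
    rw [countLE, Finset.filter_true_of_mem, Finset.card_insert_of_notMem fun h => (hS s h).ne rfl]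
    intro x hx
    rcases Finset.mem_insert.1 hx with rfl | hx
    · simp
    · have := hS x hx
      simp only [Fin.val_natAdd]
      omega
  have h3 : ∀ i : Fin s, countLE S i < S.card + 1 := fun i =>
    Nat.lt_succ_of_le (Finset.card_filter_le _ _)
  have key : ∀ g, (g ∈ parabolic F fun i : Fin (s + j) => countLE (insert s S) i) ↔
      ∃ h : g ∈ maxParabolic F s j,
        leviFst s j ⟨g, h⟩ ∈ parabolic F fun i : Fin s => countLE S i := by
    intro g
    constructor
    · intro hg
      have hg' : g ∈ maxParabolic F s j := by
        intro a b hab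
        induction a using Fin.addCases with
        | left a => induction b using Fin.addCases <;> simp at hab
        | right a =>
          induction b using Fin.addCases with
          | left b => exact hg (by beta_reduce; rw [h1, h2]; exact h3 b)
          | right b => simp at hab
      exact ⟨hg', fun a b hab => hg (show countLE _ _ < countLE _ _ by rwa [h1, h1])⟩
    · rintro ⟨hg, hg'⟩ a b hab
      induction a using Fin.addCases with
      | left a =>
        induction b using Fin.addCases with
        | left b =>
          beta_reduce at hab
          rw [h1, h1] at hab
          exact hg' hab
        | right b =>
          beta_reduce at hab
          rw [h1, h2] at hab
          exact absurd hab (h3 a).not_gt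
      | right a =>
        induction b using Fin.addCases with
        | left b => exact maxParabolic_lower ⟨g, hg⟩ a b
        | right b =>
          beta_reduce at hab
          rw [h2, h2] at hab
          exact absurd hab (lt_irrefl _)
  have e : (fun p => (flagChar F s S).1 (leviFst s j p)) =
      fun p => (flagChar F s S).1 (leviFst s j p) * (oneFam F j).1 (leviSnd s j p) :=
    funext fun p => (mul_one _).symm
  rw [cfGLMul_eq_induce, ← e, flagChar, flagChar]
  exact (induce_induce (maxParabolic F s j) (leviFst s j) (leviFst_surjective s j)
    (parabolic F fun i : Fin s => countLE S i) _ key (fun _ => 1) (fun _ => 1)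
    fun _ _ _ => rfl).symm

theorem induce_one_eq_one {G : Type*} [Group G] [Fintype G] (H : Subgroup G) (h : H = ⊤) (g : G) :
    (induce H fun _ => 1).1 g = 1 := by
  subst h
  rw [induce_apply]
  simp [extendZero]

theorem flagChar_empty (n : ℕ) : flagChar F n ∅ = oneFam F n := by
  refine Subtype.ext (funext fun g => induce_one_eq_one _ ?_ g)
  rw [eq_top_iff]
  intro g _ i j hij
  exact absurd hij (by simp [countLE])

end steinberg

/-! ### The signed Steinberg characters as an inverse of the trivial characters. -/

section steinberg_recursion

variable {F : Type*} [Field F] [Fintype F]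
  {V : Type*} [AddCommGroup V] [Module F V] [Finite V]

theorem ev_lofFam_self (x : ∀ n, cfGL F n) (f : Module.End F V) {k : ℕ}
    (h : Module.finrank F V = k) : ev (lofFam (x k)) f = ev x f := by
  subst h
  have : lofFam (x (Module.finrank F V)) (Module.finrank F V) = x (Module.finrank F V) :=
    DirectSum.lof_apply (M := fun n => cfGL F n) ℂ (Module.finrank F V) (x (Module.finrank F V))
  rw [ev, ev, this]

/-- Sorting the subspaces by dimension expresses the sum through homogeneous products, one for each
`s`. -/
theorem sum_prodTerm_eq_sum_evL (x y : ∀ n, cfGL F n) (f : Module.End F V) {n : ℕ}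
    (h : Module.finrank F V = n) : ∑ W, prodTerm x y f W =
      ∑ s ∈ Finset.range (n + 1), evL f (DirectSum.lof ℂ ℕ (fun n => cfGL F n) (s + (n - s))
        (cfGLMul F s (n - s) (x s) (y (n - s)))) := by
  simp only [evL_cfGLMul]
  rw [Finset.sum_comm]
  refine Finset.sum_congr rfl fun W _ => ?_
  have hW := Submodule.finrank_quotient_add_finrank W
  rw [Finset.sum_eq_single (Module.finrank F W)]
  · rw [prodTerm, prodTerm]
    split_ifs
    · rw [ev_lofFam_self x _ rfl, ev_lofFam_self y _ (by omega)]
    · rfl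
  · exact fun s _ hs => prodTerm_lofFam_of_ne _ _ _ _ (Or.inl hs.symm)
  · intro hk
    rw [Finset.mem_range] at hk
    omega

variable (F) in
/-- The Steinberg characters with signs: the inverse of the sum of the trivial characters under
parabolic induction. -/
def stFam (n : ℕ) : cfGL F n := (-1 : ℂ) ^ n • steinberg F n

theorem stFam_zero : stFam F 0 = oneFam F 0 := by
  refine Subtype.ext (funext fun g => ?_)
  have : Fintype.card (Composition 0) = 1 := composition_card 0
  obtain ⟨_⟩ := Fintype.card_eq_one_iff_nonempty_unique.1 this
  rw [stFam, pow_zero, one_smul, steinberg, Fintype.sum_unique, Nat.zero_sub, pow_zero, one_smul]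
  refine induce_one_eq_one _ ?_ g
  exact eq_top_iff.2 fun g _ i => Fin.elim0 i

/-- The value at `f` of the permutation character on the partial flags with dimensions in `S`. -/
def flagVal (f : Module.End F V) (S : Finset ℕ) : ℂ :=
  evL f (DirectSum.lof ℂ ℕ (fun n => cfGL F n) (Module.finrank F V)
    (flagChar F (Module.finrank F V) S))

theorem evL_flagChar (f : Module.End F V) (S : Finset ℕ) {n : ℕ} (h : Module.finrank F V = n) :
    evL f (DirectSum.lof ℂ ℕ (fun n => cfGL F n) n (flagChar F n S)) = flagVal f S := by
  subst h
  rfl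

theorem flagVal_congr {f : Module.End F V} {S T : Finset ℕ}
    (h : ∀ s, 1 ≤ s → s < Module.finrank F V → (s ∈ S ↔ s ∈ T)) : flagVal f S = flagVal f T := by
  rw [flagVal, flagVal, flagChar_congr h]

/-- Multiplying by a trivial character adjoins `s` as the largest dimension of each flag. The case
`s = 0` is separate because the expansion of the Steinberg character assumes positive degree. -/
theorem evL_stFam_mul_one (f : Module.End F V) {n : ℕ} (h : Module.finrank F V = n) {s : ℕ}
    (hs : s ≤ n) : evL f (DirectSum.lof ℂ ℕ (fun n => cfGL F n) (s + (n - s))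
        (cfGLMul F s (n - s) (stFam F s) (oneFam F (n - s)))) = if s = 0 then flagVal f ∅ else
      ∑ S ∈ (Finset.Ico 1 s).powerset, (-1 : ℂ) ^ (S.card + 1) * flagVal f (insert s S) := by
  have hsn : Module.finrank F V = s + (n - s) := by omega
  split_ifs with h0
  · subst h0
    rw [stFam_zero, ← flagChar_empty, ← flagChar_insert (by simp), evL_flagChar f _ hsn]
    exact flagVal_congr fun t ht _ => by simp; omega
  · rw [stFam, steinberg_eq h0, map_sum, LinearMap.sum_apply, map_sum, map_sum]
    refine Finset.sum_congr rfl fun S hS => ?_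
    have hS' : ∀ x ∈ S, x < s := fun x hx =>
      (Finset.mem_Ico.1 (Finset.mem_powerset.1 hS hx)).2
    rw [map_smul, LinearMap.smul_apply, map_smul, map_smul, ← flagChar_insert hS',
      evL_flagChar f _ hsn, smul_eq_mul]

/-- The left side groups the subsets of `[1, k]` by their maximum, the empty set being the term `s =
0`. -/
theorem sum_range_flagVal (f : Module.End F V) (k : ℕ) :
    (∑ s ∈ Finset.range (k + 1), if s = 0 then flagVal f ∅ else
      ∑ S ∈ (Finset.Ico 1 s).powerset, (-1 : ℂ) ^ (S.card + 1) * flagVal f (insert s S)) =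
    ∑ S ∈ (Finset.Ico 1 (k + 1)).powerset, (-1 : ℂ) ^ S.card * flagVal f S := by
  induction k with
  | zero => simp
  | succ k ih =>
    have hk : k + 1 ∉ Finset.Ico 1 (k + 1) := by simp
    rw [Finset.sum_range_succ, ih, if_neg (Nat.succ_ne_zero k),
      ← Finset.insert_Ico_right_eq_Ico_add_one (show 1 ≤ k + 1 by omega),
      Finset.sum_powerset_insert hk]
    refine congrArg₂ (· + ·) rfl (Finset.sum_congr rfl fun S hS => ?_)
    rw [Finset.card_insert_of_notMem fun h => hk (Finset.mem_powerset.1 hS h)]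

/-- The product of the two families is an alternating sum over subsets of `[1, n]`. For `n > 0` it
cancels in pairs, as the dimension `n` of the whole space can be inserted or removed freely. -/
theorem sum_prodTerm_stFam (f : Module.End F V) :
    ∑ W, prodTerm (stFam F) (oneFam F) f W = if Module.finrank F V = 0 then flagVal f ∅ else 0 := by
  rw [sum_prodTerm_eq_sum_evL _ _ f rfl, Finset.sum_congr rfl fun s hs =>
    evL_stFam_mul_one f rfl (Nat.lt_succ_iff.1 (Finset.mem_range.1 hs)), sum_range_flagVal]
  split_ifs with h
  · rw [h]
    simp
  · obtain ⟨k, hk⟩ := Nat.exists_eq_succ_of_ne_zero h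
    have hk' : k + 1 ∉ Finset.Ico 1 (k + 1) := by simp
    rw [hk, Nat.succ_eq_add_one,
      ← Finset.insert_Ico_right_eq_Ico_add_one (show 1 ≤ k + 1 by omega),
      Finset.sum_powerset_insert hk', ← Finset.sum_add_distrib]
    refine Finset.sum_eq_zero fun S hS => ?_
    rw [Finset.card_insert_of_notMem fun h => hk' (Finset.mem_powerset.1 hS h),
      flagVal_congr (S := insert (k + 1) S) (T := S)]
    · ring
    · intro s _ hs
      rw [Finset.mem_insert, or_iff_right]
      omega

theorem ev_oneFam {f : Module.End F V} (hf : IsUnit f) : ev (oneFam F) f = 1 := by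
  obtain ⟨g, e, he⟩ := exists_toLin'_of_isUnit hf
  rw [ev_equiv _ e he, ev_toLin', matFun_coe]
  rfl

theorem flagVal_empty {f : Module.End F V} (hf : IsUnit f) : flagVal f ∅ = 1 := by
  obtain ⟨g, e, he⟩ := exists_toLin'_of_isUnit hf
  rw [flagVal, flagChar_empty, evL_equiv e he, evL_lof_of_isUnit]
  rfl

theorem isUnit_iff_injective {f : Module.End F V} : IsUnit f ↔ Function.Injective f :=
  (Module.End.isUnit_iff f).trans Finite.injective_iff_bijective.symm

theorem isUnit_resEnd {f : Module.End F V} (hf : IsUnit f) {W : Submodule F V}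
    (h : W ≤ W.comap f) : IsUnit (resEnd f W h) :=
  isUnit_iff_injective.2 fun _ _ e =>
    Subtype.ext (isUnit_iff_injective.1 hf (congrArg Subtype.val e))

theorem isUnit_quoEnd {f : Module.End F V} (hf : IsUnit f) {W : Submodule F V}
    (h : W ≤ W.comap f) : IsUnit (quoEnd f W h) := by
  rw [Module.End.isUnit_iff, ← Finite.surjective_iff_bijective]
  intro v
  obtain ⟨v, rfl⟩ := W.mkQ_surjective v
  obtain ⟨w, rfl⟩ := ((Module.End.isUnit_iff f).1 hf).2 v
  exact ⟨W.mkQ w, rfl⟩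

/-- The value of the signed Steinberg character on a stable subspace. -/
def stRes (f : Module.End F V) (W : Submodule F V) : ℂ :=
  if h : W ≤ W.comap f then ev (stFam F) (resEnd f W h) else 0

/-- For invertible `f` all trivial-character factors are one. This recursion over stable subspaces
is the only property of the Steinberg values used to prove multiplicativity and vanishing. -/
theorem sum_stRes {f : Module.End F V} (hf : IsUnit f) :
    ∑ W, stRes f W = if Module.finrank F V = 0 then 1 else 0 := by
  rw [← flagVal_empty hf, ← sum_prodTerm_stFam]
  refine Finset.sum_congr rfl fun W _ => ?_
  rw [stRes, prodTerm]
  split_ifs with h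
  · rw [ev_oneFam (isUnit_quoEnd hf h), mul_one]
  · rfl

theorem stRes_top (f : Module.End F V) : stRes f ⊤ = ev (stFam F) f := by
  have h : (⊤ : Submodule F V) ≤ Submodule.comap f ⊤ := fun _ _ => trivial
  rw [stRes, dif_pos h]
  exact ev_resEnd _ h LinearMap.id Function.injective_id LinearMap.range_id _ fun v => rfl

end steinberg_recursion

/-! ### Multiplicativity of the Steinberg functional. -/

section steinberg_multiplicative

theorem sum_mul_deflate_hom {X L : Type*} [Group X] [Fintype X] [Group L] [Fintype L] (π : X →* L)
    (hπ : Function.Surjective π) (θ : L → ℂ) (χ : X → ℂ) :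
    (Fintype.card X : ℂ)⁻¹ * ∑ x, θ (π x) * χ x =
      (Fintype.card L : ℂ)⁻¹ * ∑ l, θ l * deflate π χ l := by
  refine sum_mul_deflate π θ χ (Finset.card {x | π x = 1}) fun l => ?_
  convert MonoidHom.card_fiber_eq_of_mem_range π (hπ l) (hπ 1)

universe u v w

variable {F : Type w} [Field F] [Fintype F]

theorem isUnit_blk {A B : Type*} [AddCommGroup A] [Module F A] [Finite A] [AddCommGroup B]
    [Module F B] [Finite B] {a : Module.End F A} {b : Module.End F B} (ha : IsUnit a)
    (hb : IsUnit b) (c : B →ₗ[F] A) : IsUnit (blk a b c) := by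
  rw [isUnit_iff_injective] at ha hb ⊢
  intro v w h
  simp only [blk_apply, Prod.mk.injEq] at h
  have h2 := hb h.2
  rw [h2, add_left_inj] at h
  exact Prod.ext (ha h.1) h2

theorem avgEv_oneFam {A B : Type*} [AddCommGroup A] [Module F A] [Finite A] [AddCommGroup B]
    [Module F B] [Finite B] {a : Module.End F A} {b : Module.End F B} (ha : IsUnit a)
    (hb : IsUnit b) : avgEv (oneFam F) a b = 1 := by
  rw [avgEv, Finset.sum_congr rfl fun c _ => ev_oneFam (isUnit_blk ha hb c), Finset.sum_const,
    nsmul_eq_mul, mul_one, Finset.card_univ,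
    inv_mul_cancel₀ (Nat.cast_ne_zero.2 Fintype.card_ne_zero)]

/-- Induction on total dimension. Averaging the recursion for block endomorphisms gives the same
total over pairs `(A', B')` as multiplying the recursions for `a` and `b`; all pairs but `(⊤, ⊤)`
agree by induction, so that one does too. -/
theorem avgEv_stFam_of_isUnit (n : ℕ) : ∀ {A : Type u} {B : Type v} [AddCommGroup A] [Module F A]
    [Finite A] [AddCommGroup B] [Module F B] [Finite B] {a : Module.End F A} {b : Module.End F B},
    IsUnit a → IsUnit b → Module.finrank F A + Module.finrank F B = n →
    avgEv (stFam F) a b = ev (stFam F) a * ev (stFam F) b := by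
  induction n using Nat.strong_induction_on with
  | _ n ih =>
  intro A B _ _ _ _ _ _ a b ha hb hn
  let T : Submodule F A × Submodule F B → ℂ := fun p =>
    if h : p.1 ≤ p.1.comap a ∧ p.2 ≤ p.2.comap b then
      avgEv (stFam F) (resEnd a p.1 h.1) (resEnd b p.2 h.2) else 0
  have hsum : ∑ p, T p = ∑ p : Submodule F A × Submodule F B, stRes a p.1 * stRes b p.2 := by
    have h1 : ∑ p, T p = (Fintype.card (B →ₗ[F] A) : ℂ)⁻¹ *
        ∑ c : B →ₗ[F] A, ∑ W, prodTerm (stFam F) (oneFam F) (blk a b c) W := by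
      rw [sum_sum_prodTerm, Fintype.sum_prod_type]
      refine Finset.sum_congr rfl fun A' _ => Finset.sum_congr rfl fun B' _ => ?_
      simp only [T]
      split_ifs with h
      · rw [avgEv_oneFam (isUnit_quoEnd ha h.1) (isUnit_quoEnd hb h.2), mul_one]
      · rfl
    have h2 : ∀ c : B →ₗ[F] A, ∑ W, prodTerm (stFam F) (oneFam F) (blk a b c) W =
        if Module.finrank F (A × B) = 0 then 1 else 0 := fun c => by
      rw [sum_prodTerm_stFam, flagVal_empty (isUnit_blk ha hb c)]
    rw [h1, Finset.sum_congr rfl fun c _ => h2 c, Finset.sum_const, nsmul_eq_mul,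
      Finset.card_univ, inv_mul_cancel_left₀ (Nat.cast_ne_zero.2 Fintype.card_ne_zero),
      Fintype.sum_prod_type, ← Finset.sum_mul_sum, sum_stRes ha, sum_stRes hb,
      Module.finrank_prod]
    simp only [Nat.add_eq_zero_iff, ite_and, mul_ite, mul_one, mul_zero]
    split_ifs <;> rfl
  -- Any other pair has a proper member, hence smaller total dimension.
  have hne : ∀ p, p ≠ (⊤, ⊤) → T p = stRes a p.1 * stRes b p.2 := by
    rintro ⟨A', B'⟩ hp
    simp only [T, stRes]
    by_cases h1 : A' ≤ A'.comap a
    · by_cases h2 : B' ≤ B'.comap b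
      · rw [dif_pos ⟨h1, h2⟩, dif_pos h1, dif_pos h2]
        refine ih _ ?_ (isUnit_resEnd ha h1) (isUnit_resEnd hb h2) rfl
        have h3 := Submodule.finrank_le A'
        have h4 := Submodule.finrank_le B'
        have h5 : ¬ (Module.finrank F A' = Module.finrank F A ∧
            Module.finrank F B' = Module.finrank F B) := fun e =>
          hp (Prod.ext (Submodule.eq_top_of_finrank_eq e.1) (Submodule.eq_top_of_finrank_eq e.2))
        omega
      · rw [dif_neg fun k => h2 k.2, dif_neg h2, mul_zero]
    · rw [dif_neg fun k => h1 k.1, dif_neg h1, zero_mul]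
  rw [← Finset.add_sum_erase _ _ (Finset.mem_univ ((⊤, ⊤) : Submodule F A × Submodule F B)),
    ← Finset.add_sum_erase (Finset.univ : Finset (Submodule F A × Submodule F B)) _
      (Finset.mem_univ (⊤, ⊤)),
    Finset.sum_congr rfl fun p hp => hne p (Finset.ne_of_mem_erase hp), add_left_inj,
    stRes_top, stRes_top] at hsum
  rw [← hsum]
  have h1 : (⊤ : Submodule F A) ≤ Submodule.comap a ⊤ := fun _ _ => trivial
  have h2 : (⊤ : Submodule F B) ≤ Submodule.comap b ⊤ := fun _ _ => trivial
  simp only [T]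
  rw [dif_pos ⟨h1, h2⟩]
  exact (avgEv_equiv _ Submodule.topEquiv Submodule.topEquiv (fun _ => rfl) fun _ => rfl).symm

theorem avgEv_stFam {A : Type u} {B : Type v} [AddCommGroup A] [Module F A]
    [Finite A] [AddCommGroup B] [Module F B] [Finite B] (a : Module.End F A) (b : Module.End F B) :
    avgEv (stFam F) a b = ev (stFam F) a * ev (stFam F) b := by
  by_cases ha : IsUnit a
  · by_cases hb : IsUnit b
    · exact avgEv_stFam_of_isUnit _ ha hb rfl
    · rw [avgEv_of_not_isUnit _ _ _ (Or.inr hb), ev_of_not_isUnit _ hb, mul_zero]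
  · rw [avgEv_of_not_isUnit _ _ _ (Or.inl ha), ev_of_not_isUnit _ ha, zero_mul]

theorem conj_steinberg (n : ℕ) (g : GL (Fin n) F) :
    (starRingEnd ℂ) ((steinberg F n).1 g) = (steinberg F n).1 g := by
  simp only [steinberg, Submodule.coe_sum, Submodule.coe_smul, Finset.sum_apply, Pi.smul_apply,
    smul_eq_mul, map_sum, map_mul, map_pow, map_neg, map_one, induce_apply, map_inv₀, map_natCast,
    extendZero, apply_dite, map_zero]

theorem steinberg_apply (n : ℕ) (g : GL (Fin n) F) :
    (steinberg F n).1 g = (-1) ^ n * ev (stFam F) (Matrix.toLin' g.1) := by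
  rw [ev_toLin', matFun_coe, stFam, Submodule.coe_smul, Pi.smul_apply, smul_eq_mul, ← mul_assoc,
    ← mul_pow, neg_one_mul, neg_neg, one_pow, one_mul]

theorem deflate_steinberg (k l : ℕ) (g : GL (Fin k) F) (h : GL (Fin l) F) :
    (cfGLDeflate F k l (steinberg F (k + l))).1 (g, h) =
      (steinberg F k).1 g * (steinberg F l).1 h := by
  have h1 : avgEv (lofFam (stFam F (k + l))) (Matrix.toLin' g.1) (Matrix.toLin' h.1) =
      avgEv (stFam F) (Matrix.toLin' g.1) (Matrix.toLin' h.1) := by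
    rw [avgEv, avgEv]
    refine congrArg _ (Finset.sum_congr rfl fun c _ => ev_lofFam_self _ _ ?_)
    rw [Module.finrank_prod, Module.finrank_fin_fun, Module.finrank_fin_fun]
  have h2 : steinberg F (k + l) = (-1 : ℂ) ^ (k + l) • stFam F (k + l) := by
    rw [stFam, smul_smul, ← mul_pow, neg_one_mul, neg_neg, one_pow, one_smul]
  rw [h2, map_smul, Submodule.coe_smul, Pi.smul_apply, deflate_levi, h1, avgEv_stFam,
    steinberg_apply, steinberg_apply, pow_add, smul_eq_mul]
  ring

/-- Frobenius reciprocity moves the pairing to `P_{k,l}`, adjunction moves it to the Levi factor,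
and there the deflated Steinberg character is an external product. Its values are real, so
conjugation is harmless. -/
theorem ket_steinberg_cfGLMul {k l : ℕ} (φ : cfGL F k) (ψ : cfGL F l) :
    ket (steinberg F (k + l)).1 (cfGLMul F k l φ ψ).1 =
      ket (steinberg F k).1 φ.1 * ket (steinberg F l).1 ψ.1 := by
  rw [cfGLMul_eq_induce, ket_induce, ket_apply]
  simp only [conj_steinberg]
  have h := sum_mul_deflate_hom (levi (F := F) k l) (levi_surjective k l)
    (fun p => φ.1 p.1 * ψ.1 p.2) (fun p => (steinberg F (k + l)).1 p.1)
  refine h.trans ?_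
  have h2 : ∀ p, deflate (levi (F := F) k l) (fun p => (steinberg F (k + l)).1 p.1) p =
      (steinberg F k).1 p.1 * (steinberg F l).1 p.2 := fun p => deflate_steinberg k l p.1 p.2
  simp only [h2]
  rw [ket_apply, ket_apply, mul_mul_mul_comm, Finset.sum_mul_sum, Fintype.sum_prod_type,
    Fintype.card_prod, Nat.cast_mul, mul_inv]
  simp only [conj_steinberg]
  refine congrArg _ (Finset.sum_congr rfl fun g _ => Finset.sum_congr rfl fun h _ => ?_)
  ring

theorem stFunctional_lof (n : ℕ) (φ : cfGL F n) :
    stFunctional F (DirectSum.lof ℂ ℕ (fun n => cfGL F n) n φ) = ket (steinberg F n).1 φ.1 := by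
  rw [stFunctional, DirectSum.toModule_lof]
  rfl

theorem steinberg_zero : steinberg F 0 = oneFam F 0 := by
  rw [← stFam_zero, stFam, pow_zero, one_smul]

variable (F) in
theorem isLinearCharacter_stFunctional : IsLinearCharacter (cfGLHopf F) (stFunctional F) where
  map_mul x y := by
    induction x using DirectSum.induction_on with
    | zero => rw [TensorProduct.zero_tmul, map_zero, map_zero, zero_mul]
    | add x x' hx hx' => rw [TensorProduct.add_tmul, map_add, map_add, hx, hx', map_add, add_mul]
    | of k φ =>
      induction y using DirectSum.induction_on with
      | zero => rw [TensorProduct.tmul_zero, map_zero, map_zero, mul_zero]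
      | add y y' hy hy' => rw [TensorProduct.tmul_add, map_add, map_add, hy, hy', map_add, mul_add]
      | of l ψ =>
        refine (congrArg _ (cfGLHopf_mul_lof k l φ ψ)).trans ?_
        refine (stFunctional_lof _ _).trans ((ket_steinberg_cfGLMul φ ψ).trans ?_)
        exact congrArg₂ (· * ·) (stFunctional_lof _ _).symm (stFunctional_lof _ _).symm
  map_unit := by
    rw [unit_cfGLHopf, stFunctional_lof, steinberg_zero, ket_apply, Fintype.sum_subsingleton _ 1,
      Fintype.card_unique]
    simp [oneFam]

end steinberg_multiplicative

/-! ### Steinberg values at unipotent elements. -/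

section steinberg_unipotent

universe u w

variable {F : Type w} [Field F] [Fintype F]

/-- Every nonzero stable subspace contains a nonzero fixed vector. -/
def HasFixedVectors {V : Type*} [AddCommGroup V] [Module F V] (f : Module.End F V) : Prop :=
  ∀ W : Submodule F V, W ≤ W.comap f → W ≠ ⊥ → ∃ v ∈ W, v ≠ 0 ∧ f v = v

theorem HasFixedVectors.resEnd {V : Type*} [AddCommGroup V] [Module F V] [Finite V]
    {f : Module.End F V} (hf : HasFixedVectors f) {W : Submodule F V} (h : W ≤ W.comap f) :
    HasFixedVectors (resEnd f W h) := by
  intro U hU hU0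
  obtain ⟨v, hv, hv0, hfv⟩ := hf (U.map W.subtype) (by
    rintro _ ⟨v, hv, rfl⟩
    exact ⟨_, hU hv, rfl⟩) fun h =>
      hU0 (Submodule.map_injective_of_injective W.injective_subtype (h.trans (Submodule.map_bot _).symm))
  obtain ⟨v, hv, rfl⟩ := hv
  exact ⟨v, hv, fun h => hv0 (by rw [h]; rfl), Subtype.ext hfv⟩

/-- In the recursion for `f`, the subspaces of the fixed space `K` contribute the recursion for the
identity of `K`, which is zero as `K ≠ 0`. Stable proper subspaces not inside `K` contribute zero by
induction. Only `V` itself remains. -/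
theorem ev_stFam_eq_zero (n : ℕ) : ∀ {V : Type u} [AddCommGroup V] [Module F V] [Finite V]
    {f : Module.End F V}, IsUnit f → HasFixedVectors f → f ≠ 1 → Module.finrank F V = n →
    ev (stFam F) f = 0 := by
  induction n using Nat.strong_induction_on with
  | _ n ih =>
  intro V _ _ _ f hf hfix hne hn
  let K : Submodule F V := LinearMap.ker (f - 1)
  have hK : ∀ v, v ∈ K ↔ f v = v := fun v => by
    rw [LinearMap.mem_ker, LinearMap.sub_apply, sub_eq_zero]
    rfl
  have hV : Module.finrank F V ≠ 0 := by
    intro h0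
    have := Module.finrank_zero_iff.1 h0
    exact hne (LinearMap.ext fun v => Subsingleton.elim _ _)
  have hK0 : Module.finrank F K ≠ 0 := by
    intro h0
    have hsub := Module.finrank_zero_iff.1 h0
    have htop : (⊤ : Submodule F V) ≠ ⊥ := by
      intro h
      rw [← finrank_top F V, h, finrank_bot] at hV
      exact hV rfl
    obtain ⟨v, -, hv0, hv⟩ := hfix ⊤ (fun _ _ => trivial) htop
    exact hv0 (congrArg Subtype.val (Subsingleton.elim (⟨v, (hK v).2 hv⟩ : K) 0))
  have h1 : ∑ W, stRes f W = 0 := by rw [sum_stRes hf, if_neg hV]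
  -- Every subspace of `K` is stable, with `f` acting as the identity.
  have h2 : ∑ W with W ≤ K, stRes f W = ∑ U, stRes (1 : Module.End F K) U := by
    refine Finset.sum_bij' (fun W _ => W.comap K.subtype) (fun U _ => U.map K.subtype) ?_ ?_ ?_ ?_ ?_
    · exact fun _ _ => Finset.mem_univ _
    · intro U _
      simpa using Submodule.map_subtype_le K U
    · intro W hW
      simp only [Finset.mem_filter, Finset.mem_univ, true_and] at hW
      rw [Submodule.map_comap_subtype, inf_eq_right.2 hW]
    · intro U _
      exact Submodule.comap_map_eq_of_injective K.injective_subtype U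
    · intro W hW
      simp only [Finset.mem_filter, Finset.mem_univ, true_and] at hW
      have hs : W ≤ W.comap f := fun v hv => by
        rw [Submodule.mem_comap, (hK v).1 (hW hv)]
        exact hv
      have hs' : W.comap K.subtype ≤ (W.comap K.subtype).comap (1 : Module.End F K) := le_rfl
      rw [stRes, stRes, dif_pos hs, dif_pos hs']
      refine (ev_resEnd _ hs (K.subtype ∘ₗ (W.comap K.subtype).subtype) ?_ ?_ _ ?_)
      · exact K.injective_subtype.comp (Submodule.injective_subtype _)
      · rw [LinearMap.range_comp, Submodule.range_subtype, Submodule.map_comap_subtype,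
          inf_eq_right.2 hW]
      · exact fun v => ((hK _).1 v.1.2).symm
  have hzero : ∑ W with W ≤ K, stRes f W = 0 := by
    rw [h2, sum_stRes isUnit_one, if_neg hK0]
  have htopK : ¬ (⊤ : Submodule F V) ≤ K := fun h =>
    hne (LinearMap.ext fun v => (hK v).1 (h trivial))
  rw [← Finset.sum_filter_add_sum_filter_not Finset.univ (fun W => W ≤ K), hzero, zero_add,
    Finset.sum_eq_single ⊤, stRes_top] at h1
  · exact h1
  · intro W hW hW'
    simp only [Finset.mem_filter, Finset.mem_univ, true_and] at hW
    rw [stRes]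
    split_ifs with hs
    · refine ih (Module.finrank F W) ?_ (isUnit_resEnd hf hs) (hfix.resEnd hs) ?_ rfl
      · rw [← hn]
        exact Submodule.finrank_lt hW'
      · intro h
        exact hW fun v hv => (hK v).2 (congrArg Subtype.val (LinearMap.congr_fun h ⟨v, hv⟩))
    · rfl
  · intro h
    exact (h (by simpa using htopK)).elim

theorem hasFixedVectors_utMat {n : ℕ} (g : UT F n) : HasFixedVectors (Matrix.toLin' (utMat g)) := by
  intro W hW hW0
  by_contra! hc
  refine hW0 (W.eq_bot_iff.2 fun v hv => ?_)
  -- For `v` supported in the first `k + 1` coordinates, `g v - v` is supported in the first `k`,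
  -- hence zero by induction. Then `v` is fixed, and so `v = 0`.
  have key : ∀ k, ∀ v ∈ W, (∀ i : Fin n, k ≤ (i : ℕ) → v i = 0) → v = 0 := by
    intro k
    induction k with
    | zero => exact fun v _ h => funext fun i => h i (Nat.zero_le _)
    | succ k ih =>
      intro v hv h
      by_contra hv0
      refine hc v hv hv0 (sub_eq_zero.1 (ih _ (W.sub_mem (hW hv) hv) fun i hi => ?_))
      have e : (Matrix.toLin' (utMat g) v - v) i = ∑ j, (utMat g - 1) i j * v j := by
        simp only [Matrix.sub_apply, sub_mul, Finset.sum_sub_distrib]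
        rw [Pi.sub_apply, Matrix.toLin'_apply, Matrix.mulVec, dotProduct]
        congr 1
        simp [Matrix.one_apply]
      rw [e]
      refine Finset.sum_eq_zero fun j _ => ?_
      by_contra hj
      have h1 := g.2 i j (left_ne_zero_of_mul hj)
      refine right_ne_zero_of_mul hj (h j ?_)
      have h1' : (i : ℕ) < j := h1
      omega
  exact key n v hv fun i hi => absurd i.2 (not_lt.2 hi)

/-- The Steinberg character vanishes on nontrivial unipotent elements. -/
theorem steinberg_unipotent {n : ℕ} {g : UT F n} (hg : g ≠ 1) : (steinberg F n).1 g.1 = 0 := by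
  have h : ev (stFam F) (Matrix.toLin' (utMat g)) = 0 := by
    refine ev_stFam_eq_zero _ ?_ (hasFixedVectors_utMat g) ?_ rfl
    · have := g.1.isUnit.map (Matrix.toLinAlgEquiv' (R := F) (n := Fin n))
      exact this
    · intro h
      refine hg (ut_ext (Matrix.toLin'.injective (h.trans ?_)))
      exact (Matrix.toLin'_one).symm
  rw [steinberg_apply, h, mul_zero]

/-- By Frobenius reciprocity the pairing takes place on `UT_n`, where the Steinberg character is
supported at the identity. -/
theorem ket_steinberg_induce {n : ℕ} (φ : UT F n → ℂ) :
    ket (steinberg F n).1 (induce (UT F n) φ).1 =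
      (Fintype.card (UT F n) : ℂ)⁻¹ * (steinberg F n).1 1 * φ 1 := by
  rw [ket_induce, ket_apply, Finset.sum_eq_single 1]
  · rw [conj_steinberg]
    rw [show (((1 : UT F n) : GL (Fin n) F)) = 1 from rfl]
    ring
  · intro g _ hg
    rw [steinberg_unipotent hg, map_zero, mul_zero]
  · exact fun h => absurd (Finset.mem_univ _) h

end steinberg_unipotent

/-! ### Induction from `UT` respects products. -/

section ind_mul

variable {F : Type*} [Field F] [Fintype F]

theorem mem_UT_iff_levi {m n : ℕ} (g : GL (Fin (m + n)) F) : g ∈ UT F (m + n) ↔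
    ∃ h : g ∈ maxParabolic F m n, levi m n ⟨g, h⟩ ∈ (UT F m).prod (UT F n) := by
  have h1 : ∀ (h : g ∈ maxParabolic F m n) i j, ((leviFst m n ⟨g, h⟩).1 - 1) i j =
      (g.1 - 1) (Fin.castAdd n i) (Fin.castAdd n j) := fun h i j => by
    rw [Matrix.sub_apply, Matrix.sub_apply]
    refine congrArg₂ (· - ·) rfl ?_
    simp [Matrix.one_apply]
  have h2 : ∀ (h : g ∈ maxParabolic F m n) i j, ((leviSnd m n ⟨g, h⟩).1 - 1) i j =
      (g.1 - 1) (Fin.natAdd m i) (Fin.natAdd m j) := fun h i j => by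
    rw [Matrix.sub_apply, Matrix.sub_apply]
    refine congrArg₂ (· - ·) rfl ?_
    simp [Matrix.one_apply]
  have h3 : ∀ i j, (g.1 - 1) (Fin.natAdd m i) (Fin.castAdd n j) =
      g.1 (Fin.natAdd m i) (Fin.castAdd n j) := fun i j => by
    rw [Matrix.sub_apply, Matrix.one_apply_ne, sub_zero]
    intro h
    have := congrArg Fin.val h
    simp only [Fin.val_natAdd, Fin.val_castAdd] at this
    omega
  constructor
  · intro hg
    have hP : g ∈ maxParabolic F m n := by
      intro a b hab
      induction a using Fin.addCases with
      | left a => induction b using Fin.addCases <;> simp at hab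
      | right a =>
        induction b using Fin.addCases with
        | left b =>
          rw [← h3]
          by_contra h
          have := hg _ _ h
          simp only [Fin.lt_def, Fin.val_natAdd, Fin.val_castAdd] at this
          omega
        | right b => simp at hab
    refine ⟨hP, fun i j h => ?_, fun i j h => ?_⟩
    · exact (Fin.castAddOrderEmb n).lt_iff_lt.1 (hg _ _ (h1 hP i j ▸ h))
    · exact (Fin.natAddOrderEmb m).lt_iff_lt.1 (hg _ _ (h2 hP i j ▸ h))
  · rintro ⟨h, ha, hb⟩ i j hij
    induction i using Fin.addCases with
    | left i =>
      induction j using Fin.addCases with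
      | left j =>
        have := ha i j (by
          change ((leviFst m n ⟨g, h⟩).1 - 1) i j ≠ 0
          rwa [h1])
        exact (Fin.castAddOrderEmb n).lt_iff_lt.2 this
      | right j =>
        have := i.2
        simp only [Fin.lt_def, Fin.val_castAdd, Fin.val_natAdd]
        omega
    | right i =>
      induction j using Fin.addCases with
      | left j =>
        rw [h3] at hij
        exact absurd (maxParabolic_lower ⟨g, h⟩ i j) hij
      | right j =>
        have := hb i j (by
          change ((leviSnd m n ⟨g, h⟩).1 - 1) i j ≠ 0
          rwa [h2])
        exact (Fin.natAddOrderEmb m).lt_iff_lt.2 this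

/-- The product function on `UT_{m+n}` is pulled back from `UT_m × UT_n` along the Levi projection,
so inducing it directly equals inducing on the Levi factor, inflating to `P_{m,n}` and inducing
again. -/
theorem induce_scfMul {m n : ℕ} (φ : scf F m) (ψ : scf F n) :
    induce (UT F (m + n)) (scfMul F m n φ ψ).1 =
      cfGLMul F m n (induce (UT F m) φ.1) (induce (UT F n) ψ.1) := by
  have e : (fun p => (induce ((UT F m).prod (UT F n)) fun p =>
      φ.1 ⟨p.1.1, p.2.1⟩ * ψ.1 ⟨p.1.2, p.2.2⟩).1 (levi m n p)) =
      fun p => (induce (UT F m) φ.1).1 (leviFst m n p) * (induce (UT F n) ψ.1).1 (leviSnd m n p) :=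
    funext fun p => induce_prod (UT F m) (UT F n) φ.1 ψ.1 _ _
  rw [cfGLMul_eq_induce, ← e]
  refine (induce_induce (maxParabolic F m n) (levi m n) (levi_surjective m n) _ _
    mem_UT_iff_levi _ _ fun g h h' => ?_).symm
  rw [scfMul_apply]
  refine congrArg₂ (· * ·) (congrArg φ.1 (ut_ext rfl)) (congrArg ψ.1 (ut_ext rfl))

theorem indUTGL_lof (n : ℕ) (φ : scf F n) :
    indUTGL F (DirectSum.lof ℂ ℕ (fun n => scf F n) n φ) =
      DirectSum.lof ℂ ℕ (fun n => cfGL F n) n (induce (UT F n) φ.1) := by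
  rw [indUTGL, DirectSum.lmap_lof]
  rfl

variable (F) in
theorem indUTGL_mul (x y : ⨁ n, scf F n) : indUTGL F ((scfHopf F).mul (x ⊗ₜ y)) =
    (cfGLHopf F).mul (indUTGL F x ⊗ₜ indUTGL F y) := by
  induction x using DirectSum.induction_on with
  | zero => rw [TensorProduct.zero_tmul, map_zero, map_zero, TensorProduct.zero_tmul,
      map_zero]
  | add x x' hx hx' => rw [TensorProduct.add_tmul, map_add, map_add, hx, hx', map_add,
      TensorProduct.add_tmul, map_add]
  | of k φ =>
    induction y using DirectSum.induction_on with
    | zero => rw [TensorProduct.tmul_zero, map_zero, map_zero, TensorProduct.tmul_zero,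
        map_zero]
    | add y y' hy hy' => rw [TensorProduct.tmul_add, map_add, map_add, hy, hy', map_add,
        TensorProduct.tmul_add, map_add]
    | of l ψ =>
      refine (congrArg (indUTGL F) (scfHopf_mul_lof k l φ ψ)).trans ?_
      refine (indUTGL_lof _ _).trans ?_
      rw [induce_scfMul]
      refine (cfGLHopf_mul_lof _ _ _ _).symm.trans ?_
      exact congrArg _ (congrArg₂ (· ⊗ₜ[ℂ] ·) (indUTGL_lof k φ).symm (indUTGL_lof l ψ).symm)

end ind_mul

/-! ### The regular functional and the degree of the Steinberg character. -/

section regular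

variable {F : Type*} [Field F] [Fintype F]

theorem card_eq_one_of_subsingleton {G : Type*} [Group G] [Fintype G] [Subsingleton G] :
    Fintype.card G = 1 := Fintype.card_eq_one_iff.2 ⟨1, fun _ => Subsingleton.elim _ _⟩

theorem regChar_apply {G : Type*} [Group G] [Fintype G] (g : G) :
    regChar G g = if g = 1 then (Fintype.card G : ℂ) else 0 := by
  rw [regChar, Representation.character,
    LinearMap.trace_eq_matrix_trace ℂ (MonoidAlgebra.basis G ℂ), Matrix.trace]
  have h : ∀ i : G, (LinearMap.toMatrix (MonoidAlgebra.basis G ℂ) (MonoidAlgebra.basis G ℂ)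
      (Representation.leftRegular ℂ G g)).diag i = if g = 1 then (1 : ℂ) else 0 := by
    intro i
    rw [Matrix.diag_apply, LinearMap.toMatrix_apply, MonoidAlgebra.basis_apply,
      Representation.ofMulAction_single]
    change (MonoidAlgebra.single (g • i) (1 : ℂ)).coeff i = _
    rw [MonoidAlgebra.coeff_single, Finsupp.single_apply]
    simp
  rw [Finset.sum_congr rfl fun i _ => h i, Finset.sum_const, Finset.card_univ]
  split_ifs <;> simp

theorem ket_regChar {G : Type*} [Group G] [Fintype G] (ψ : G → ℂ) : ket (regChar G) ψ = ψ 1 := by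
  rw [ket_apply, Finset.sum_eq_single 1]
  · rw [regChar_apply, if_pos rfl, map_natCast]
    have : (Fintype.card G : ℂ) ≠ 0 := Nat.cast_ne_zero.2 Fintype.card_ne_zero
    field_simp
  · intro g _ hg
    rw [regChar_apply, if_neg hg, map_zero, mul_zero]
  · exact fun h => absurd (Finset.mem_univ _) h

theorem regFunctional_lof (n : ℕ) (φ : scf F n) :
    regFunctional F (DirectSum.lof ℂ ℕ (fun n => scf F n) n φ) = φ.1 1 := by
  rw [regFunctional, DirectSum.toModule_lof]
  exact ket_regChar φ.1

theorem stFunctional_indUTGL_lof (n : ℕ) (φ : scf F n) :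
    stFunctional F (indUTGL F (DirectSum.lof ℂ ℕ (fun n => scf F n) n φ)) =
      (Fintype.card (UT F n) : ℂ)⁻¹ * (steinberg F n).1 1 * φ.1 1 := by
  rw [indUTGL_lof, stFunctional_lof, ket_steinberg_induce]

variable (F) in
/-- The trivial character of `UT_n`. -/
def oneUT (n : ℕ) : scf F n := ⟨fun _ => 1, fun _ _ _ => rfl⟩

theorem steinberg_one : steinberg F 1 = oneFam F 1 := by
  have h := steinberg_eq (F := F) one_ne_zero
  rw [Finset.Ico_self, Finset.powerset_empty, Finset.sum_singleton, flagChar_empty,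
    Finset.card_empty, zero_add, pow_one] at h
  simpa using h

theorem subsingleton_UT_one : Subsingleton (UT F 1) :=
  ⟨fun g h => ut_ext (Matrix.ext fun i j => by
    rw [utMat_of_not_lt g (by simp [Subsingleton.elim i j]),
      utMat_of_not_lt h (by simp [Subsingleton.elim i j])])⟩

/-- The trivial character of `UT_n` is the `n`-fold product of that of `UT_1`, on which the
pulled-back Steinberg functional is one. By multiplicativity it is one in degree `n`, whereas it is
also `St(1) / |UT_n|`. -/
theorem steinberg_apply_one (n : ℕ) : (steinberg F n).1 1 = Fintype.card (UT F n) := by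
  have key : stFunctional F (indUTGL F
      (DirectSum.lof ℂ ℕ (fun n => scf F n) n (oneUT F n))) = 1 := by
    induction n with
    | zero =>
      rw [stFunctional_indUTGL_lof, steinberg_zero, card_eq_one_of_subsingleton, Nat.cast_one, inv_one,
        one_mul]
      exact one_mul _
    | succ n ih =>
      have h1 : scfMul F n 1 (oneUT F n) (oneUT F 1) = oneUT F (n + 1) :=
        Subtype.ext (funext fun g => one_mul _)
      have := subsingleton_UT_one (F := F)
      rw [← h1, ← scfHopf_mul_lof, indUTGL_mul, (isLinearCharacter_stFunctional F).map_mul, ih,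
        one_mul, stFunctional_indUTGL_lof, steinberg_one, card_eq_one_of_subsingleton, Nat.cast_one,
        inv_one, one_mul]
      exact one_mul _
  rw [stFunctional_indUTGL_lof] at key
  have : (Fintype.card (UT F n) : ℂ) ≠ 0 := Nat.cast_ne_zero.2 Fintype.card_ne_zero
  have h1 : (oneUT F n).1 1 = 1 := rfl
  rw [h1, mul_one] at key
  field_simp at key
  exact key

variable (F) in
theorem regFunctional_eq : regFunctional F = stFunctional F ∘ₗ indUTGL F := by
  refine DirectSum.linearMap_ext ℂ fun n => LinearMap.ext fun φ => ?_
  rw [LinearMap.comp_apply, LinearMap.comp_apply, LinearMap.comp_apply, regFunctional_lof,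
    stFunctional_indUTGL_lof, steinberg_apply_one, inv_mul_cancel₀, one_mul]
  exact Nat.cast_ne_zero.2 Fintype.card_ne_zero

variable (F) in
theorem unit_scfHopf_one : (scfHopf F).unit 1 =
    DirectSum.lof ℂ ℕ (fun n => scf F n) 0 (oneUT F 0) := by
  simp [scfHopf, oneUT]

variable (F) in
theorem indUTGL_unit : indUTGL F ((scfHopf F).unit 1) = (cfGLHopf F).unit 1 := by
  rw [unit_scfHopf_one, indUTGL_lof, unit_cfGLHopf]
  refine congrArg _ (Subtype.ext (funext fun g => ?_))
  exact induce_one_eq_one _ (Subsingleton.elim _ _) g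

-- Multiplicativity is inherited from the Steinberg functional through the multiplicative map
-- `indUTGL`.
variable (F) in
theorem isLinearCharacter_regFunctional : IsLinearCharacter (scfHopf F) (regFunctional F) where
  map_mul x y := by
    rw [regFunctional_eq, LinearMap.comp_apply, indUTGL_mul,
      (isLinearCharacter_stFunctional F).map_mul]
    rfl
  map_unit := by
    rw [regFunctional_eq, LinearMap.comp_apply, indUTGL_unit,
      (isLinearCharacter_stFunctional F).map_unit]

variable (F) in
theorem indUTGL_counit (x : ⨁ n, scf F n) :
    (cfGLHopf F).counit (indUTGL F x) = (scfHopf F).counit x := by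
  refine LinearMap.congr_fun (f := (cfGLHopf F).counit ∘ₗ indUTGL F)
    (DirectSum.linearMap_ext ℂ fun n => LinearMap.ext fun φ => ?_) x
  rw [LinearMap.comp_apply, LinearMap.comp_apply, LinearMap.comp_apply, indUTGL_lof]
  by_cases hn : n = 0
  · subst hn
    rw [counit_scfHopf_lof_zero, counit_cfGLHopf_lof_zero, induce_apply,
      Fintype.sum_subsingleton _ 1, card_eq_one_of_subsingleton]
    have : (1 : GL (Fin 0) F)⁻¹ * 1 * 1 = ((1 : UT F 0) : GL (Fin 0) F) := Subsingleton.elim _ _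
    rw [this, extendZero_coe, Nat.cast_one, inv_one, one_mul]
  · rw [counit_scfHopf_lof n hn, counit_cfGLHopf_lof F n hn]

end regular

/-! ### Mackey's formula for deflation. -/

section mackey

variable {G : Type*} [Group G] [Fintype G] {L : Type*} [Group L] [Fintype L] {ι : Type*} [Fintype ι]

theorem extendZero_conj {U : Subgroup G} {φ : U → ℂ} (hφ : ∀ u v : U, φ (v * u * v⁻¹) = φ u)
    (v : U) (g : G) : extendZero U φ (v.1⁻¹ * g * v.1) = extendZero U φ g := by
  by_cases h : g ∈ U
  · have := hφ ⟨g, h⟩ v⁻¹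
    rw [inv_inv] at this
    rw [← extendZero_coe U φ] at this
    rw [extendZero, extendZero, dif_pos h, ← this, Subgroup.coe_mul, Subgroup.coe_mul,
      Subgroup.coe_inv, extendZero]
  · rw [extendZero, extendZero, dif_neg h, dif_neg]
    intro h'
    refine h ?_
    have := U.mul_mem (U.mul_mem v.2 h') (U.inv_mem v.2)
    convert this using 1
    group

/-- The intersection of `U` with the conjugate `w⁻¹ P w`. -/
abbrev capConj (U P : Subgroup G) (w : G) : Type _ := {u : U // w * u.1 * w⁻¹ ∈ P}

theorem card_capConj_ne_zero (U P : Subgroup G) (w : G) :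
    (Fintype.card (capConj U P w) : ℂ) ≠ 0 := by
  have : Nonempty (capConj U P w) := ⟨⟨1, by simp⟩⟩
  exact Nat.cast_ne_zero.2 Fintype.card_ne_zero

/-- Two factorizations `p w u` of the same element differ by an element of `U ∩ w⁻¹ P w`. -/
theorem card_doubleCoset_fibre (U P : Subgroup G) (w z : G) :
    Finset.card {q : P × U | q.1.1 * w * q.2.1 = z} =
      if ∃ p ∈ P, ∃ u ∈ U, z = p * w * u then Fintype.card (capConj U P w) else 0 := by
  split_ifs with h
  · obtain ⟨p, hp, u, hu, rfl⟩ := h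
    rw [← Fintype.card_coe]
    refine Fintype.card_congr
      { toFun := fun q => ⟨q.1.2 * ⟨u, hu⟩⁻¹, ?_⟩
        invFun := fun v => ⟨(⟨p, hp⟩ * ⟨w * v.1.1 * w⁻¹, v.2⟩⁻¹, v.1 * ⟨u, hu⟩), ?_⟩
        left_inv := ?_
        right_inv := ?_ }
    · have h1 := (Finset.mem_filter.1 q.2).2
      have h2 : w * (q.1.2 * ⟨u, hu⟩⁻¹ : U).1 * w⁻¹ = q.1.1.1⁻¹ * p := by
        rw [Subgroup.coe_mul, Subgroup.coe_inv, eq_inv_mul_iff_mul_eq]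
        calc q.1.1.1 * (w * (q.1.2.1 * u⁻¹) * w⁻¹) = (q.1.1.1 * w * q.1.2.1) * u⁻¹ * w⁻¹ := by group
          _ = p := by rw [h1]; group
      rw [h2]
      exact P.mul_mem (P.inv_mem q.1.1.2) hp
    · refine Finset.mem_filter.2 ⟨Finset.mem_univ _, ?_⟩
      simp only [Subgroup.coe_mul, Subgroup.coe_inv]
      group
    · rintro ⟨⟨⟨p', hp'⟩, ⟨u', hu'⟩⟩, hq⟩
      have h1 : p' * w * u' = p * w * u := (Finset.mem_filter.1 hq).2
      refine Subtype.ext (Prod.ext (Subtype.ext ?_) (Subtype.ext ?_))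
      · change p * (w * (u' * u⁻¹) * w⁻¹)⁻¹ = p'
        rw [mul_inv_eq_iff_eq_mul]
        calc p = p * w * u * u⁻¹ * w⁻¹ := by group
          _ = p' * (w * (u' * u⁻¹) * w⁻¹) := by rw [← h1]; group
      · change u' * u⁻¹ * u = u'
        group
    · rintro ⟨⟨v, hv⟩, hv'⟩
      refine Subtype.ext (Subtype.ext ?_)
      change v * u * u⁻¹ = v
      group
  · rw [Finset.card_eq_zero, Finset.filter_eq_empty_iff]
    rintro ⟨p, u⟩ _ hq
    exact h ⟨p.1, p.2, u.1, u.2, hq.symm⟩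

/-- Summation over `G` by double cosets. -/
theorem sum_doubleCosets {U P : Subgroup G} {w : ι → G}
    (hw : ∀ z, ∃! i, ∃ p ∈ P, ∃ u ∈ U, z = p * w i * u) {Φ : G → ℂ}
    (hΦ : ∀ z, ∀ u ∈ U, Φ (z * u) = Φ z) :
    ∑ z, Φ z = ∑ i, (Fintype.card U : ℂ) * (Fintype.card (capConj U P (w i)) : ℂ)⁻¹ *
      ∑ p : P, Φ (p * w i) := by
  have h1 : ∀ i, (Fintype.card U : ℂ) * ∑ p : P, Φ (p * w i) =
      ∑ z, (if ∃ p ∈ P, ∃ u ∈ U, z = p * w i * u then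
        (Fintype.card (capConj U P (w i)) : ℂ) else 0) * Φ z := by
    intro i
    have h2 : ∑ q : P × U, Φ (q.1.1 * w i * q.2.1) = (Fintype.card U : ℂ) * ∑ p : P, Φ (p * w i) := by
      rw [Fintype.sum_prod_type, Finset.mul_sum]
      refine Finset.sum_congr rfl fun p _ => ?_
      refine (Finset.sum_congr rfl fun (u : U) _ => hΦ (p.1 * w i) u.1 u.2).trans ?_
      rw [Finset.sum_const, nsmul_eq_mul, Finset.card_univ]
    rw [← h2, ← Finset.sum_fiberwise Finset.univ fun q : P × U => q.1.1 * w i * q.2.1]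
    refine Finset.sum_congr rfl fun z _ => ?_
    rw [Finset.sum_congr rfl fun q hq => congrArg Φ (Finset.mem_filter.1 hq).2, Finset.sum_const,
      card_doubleCoset_fibre, nsmul_eq_mul, Nat.cast_ite, Nat.cast_zero]
  have h3 : ∀ i, (Fintype.card U : ℂ) * (Fintype.card (capConj U P (w i)) : ℂ)⁻¹ *
      ∑ p : P, Φ (p * w i) =
      ∑ z, (if ∃ p ∈ P, ∃ u ∈ U, z = p * w i * u then Φ z else 0) := by
    intro i
    rw [mul_right_comm, h1, Finset.sum_mul]
    refine Finset.sum_congr rfl fun z _ => ?_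
    have := card_capConj_ne_zero U P (w i)
    split_ifs
    · field_simp
    · rw [zero_mul, zero_mul]
  rw [Finset.sum_congr rfl fun i _ => h3 i, Finset.sum_comm]
  refine Finset.sum_congr rfl fun z _ => ?_
  obtain ⟨i, hi, hi'⟩ := hw z
  rw [Finset.sum_eq_single i, if_pos hi]
  · intro j _ hj
    rw [if_neg fun h => hj (hi' j h)]
  · exact fun h => absurd (Finset.mem_univ _) h

/-- Mackey's formula for the deflation of an induced function. -/
theorem deflate_induce {U P : Subgroup G} {w : ι → G}
    (hw : ∀ z, ∃! i, ∃ p ∈ P, ∃ u ∈ U, z = p * w i * u) (π : P →* L)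
    (hπ : Function.Surjective π) {φ : U → ℂ} (hφ : ∀ u v : U, φ (v * u * v⁻¹) = φ u) (l : L) :
    deflate π (fun p : P => (induce U φ).1 p) l =
      ∑ i, (Fintype.card (capConj U P (w i)) : ℂ)⁻¹ *
        ∑ x : L, ∑ M : P with π M = x⁻¹ * l * x, extendZero U φ ((w i)⁻¹ * M * w i) := by
  have hfib : ∀ x, Finset.card {p : P | π p = x} = Finset.card {p : P | π p = l} := fun x => by
    convert MonoidHom.card_fiber_eq_of_mem_range π (hπ x) (hπ l)
  have hN : (Finset.card {p : P | π p = l} : ℂ) ≠ 0 := by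
    rw [Nat.cast_ne_zero, ← Nat.pos_iff_ne_zero, Finset.card_pos]
    obtain ⟨p, hp⟩ := hπ l
    exact ⟨p, Finset.mem_filter.2 ⟨Finset.mem_univ _, hp⟩⟩
  have hU : (Fintype.card U : ℂ) ≠ 0 := Nat.cast_ne_zero.2 Fintype.card_ne_zero
  have h1 : ∀ M : P, (induce U φ).1 M = ∑ i, (Fintype.card (capConj U P (w i)) : ℂ)⁻¹ *
      ∑ p : P, extendZero U φ ((w i)⁻¹ * (p⁻¹ * M * p : P) * w i) := by
    intro M
    have h2 := sum_doubleCosets hw (Φ := fun z => extendZero U φ (z⁻¹ * M * z)) fun z u hu => by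
      have := extendZero_conj hφ ⟨u, hu⟩ (z⁻¹ * M * z)
      rw [← this]
      exact congrArg _ (by group)
    rw [induce_apply, h2, Finset.mul_sum]
    refine Finset.sum_congr rfl fun i _ => ?_
    rw [← mul_assoc, ← mul_assoc, inv_mul_cancel₀ hU, one_mul]
    refine congrArg _ (Finset.sum_congr rfl fun p _ => congrArg _ ?_)
    rw [Subgroup.coe_mul, Subgroup.coe_mul, Subgroup.coe_inv]
    group
  -- Conjugation by `p` carries the fibre over `l` to the fibre over the conjugate of `l` by `π p`.
  have h3 : ∀ (i : ι) (p : P), ∑ M : P with π M = l,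
      extendZero U φ ((w i)⁻¹ * (p⁻¹ * M * p : P) * w i) =
      ∑ M : P with π M = (π p)⁻¹ * l * π p, extendZero U φ ((w i)⁻¹ * M * w i) := by
    intro i p
    refine Finset.sum_nbij' (fun M => p⁻¹ * M * p) (fun M => p * M * p⁻¹) ?_ ?_ ?_ ?_ ?_
    · intro M hM
      simp only [Finset.mem_filter, Finset.mem_univ, true_and] at hM ⊢
      rw [map_mul, map_mul, map_inv, hM]
    · intro M hM
      simp only [Finset.mem_filter, Finset.mem_univ, true_and] at hM ⊢
      rw [map_mul, map_mul, map_inv, hM]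
      group
    · intro M _
      group
    · intro M _
      group
    · exact fun _ _ => rfl
  -- The dependence on `p` is only through `π p`; the fibre size that appears cancels the
  -- denominator of the average.
  have h4 : ∀ h : L → ℂ, ∑ p : P, h (π p) = (Finset.card {p : P | π p = l} : ℂ) * ∑ x, h x := by
    intro h
    rw [← Finset.sum_fiberwise Finset.univ π, Finset.mul_sum]
    refine Finset.sum_congr rfl fun x _ => ?_
    rw [Finset.sum_congr rfl fun k hk => congrArg h (Finset.mem_filter.1 hk).2, Finset.sum_const,
      nsmul_eq_mul]
    exact congrArg (fun n : ℕ => (n : ℂ) * h x) (hfib x)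
  rw [deflate_apply, div_eq_iff (by convert hN), Finset.sum_mul]
  simp only [h1]
  rw [Finset.sum_comm]
  refine Finset.sum_congr rfl fun i _ => ?_
  rw [← Finset.mul_sum, Finset.sum_comm, mul_assoc]
  refine congrArg _ ?_
  refine (Finset.sum_congr rfl fun p _ => ?_).trans ((h4 fun x =>
    ∑ M : P with π M = x⁻¹ * l * x, extendZero U φ ((w i)⁻¹ * M * w i)).trans ?_)
  · rw [← h3]
  · rw [mul_comm]

end mackey

/-! ### Pivots of a family of vectors. -/

section pivots

variable {F : Type*} [Field F]

/-- The positions `j` for which `v j` lies in the span of the preceding vectors. -/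
def nonPivots {V : Type*} [AddCommGroup V] [Module F V] {n : ℕ} (v : Fin n → V) : Finset (Fin n) :=
  {j | v j ∈ Submodule.span F (v '' Set.Iio j)}

theorem mem_nonPivots {V : Type*} [AddCommGroup V] [Module F V] {n : ℕ} {v : Fin n → V}
    {j : Fin n} : j ∈ nonPivots (F := F) v ↔ v j ∈ Submodule.span F (v '' Set.Iio j) := by
  simp [nonPivots]

theorem finrank_sup_span_singleton_eq_ite {V : Type*} [AddCommGroup V] [Module F V]
    [FiniteDimensional F V] (W : Submodule F V) (x : V) :
    Module.finrank F (W ⊔ Submodule.span F {x} : Submodule F V) =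
      Module.finrank F W + if x ∈ W then 0 else 1 := by
  split_ifs with h
  · rw [sup_eq_left.2, add_zero]
    rwa [Submodule.span_singleton_le_iff_mem]
  · exact Submodule.finrank_sup_span_singleton h

/-- Adjoining the last vector raises the rank by one unless it lies in the span of the earlier ones,
which is the condition for a non-pivot. -/
theorem finrank_span_add_card_nonPivots {V : Type*} [AddCommGroup V] [Module F V]
    [FiniteDimensional F V] {n : ℕ} (v : Fin n → V) :
    Module.finrank F (Submodule.span F (Set.range v)) + (nonPivots (F := F) v).card = n := by
  induction n with
  | zero =>
    have : nonPivots (F := F) v = ∅ := Finset.eq_empty_of_isEmpty _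
    rw [this, Set.range_eq_empty, Submodule.span_empty, finrank_bot, Finset.card_empty]
  | succ n ih =>
    have h1 : Submodule.span F (Set.range v) =
        Submodule.span F (Set.range fun i : Fin n => v i.castSucc) ⊔
          Submodule.span F {v (Fin.last n)} := by
      rw [← Submodule.span_union]
      refine congrArg _ (Set.ext fun x => ?_)
      simp only [Set.mem_range, Set.mem_union, Set.mem_singleton_iff, Fin.exists_fin_succ']
      exact or_congr Iff.rfl eq_comm
    have h2 : ∀ i : Fin n, i.castSucc ∈ nonPivots (F := F) v ↔
        i ∈ nonPivots (F := F) fun i : Fin n => v i.castSucc := by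
      intro i
      rw [mem_nonPivots, mem_nonPivots]
      have : v '' Set.Iio i.castSucc = (fun i : Fin n => v i.castSucc) '' Set.Iio i := by
        ext x
        constructor
        · rintro ⟨j, hj, rfl⟩
          have hj' : (j : ℕ) < i := hj
          exact ⟨⟨j, by omega⟩, hj', rfl⟩
        · rintro ⟨j, hj, rfl⟩
          exact ⟨j.castSucc, hj, rfl⟩
      rw [this]
    have h3 : Fin.last n ∈ nonPivots (F := F) v ↔
        v (Fin.last n) ∈ Submodule.span F (Set.range fun i : Fin n => v i.castSucc) := by
      rw [mem_nonPivots]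
      have : v '' Set.Iio (Fin.last n) = Set.range fun i : Fin n => v i.castSucc := by
        ext x
        constructor
        · rintro ⟨j, hj, rfl⟩
          have hj' : (j : ℕ) < n := hj
          exact ⟨⟨j, hj'⟩, rfl⟩
        · rintro ⟨j, rfl⟩
          exact ⟨j.castSucc, Fin.castSucc_lt_last j, rfl⟩
      rw [this]
    have h4 : ∀ {m : ℕ} (s : Finset (Fin m)), s.card = ∑ i, if i ∈ s then 1 else 0 := by
      intro m s
      simp
    have h5 := ih fun i : Fin n => v i.castSucc
    rw [h1, finrank_sup_span_singleton_eq_ite, h4, Fin.sum_univ_castSucc]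
    simp only [h2, h3]
    rw [← h4]
    split_ifs <;> omega

end pivots

/-! ### Conjugation of superclasses; permutation matrices of shuffles. -/

section mackey_UT

variable {F : Type*} [Field F] [Fintype F]

theorem utMat_eq_zero {n : ℕ} (g : UT F n) {i j : Fin n} (h : j < i) : utMat g i j = 0 := by
  rw [utMat_of_not_lt g h.not_gt, Matrix.one_apply_ne h.ne']

/-- Superclass functions are class functions. -/
theorem superSetoid_conj {n : ℕ} (u v : UT F n) : superSetoid F n u (v * u * v⁻¹) := by
  have key : ∀ (u v : UT F n) i l, VanishOn u i l → VanishOn (v * u * v⁻¹) i l := by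
    intro u v i l hu j k h1 h2 h3
    -- The `(j, k)` entry of the first summand combines entries of `u - 1` at positions `(a, b)`
    -- with `j ≤ a` and `b ≤ k`, all inside the interval.
    have e : utMat (v * u * v⁻¹) = utMat v * (utMat u - 1) * utMat v⁻¹ + 1 := by
      have h : utMat v * utMat v⁻¹ = 1 := congrArg Units.val (mul_inv_cancel v.1)
      rw [mul_sub, sub_mul, mul_one, h, sub_add_cancel]
      rfl
    rw [e, Matrix.add_apply, Matrix.one_apply_ne h2.ne, add_zero, Matrix.mul_apply]
    refine Finset.sum_eq_zero fun b _ => ?_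
    rw [Matrix.mul_apply, Finset.sum_mul]
    refine Finset.sum_eq_zero fun a _ => ?_
    by_contra hne
    have hN := right_ne_zero_of_mul (left_ne_zero_of_mul hne)
    have hab := u.2 a b hN
    have hja : j ≤ a := not_lt.1 fun h => left_ne_zero_of_mul (left_ne_zero_of_mul hne)
      (utMat_eq_zero v h)
    have hbk : b ≤ k := not_lt.1 fun h => right_ne_zero_of_mul hne (utMat_eq_zero v⁻¹ h)
    refine hN ?_
    rw [Matrix.sub_apply, Matrix.one_apply_ne hab.ne, sub_zero]
    exact hu a b (h1.trans hja) hab (hbk.trans h3)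
  rw [superSetoid_iff]
  refine fun i l => ⟨key u v i l, fun h => ?_⟩
  have := key _ v⁻¹ i l h
  rwa [inv_inv, mul_assoc, mul_assoc, inv_mul_cancel, mul_one, inv_mul_cancel_left] at this

variable (F) in
/-- Permutation matrices. -/
def permGL {n : ℕ} (τ : Equiv.Perm (Fin n)) : GL (Fin n) F where
  val := (1 : Matrix (Fin n) (Fin n) F).submatrix τ id
  inv := (1 : Matrix (Fin n) (Fin n) F).submatrix id τ
  val_inv := by
    ext i j
    simp [Matrix.mul_apply, Matrix.one_apply]
  inv_val := by
    rw [Matrix.submatrix_mul_equiv]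
    simp

theorem permGL_mul {n : ℕ} (τ : Equiv.Perm (Fin n)) (g : GL (Fin n) F) :
    (permGL F τ * g).1 = g.1.submatrix τ id := by
  ext i j
  rw [Units.val_mul, Matrix.mul_apply]
  simp [permGL, Matrix.one_apply]

theorem mul_permGL_inv {n : ℕ} (τ : Equiv.Perm (Fin n)) (g : GL (Fin n) F) :
    (g * (permGL F τ)⁻¹).1 = g.1.submatrix id τ := by
  ext i j
  rw [Units.val_mul, Matrix.mul_apply]
  change ∑ x, g.1 i x * (1 : Matrix (Fin n) (Fin n) F).submatrix id τ x j = _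
  simp [Matrix.one_apply]

theorem permGL_conj {n : ℕ} (τ : Equiv.Perm (Fin n)) (g : GL (Fin n) F) :
    (permGL F τ * g * (permGL F τ)⁻¹).1 = g.1.submatrix τ τ := by
  rw [mul_permGL_inv, permGL_mul]
  rfl

theorem mem_maxParabolic {k l : ℕ} {g : GL (Fin (k + l)) F} :
    g ∈ maxParabolic F k l ↔ ∀ i j, g.1 (Fin.natAdd k i) (Fin.castAdd l j) = 0 := by
  refine ⟨fun h => maxParabolic_lower ⟨g, h⟩, fun h i j hij => ?_⟩
  induction i using Fin.addCases with
  | left i => induction j using Fin.addCases <;> simp at hij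
  | right i =>
    induction j using Fin.addCases with
    | left j => exact h i j
    | right j => simp at hij

section shuffle

variable {k l : ℕ} (I : Finset (Fin (k + l))) (hk : I.card = k) (hl : Iᶜ.card = l)

/-- The permutation of `Fin (k + l)` whose restrictions to the first `k` and the last `l` elements
are the order preserving numberings of `I` and of its complement. -/
def shufflePerm : Equiv.Perm (Fin (k + l)) :=
  finSumFinEquiv.symm.trans (finSumEquivOfFinset hk hl)

theorem shufflePerm_castAdd (i : Fin k) :
    shufflePerm I hk hl (Fin.castAdd l i) = I.orderEmbOfFin hk i := by
  simp [shufflePerm]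

theorem shufflePerm_natAdd (i : Fin l) :
    shufflePerm I hk hl (Fin.natAdd k i) = Iᶜ.orderEmbOfFin hl i := by
  simp [shufflePerm]

end shuffle

end mackey_UT

/-! ### Double cosets of `P_{k,l}` and `UT_{k+l}`. -/

section bruhat

variable {F : Type*} [Field F] [Fintype F] {k l : ℕ}

/-- The last `l` rows of an invertible matrix, as a family of column vectors. -/
def botCol (z : GL (Fin (k + l)) F) (j : Fin (k + l)) : Fin l → F := fun i => z.1 (Fin.natAdd k i) j

theorem span_botCol (z : GL (Fin (k + l)) F) :
    Submodule.span F (Set.range (botCol z)) = ⊤ := by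
  refine Submodule.eq_top_iff'.2 fun y => ?_
  let x : Fin (k + l) → F := (z⁻¹).1.mulVec (Fin.append (0 : Fin k → F) y)
  have h : z.1.mulVec x = Fin.append (0 : Fin k → F) y := by
    rw [Matrix.mulVec_mulVec, ← Units.val_mul, mul_inv_cancel, Units.val_one, Matrix.one_mulVec]
  have hy : y = ∑ j, x j • botCol z j := by
    ext i
    have := congrFun h (Fin.natAdd k i)
    rw [Fin.append_right] at this
    rw [← this, Finset.sum_apply, Matrix.mulVec, dotProduct]
    exact Finset.sum_congr rfl fun j _ => mul_comm _ _
  rw [hy]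
  exact Submodule.sum_mem _ fun j _ => Submodule.smul_mem _ _ (Submodule.subset_span ⟨j, rfl⟩)

/-- The truncated columns span `F^l` because `z` is surjective, leaving `k` non-pivots. -/
theorem card_nonPivots_botCol (z : GL (Fin (k + l)) F) :
    (nonPivots (F := F) (botCol z)).card = k := by
  have := finrank_span_add_card_nonPivots (F := F) (botCol z)
  rw [span_botCol, finrank_top, Module.finrank_fin_fun] at this
  omega

theorem botCol_mul_UT (z : GL (Fin (k + l)) F) (u : UT F (k + l)) (j : Fin (k + l)) :
    botCol (z * u.1) j = ∑ i ∈ Finset.Iio j, utMat u i j • botCol z i + botCol z j := by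
  ext a
  rw [botCol, Units.val_mul, Matrix.mul_apply, Pi.add_apply, Finset.sum_apply,
    ← Finset.sum_subset (Finset.subset_univ (Finset.Iic j)), ← Finset.Iio_insert,
    Finset.sum_insert (by simp), add_comm]
  · refine congrArg₂ (· + ·) (Finset.sum_congr rfl fun i _ => mul_comm _ _) ?_
    have h1 : utMat u j j = 1 := by rw [utMat_of_not_lt u (lt_irrefl j), Matrix.one_apply_eq]
    exact (congrArg _ h1).trans (mul_one _)
  · intro i _ hi
    exact (congrArg _ (utMat_eq_zero u (by simpa using hi))).trans (mul_zero _)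

/-- Right multiplication by `u` adds to each column multiples of earlier columns only, so a column
that becomes zero was dependent on its predecessors. -/
theorem mem_nonPivots_of_botCol_mul_UT {z : GL (Fin (k + l)) F} {u : UT F (k + l)}
    {j : Fin (k + l)} (h : botCol (z * u.1) j = 0) : j ∈ nonPivots (F := F) (botCol z) := by
  rw [botCol_mul_UT, add_comm, add_eq_zero_iff_eq_neg] at h
  rw [mem_nonPivots, h]
  refine Submodule.neg_mem _ (Submodule.sum_mem _ fun i hi => Submodule.smul_mem _ _
    (Submodule.subset_span ⟨i, Finset.mem_Iio.1 hi, rfl⟩))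

/-- The dependency of each non-pivot column on earlier ones, with a minus sign, is the corresponding
column of `u` above the diagonal; all non-pivots are cleared at once. -/
theorem exists_UT_botCol_eq_zero (z : GL (Fin (k + l)) F) :
    ∃ u : UT F (k + l), ∀ j ∈ nonPivots (F := F) (botCol z), botCol (z * u.1) j = 0 := by
  have h : ∀ j, ∃ c : Fin (k + l) → F, j ∈ nonPivots (F := F) (botCol z) →
      botCol z j = ∑ i ∈ Finset.Iio j, c i • botCol z i := by
    intro j
    by_cases hj : j ∈ nonPivots (F := F) (botCol z)
    · have h1 := mem_nonPivots.1 hj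
      have h2 : Set.Iio j = (Finset.Iio j : Set (Fin (k + l))) := by simp
      rw [h2, Submodule.mem_span_image_finset_iff_exists_fun] at h1
      obtain ⟨c, hc⟩ := h1
      refine ⟨fun i => if h : i ∈ Finset.Iio j then c ⟨i, h⟩ else 0, fun _ => hc.symm.trans ?_⟩
      refine Eq.trans (Finset.sum_congr rfl fun i _ => ?_)
        (Finset.sum_coe_sort (Finset.Iio j) fun i =>
          (if h : i ∈ Finset.Iio j then c ⟨i, h⟩ else 0) • botCol z i)
      rw [dif_pos i.2]
    · exact ⟨0, fun h => absurd h hj⟩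
  choose c hc using h
  refine ⟨utMk (Matrix.of fun i j => if i < j then - c j i else if i = j then 1 else 0) ?_, ?_⟩
  · intro i j hij
    by_contra hlt
    rw [Matrix.sub_apply, Matrix.of_apply, if_neg hlt, Matrix.one_apply, sub_self] at hij
    exact hij rfl
  · intro j hj
    rw [botCol_mul_UT, utMat_mk]
    have : ∑ i ∈ Finset.Iio j, (Matrix.of fun i j => if i < j then - c j i else
        if i = j then 1 else 0 : Matrix (Fin (k + l)) (Fin (k + l)) F) i j • botCol z i =
        - ∑ i ∈ Finset.Iio j, c j i • botCol z i := by
      rw [← Finset.sum_neg_distrib]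
      refine Finset.sum_congr rfl fun i hi => ?_
      rw [Matrix.of_apply, if_pos (Finset.mem_Iio.1 hi), neg_smul]
    rw [this, ← hc j hj, neg_add_cancel]

/-- Undoing the shuffle moves the columns indexed by `I` to the first `k` places, where membership
in `P_{k,l}` means that their last `l` entries vanish. -/
theorem mem_doubleCoset_shuffle_iff {I : Finset (Fin (k + l))} (hk : I.card = k)
    (hl : Iᶜ.card = l) (z : GL (Fin (k + l)) F) :
    (∃ p ∈ maxParabolic F k l, ∃ u ∈ UT F (k + l), z = p * permGL F (shufflePerm I hk hl) * u) ↔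
      ∃ u : UT F (k + l), ∀ j ∈ I, botCol (z * u.1) j = 0 := by
  have key : ∀ u : UT F (k + l), z * u.1 * (permGL F (shufflePerm I hk hl))⁻¹ ∈ maxParabolic F k l ↔
      ∀ j ∈ I, botCol (z * u.1) j = 0 := by
    intro u
    rw [mem_maxParabolic]
    simp only [mul_permGL_inv, Matrix.submatrix_apply, shufflePerm_castAdd, id]
    constructor
    · intro h j hj
      ext i
      have := h i ((I.orderIsoOfFin hk).symm ⟨j, hj⟩)
      rw [emb_orderIso_symm] at this
      exact this
    · intro h i j
      exact congrFun (h _ (I.orderEmbOfFin_mem hk j)) i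
  constructor
  · rintro ⟨p, hp, u, hu, rfl⟩
    refine ⟨⟨u, hu⟩⁻¹, (key _).1 ?_⟩
    convert hp using 1
    rw [Subgroup.coe_inv]
    group
  · rintro ⟨u, hu⟩
    refine ⟨_, (key u).2 hu, u.1⁻¹, (UT F (k + l)).inv_mem u.2, ?_⟩
    group

theorem card_compl_of_card {I : Finset (Fin (k + l))} (hk : I.card = k) : Iᶜ.card = l := by
  rw [Finset.card_compl, Fintype.card_fin, hk, Nat.add_sub_cancel_left]

/-- The double cosets `P_{k,l} \ GL_{k+l} / UT_{k+l}` are represented by the shuffles. -/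
theorem existsUnique_doubleCoset_shuffle (z : GL (Fin (k + l)) F) :
    ∃! I : {I : Finset (Fin (k + l)) // I.card = k}, ∃ p ∈ maxParabolic F k l,
      ∃ u ∈ UT F (k + l), z = p * permGL F (shufflePerm I.1 I.2 (card_compl_of_card I.2)) * u := by
  simp only [mem_doubleCoset_shuffle_iff]
  refine ⟨⟨nonPivots (F := F) (botCol z), card_nonPivots_botCol z⟩, exists_UT_botCol_eq_zero z, ?_⟩
  rintro ⟨I, hI⟩ ⟨u, hu⟩
  -- Columns that can be cleared are non-pivots, and there are only `k` of those, so `I` is the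
  -- whole set.
  refine Subtype.ext (Finset.eq_of_subset_of_card_le
    (fun j hj => mem_nonPivots_of_botCol_mul_UT (hu j hj)) ?_)
  rw [card_nonPivots_botCol, hI]

end bruhat

/-! ### Tensor components of the induced coproduct. -/

section comul

variable {F : Type*} [Field F] [Fintype F]

/-- The identification of `UT_c` with `UT_d` for `d = c`. -/
def utCast {c d : ℕ} (h : d = c) (g : UT F c) : UT F d :=
  utSub (Fin.castOrderIso h).toOrderEmbedding g

theorem utCast_rfl {c : ℕ} (h : c = c) (g : UT F c) : utCast h g = g := ut_ext rfl

theorem utCast_injective {c d : ℕ} (h : d = c) : Function.Injective (utCast (F := F) h) := by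
  subst h
  intro g g' hg
  rwa [utCast_rfl, utCast_rfl] at hg

theorem utCast_utSub {n c d : ℕ} (h : d = c) (e : Fin c ↪o Fin n) (e' : Fin d ↪o Fin n)
    (he : ∀ i, e' i = e (Fin.cast h i)) (g : UT F n) : utCast h (utSub e g) = utSub e' g := by
  refine ut_ext (Matrix.ext fun i j => ?_)
  rw [utMat_sub, he, he]
  rfl

/-- Inducing both tensor factors is inducing the two-variable function from `UT_k × UT_l`. The
equalities `hc`, `hd` bridge cardinalities such as `I.card` and the degree `k`. -/
theorem tmulFun_indUTGL {k l c d : ℕ} (hc : c = k) (hd : d = l) (g : GL (Fin k) F)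
    (h : GL (Fin l) F) (ψ : classSpace ((superSetoid F c).prod (superSetoid F d))) :
    tmulFun ((evL (Matrix.toLin' g.1) ∘ₗ indUTGL F) ∘ₗ DirectSum.lof ℂ ℕ (fun n => scf F n) c)
      ((evL (Matrix.toLin' h.1) ∘ₗ indUTGL F) ∘ₗ DirectSum.lof ℂ ℕ (fun n => scf F n) d)
      ((extEquiv (superSetoid F c) (superSetoid F d)).symm ψ) =
    (induce ((UT F k).prod (UT F l)) fun p =>
      ψ.1 (utCast hc ⟨p.1.1, p.2.1⟩, utCast hd ⟨p.1.2, p.2.2⟩)).1 (g, h) := by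
  subst hc hd
  obtain ⟨t, rfl⟩ := (extEquiv (superSetoid F c) (superSetoid F d)).surjective ψ
  rw [LinearEquiv.symm_apply_apply]
  simp only [utCast_rfl]
  let R : classSpace ((superSetoid F c).prod (superSetoid F d)) →ₗ[ℂ] ℂ :=
    LinearMap.proj (g, h) ∘ₗ (classFun (GL (Fin c) F × GL (Fin d) F)).subtype ∘ₗ
      induce ((UT F c).prod (UT F d)) ∘ₗ
      LinearMap.funLeft ℂ ℂ (fun p : (UT F c).prod (UT F d) =>
        ((⟨p.1.1, p.2.1⟩, ⟨p.1.2, p.2.2⟩) : UT F c × UT F d)) ∘ₗ Submodule.subtype _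
  refine LinearMap.congr_fun (g := R ∘ₗ (extEquiv (superSetoid F c) (superSetoid F d)).toLinearMap)
    (TensorProduct.ext' fun φ φ' => ?_) t
  rw [tmulFun_tmul]
  refine Eq.trans ?_ (induce_prod (UT F c) (UT F d) φ.1 φ'.1 g h).symm
  rw [LinearMap.comp_apply, LinearMap.comp_apply, LinearMap.comp_apply, LinearMap.comp_apply,
    indUTGL_lof, indUTGL_lof, evL_lof_of_isUnit, evL_lof_of_isUnit]

end comul

/-! ### Induction from `UT` respects coproducts. -/

section comul

variable {F : Type*} [Field F] [Fintype F] {k l : ℕ}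

/-- Identifies the intersection of `UT` with the shuffled parabolic, from Mackey's formula, with the
stabilizer of `I` in the coproduct. -/
theorem shuffle_conj_mem_iff {I : Finset (Fin (k + l))} (hk : I.card = k) (hl : Iᶜ.card = l)
    (g : UT F (k + l)) :
    permGL F (shufflePerm I hk hl) * g.1 * (permGL F (shufflePerm I hk hl))⁻¹ ∈ maxParabolic F k l ↔
      ∀ i ∉ I, ∀ j ∈ I, utMat g i j = 0 := by
  rw [mem_maxParabolic]
  simp only [permGL_conj, Matrix.submatrix_apply, shufflePerm_castAdd, shufflePerm_natAdd]
  constructor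
  · intro h i hi j hj
    have := h ((Iᶜ.orderIsoOfFin hl).symm ⟨i, Finset.mem_compl.2 hi⟩)
      ((I.orderIsoOfFin hk).symm ⟨j, hj⟩)
    rwa [emb_orderIso_symm, emb_orderIso_symm] at this
  · exact fun h i j => h _ (Finset.mem_compl.1 (Iᶜ.orderEmbOfFin_mem hl i)) _
      (I.orderEmbOfFin_mem hk j)

theorem levi_shuffle_conj {I : Finset (Fin (k + l))} (hk : I.card = k) (hl : Iᶜ.card = l)
    (g : UT F (k + l)) (h) :
    levi k l ⟨permGL F (shufflePerm I hk hl) * g.1 * (permGL F (shufflePerm I hk hl))⁻¹, h⟩ =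
      ((utSub (I.orderEmbOfFin hk) g).1, (utSub (Iᶜ.orderEmbOfFin hl) g).1) := by
  refine Prod.ext (Units.ext ?_) (Units.ext ?_)
  · change (permGL F (shufflePerm I hk hl) * g.1 * (permGL F (shufflePerm I hk hl))⁻¹).1.submatrix
      (Fin.castAdd l) (Fin.castAdd l) = (utMat g).submatrix (I.orderEmbOfFin hk) (I.orderEmbOfFin hk)
    rw [permGL_conj]
    ext i j
    simp only [Matrix.submatrix_apply, shufflePerm_castAdd]
  · change (permGL F (shufflePerm I hk hl) * g.1 * (permGL F (shufflePerm I hk hl))⁻¹).1.submatrix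
      (Fin.natAdd k) (Fin.natAdd k) =
        (utMat g).submatrix (Iᶜ.orderEmbOfFin hl) (Iᶜ.orderEmbOfFin hl)
    rw [permGL_conj]
    ext i j
    simp only [Matrix.submatrix_apply, shufflePerm_natAdd]

theorem card_UTstab (I : Finset (Fin (k + l))) (hk : I.card = k) (hl : Iᶜ.card = l) :
    ∃ N : ℕ, N ≠ 0 ∧ (∀ p, Finset.card {g : UTstab F I | UTstabProj I g = p} = N) ∧
      Fintype.card (UTstab F I) = Fintype.card ((UT F k).prod (UT F l)) * N := by
  obtain ⟨N, hN⟩ : ∃ N : ℕ, ∀ p, Finset.card {g : UTstab F I | UTstabProj I g = p} = N := by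
    refine ⟨Finset.card {g : UTstab F I | UTstabProj I g = (1, 1)}, fun p => ?_⟩
    simpa using (card_UTstab_fibre I (fun _ _ => False) p.1 p.2).trans
      (card_UTstab_fibre I (fun _ _ => False) 1 1).symm
  have h : Fintype.card (UTstab F I) = Fintype.card ((UT F k).prod (UT F l)) * N := by
    rw [← Finset.card_univ, Finset.card_eq_sum_card_fiberwise (f := UTstabProj I) (t := Finset.univ)
      (fun _ _ => Finset.mem_univ _), Finset.sum_congr rfl fun p _ => hN p, Finset.sum_const,
      smul_eq_mul, Finset.card_univ, Fintype.card_prod,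
      Fintype.card_congr (Subgroup.prodEquiv (UT F k) (UT F l)).toEquiv, Fintype.card_prod, hk, hl]
  refine ⟨N, ?_, hN, h⟩
  rintro rfl
  have : Nonempty (UTstab F I) :=
    ⟨⟨1, fun i hi j hj => Matrix.one_apply_ne fun h => hi (h ▸ hj)⟩⟩
  exact Fintype.card_ne_zero (h.trans (mul_zero _))

/-- The term of Mackey's formula for a shuffle. -/
theorem shuffle_term {I : Finset (Fin (k + l))} (hk : I.card = k) (hl : Iᶜ.card = l)
    (φ : scf F (k + l)) (x : GL (Fin k) F × GL (Fin l) F) :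
    (Fintype.card (capConj (UT F (k + l)) (maxParabolic F k l)
        (permGL F (shufflePerm I hk hl))) : ℂ)⁻¹ *
      ∑ M : maxParabolic F k l with levi k l M = x, extendZero (UT F (k + l)) φ.1
        ((permGL F (shufflePerm I hk hl))⁻¹ * M.1 * permGL F (shufflePerm I hk hl)) =
    (Fintype.card ((UT F k).prod (UT F l)) : ℂ)⁻¹ * extendZero ((UT F k).prod (UT F l)) (fun p =>
      (scfDeflate F I φ).1 (utCast hk ⟨p.1.1, p.2.1⟩, utCast hl ⟨p.1.2, p.2.2⟩)) x := by
  set w := permGL F (shufflePerm I hk hl) with hw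
  have hmem : ∀ g : UTstab F I, w * g.1.1 * w⁻¹ ∈ maxParabolic F k l :=
    fun g => (shuffle_conj_mem_iff hk hl g.1).2 g.2
  let Λ : UTstab F I → maxParabolic F k l := fun g => ⟨w * g.1.1 * w⁻¹, hmem g⟩
  have hlevi : ∀ g, levi k l (Λ g) =
      ((utSub (I.orderEmbOfFin hk) g.1).1, (utSub (Iᶜ.orderEmbOfFin hl) g.1).1) :=
    fun g => levi_shuffle_conj hk hl g.1 _
  have hΛ : ∀ g, w⁻¹ * (Λ g).1 * w = g.1.1 := fun g => by
    change w⁻¹ * (w * g.1.1 * w⁻¹) * w = _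
    group
  have hcap : Fintype.card (capConj (UT F (k + l)) (maxParabolic F k l) w) =
      Fintype.card (UTstab F I) :=
    Fintype.card_congr (Equiv.subtypeEquivRight fun g => shuffle_conj_mem_iff hk hl g)
  -- Conjugation by the shuffle embeds the stabilizer of `I` into `P_{k,l}`; elements outside its
  -- image contribute zero.
  have hS : ∑ M : maxParabolic F k l with levi k l M = x,
      extendZero (UT F (k + l)) φ.1 (w⁻¹ * M.1 * w) =
      ∑ g : UTstab F I with levi k l (Λ g) = x, φ.1 g.1 := by
    refine (Finset.sum_of_injOn Λ ?_ ?_ ?_ ?_).symm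
    · intro g _ g' _ h
      refine Subtype.ext (Subtype.ext ?_)
      rw [← hΛ, ← hΛ, h]
    · intro g hg
      simpa using hg
    · intro M hM hM'
      rw [extendZero, dif_neg]
      intro h
      have hP : w * (⟨_, h⟩ : UT F (k + l)).1 * w⁻¹ = M.1 := by
        change w * (w⁻¹ * M.1 * w) * w⁻¹ = M.1
        group
      have hP' : w * (⟨_, h⟩ : UT F (k + l)).1 * w⁻¹ ∈ maxParabolic F k l := by
        rw [hP]
        exact M.2
      have hM2 : Λ ⟨⟨_, h⟩, (shuffle_conj_mem_iff hk hl ⟨_, h⟩).1 hP'⟩ = M := Subtype.ext hP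
      refine hM' ⟨_, ?_, hM2⟩
      simpa [hM2] using hM
    · intro g _
      rw [hΛ, extendZero_coe]
  obtain ⟨N, hN0, hN, hcard⟩ := card_UTstab (F := F) I hk hl
  rw [hS, hcap, hcard, Nat.cast_mul, mul_inv, mul_assoc]
  refine congrArg _ ?_
  -- The diagonal blocks of a stabilizer element are unipotent, so the fibre is empty unless `x`
  -- lies in the product of the `UT`s.
  by_cases hx : x ∈ (UT F k).prod (UT F l)
  · obtain ⟨a, b⟩ := x
    rw [extendZero, dif_pos hx, scfDeflate_apply, hN, div_eq_inv_mul]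
    refine congrArg _ (Finset.sum_congr (Finset.filter_congr fun g _ => ?_) fun _ _ => rfl)
    rw [hlevi]
    have h1 : UTstabProj I g = (utCast hk (utSub (I.orderEmbOfFin hk) g.1),
        utCast hl (utSub (Iᶜ.orderEmbOfFin hl) g.1)) := by
      refine Prod.ext (utCast_utSub _ _ _ ?_ _).symm (utCast_utSub _ _ _ ?_ _).symm
      · exact fun i => (Finset.orderEmbOfFin_eq_orderEmbOfFin_iff ..).2 rfl
      · exact fun i => (Finset.orderEmbOfFin_eq_orderEmbOfFin_iff ..).2 rfl
    rw [h1, Prod.mk.injEq, Prod.mk.injEq, (utCast_injective hk).eq_iff, (utCast_injective hl).eq_iff,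
      Subtype.ext_iff, Subtype.ext_iff]
  · rw [extendZero, dif_neg hx, Finset.sum_eq_zero, mul_zero]
    intro g hg
    refine (hx ?_).elim
    rw [← (Finset.mem_filter.1 hg).2, hlevi]
    exact ⟨(utSub _ g.1).2, (utSub _ g.1).2⟩

theorem cfGLDeflate_induce_UT (φ : scf F (k + l)) (g : GL (Fin k) F) (h : GL (Fin l) F) :
    (cfGLDeflate F k l (induce (UT F (k + l)) φ.1)).1 (g, h) =
      ∑ I : {I : Finset (Fin (k + l)) // I.card = k},
        (induce ((UT F k).prod (UT F l)) fun p => (scfDeflate F I.1 φ).1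
          (utCast I.2 ⟨p.1.1, p.2.1⟩, utCast (card_compl_of_card I.2) ⟨p.1.2, p.2.2⟩)).1 (g, h) := by
  have h1 : (cfGLDeflate F k l (induce (UT F (k + l)) φ.1)).1 (g, h) =
      deflate (levi k l) (fun p => (induce (UT F (k + l)) φ.1).1 p.1) (g, h) := rfl
  have h2 : ∀ u v : UT F (k + l), φ.1 (v * u * v⁻¹) = φ.1 u :=
    fun u v => (φ.2 _ _ (superSetoid_conj u v)).symm
  have h3 := deflate_induce (existsUnique_doubleCoset_shuffle (F := F) (k := k) (l := l)) (levi k l)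
    (levi_surjective k l) h2 (g, h)
  refine h1.trans (h3.trans ?_)
  refine Finset.sum_congr rfl fun I _ => ?_
  refine (Finset.mul_sum _ _ _).trans ((Finset.sum_congr rfl fun x _ => ?_).trans
    (Finset.mul_sum _ _ _).symm)
  refine (congrArg₂ (· * ·) (congrArg (fun n : ℕ => (n : ℂ)⁻¹) (Fintype.card_congr (Equiv.refl _)))
    (Finset.sum_congr (Finset.filter_congr_decidable ..) fun _ _ => rfl)).trans
      (shuffle_term I.2 (card_compl_of_card I.2) φ (x⁻¹ * (g, h) * x))

-- In bidegree `(k, l)` the Mackey terms correspond to the subsets `I` with `k` elements, and the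
-- remaining components of the superclass coproduct are not seen by evaluation in these degrees.
variable (F) in
theorem indUTGL_comul (x : ⨁ n, scf F n) : (cfGLHopf F).comul (indUTGL F x) =
    TensorProduct.map (indUTGL F) (indUTGL F) ((scfHopf F).comul x) := by
  refine LinearMap.congr_fun (f := (cfGLHopf F).comul ∘ₗ indUTGL F)
    (g := TensorProduct.map (indUTGL F) (indUTGL F) ∘ₗ (scfHopf F).comul)
    (DirectSum.linearMap_ext ℂ fun n => LinearMap.ext fun φ => ?_) x
  rw [LinearMap.comp_apply, LinearMap.comp_apply, LinearMap.comp_apply, LinearMap.comp_apply,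
    indUTGL_lof, scfHopf_comul_lof]
  refine Separating.eq_tmul (A := ⨁ n, cfGL F n) (B := ⨁ n, cfGL F n) (separating_evL F)
    (separating_evL F) ?_
  rintro ⟨k, g⟩ ⟨l, h⟩
  refine (evL₂_comul_lof n _ (Matrix.toLin' g.1) (Matrix.toLin' h.1)).trans ?_
  rw [map_sum, map_sum]
  have hzero : ∀ {c : ℕ} {k : ℕ} (g : GL (Fin k) F), c ≠ k →
      (evL (Matrix.toLin' g.1) ∘ₗ indUTGL F) ∘ₗ DirectSum.lof ℂ ℕ (fun n => scf F n) c = 0 := by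
    intro c k g hc
    refine LinearMap.ext fun ψ => ?_
    rw [LinearMap.comp_apply, LinearMap.comp_apply, indUTGL_lof]
    exact evL_lof_of_ne _ _ (by rw [Module.finrank_fin_fun]; exact hc.symm)
  have hterm : ∀ I : Finset (Fin n), tmulFun (A := ⨁ n, cfGL F n) (B := ⨁ n, cfGL F n)
      (evL (F := F) (Matrix.toLin' g.1)) (evL (F := F) (Matrix.toLin' h.1))
      (TensorProduct.map (indUTGL F) (indUTGL F)
        (TensorProduct.map (DirectSum.lof ℂ ℕ (fun n => scf F n) I.card)
          (DirectSum.lof ℂ ℕ (fun n => scf F n) Iᶜ.card)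
          ((extEquiv (superSetoid F I.card) (superSetoid F Iᶜ.card)).symm (scfDeflate F I φ)))) =
      tmulFun ((evL (Matrix.toLin' g.1) ∘ₗ indUTGL F) ∘ₗ
          DirectSum.lof ℂ ℕ (fun n => scf F n) I.card)
        ((evL (Matrix.toLin' h.1) ∘ₗ indUTGL F) ∘ₗ DirectSum.lof ℂ ℕ (fun n => scf F n) Iᶜ.card)
        ((extEquiv (superSetoid F I.card) (superSetoid F Iᶜ.card)).symm (scfDeflate F I φ)) := by
    intro I
    exact (tmulFun_map (M := ⨁ n, scf F n) (N := ⨁ n, scf F n) (M' := ⨁ n, cfGL F n)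
      (N' := ⨁ n, cfGL F n) _ _ _ _ _).trans
      (tmulFun_map (M' := ⨁ n, scf F n) (N' := ⨁ n, scf F n) _ _ _ _ _)
  refine Eq.trans ?_ (Finset.sum_congr rfl fun I _ => hterm I).symm
  by_cases hn : n = k + l
  · subst hn
    rw [← deflate_levi, cfGLDeflate_induce_UT, ← Finset.sum_subset (Finset.subset_univ
      (Finset.univ.filter fun I : Finset (Fin (k + l)) => I.card = k))]
    · rw [Finset.sum_subtype (p := fun I : Finset (Fin (k + l)) => I.card = k) _ (by simp)]
      refine Finset.sum_congr rfl fun I _ => (tmulFun_indUTGL _ _ g h _).symm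
    · intro I _ hI
      rw [hzero g (by simpa using hI), tmulFun_zero_left]
  · rw [Finset.sum_eq_zero, avgEv, Finset.sum_eq_zero, mul_zero]
    · intro c _
      refine ev_lofFam_of_ne _ _ ?_
      rw [Module.finrank_prod, Module.finrank_fin_fun, Module.finrank_fin_fun]
      exact Ne.symm hn
    · intro I _
      by_cases hk : I.card = k
      · have hl : Iᶜ.card ≠ l := by
          intro hl
          have := I.card_add_card_compl
          rw [Fintype.card_fin] at this
          omega
        rw [hzero h hl, tmulFun_zero_right]
      · rw [hzero g hk, tmulFun_zero_left]

end comul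

/-! ### The morphism of combinatorial Hopf algebras. -/

variable {F : Type*} [Field F] [Fintype F]

variable (F) in
theorem isGradedHopfHom_indUTGL : IsGradedHopfHom (scfHopf F) (cfGLHopf F) (indUTGL F) where
  map_mul := indUTGL_mul F
  map_unit := indUTGL_unit F
  map_comul := indUTGL_comul F
  map_counit := indUTGL_counit F
  map_mem n x := ⟨_, (indUTGL_lof n x).symm⟩

end

theorem theorem5p5 (F : Type*) [Field F] [Fintype F] :
    IsLinearCharacter (scfHopf F) (regFunctional F) ∧
    regFunctional F = stFunctional F ∘ₗ indUTGL F ∧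
    IsCHAMorphism (scfHopf F) (regFunctional F) (cfGLHopf F) (stFunctional F) (indUTGL F) :=
  ⟨isLinearCharacter_regFunctional F, regFunctional_eq F,
    { source := ⟨isGradedConnectedHopf_scfHopf F, isLinearCharacter_regFunctional F⟩
      target := ⟨isGradedConnectedHopf_cfGLHopf F, isLinearCharacter_stFunctional F⟩
      hom := isGradedHopfHom_indUTGL F
      character_comp := regFunctional_eq F }⟩
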